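/- Let $d,n,p\ge 1$ be integers and $\kappa,\rho\in[0,\infty)$. Let $Y_1,\dots,Y_n$ be independent continuous-time simple random walks on $\mathbb Z^d$ with step rate $2d\rho$ and right-continuous paths, all started at $0$, and put $\xi(x,t)=\#\{k: Y_k(t)=x\}$. Consider the parabolic Anderson model $$\frac{\partial}{\partial t}u(x,t)=\kappa\Delta u(x,t)+\xi(x,t)u(x,t),\qquad u(x,0)=1,\qquad x\in\mathbb Z^d,\ t\ge 0,$$ where $\Delta g(x)=\sum_{y\sim x}[g(y)-g(x)]$ is the discrete Laplacian. Here $u(x,\cdot)$ is continuous, $\partial/\partial t$ denotes the right derivative ($\xi$ jumps in time), and $u$ is bounded on $\mathbb Z^d\times[0,T]$ for every $T$. For every realization of $Y_1,\dots,Y_n$ there is exactly one such solution $u$. Its moments satisfy $0<\mathbb E[u(0,t)^p]<\infty$ for all $t\ge0$. For $(x,y)\in\mathbb Z^{dp}\times\mathbb Z^{dn}$, with $x=(x_1,\dots,x_p)$ and $y=(y_1,\dots,y_n)$, let $I_p(x,y)=\sum_{j=1}^p\sum_{k=1}^n\delta_0(x_j-y_k)$. For real $f\in l^2(\mathbb Z^{dp}\times\mathbb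 Z^{dn})$ let $\nabla_xf$ (resp. $\nabla_yf$) be the vector of all forward differences of $f$ in the $dp$ coordinates of $x$ (resp. the $dn$ coordinates of $y$), let $\Delta_x=\sum_{j}\Delta_{x_j}$ and $\Delta_y=\sum_k\Delta_{y_k}$, and let $\mathcal L_p f=\kappa\Delta_xf+\rho\Delta_yf+I_pf$, a bounded self-adjoint operator on $l^2(\mathbb Z^{dp}\times\mathbb Z^{dn})$. Then the limit $$\lambda_p^{(n)}(\kappa,\rho)=\lim_{t\to\infty}\frac1{pt}\log\mathbb E\big[u(0,t)^p\big]$$ exists and is finite, and $$\lambda_p^{(n)}(\kappa,\rho)=\frac1p\,\sup_{f\in l^2(\mathbb Z^{dp}\times\mathbb Z^{dn}),\ \|f\|_2=1}\Big\{-\kappa\|\nabla_xf\|_2^2-\rho\|\nabla_yf\|_2^2+\sum_{(x,y)}I_p(x,y)f(x,y)^2\Big\}.$$ Moreover, this supremum (without the factor $1/p$) is the largest element of the spectrum of $\mathcal L_p$. -/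

import Mathlib

open MeasureTheory ProbabilityTheory Filter Topology
open scoped NNReal ENNReal

noncomputable section

namespace PAM

/-- The lattice `ℤ^d`. -/
abbrev Lattice (d : ℕ) : Type := Fin d → ℤ

/-- The `i`-th canonical basis vector of `ℤ^d`. -/
def basisVec {d : ℕ} (i : Fin d) : Lattice d := Pi.single i 1

/-- The discrete Laplacian on `ℤ^d`: the sum of `g y - g x` over the `2d` nearest neighbours
`y = x ± e_i` of `x`. -/
def laplacian {d : ℕ} (g : Lattice d → ℝ) (x : Lattice d) : ℝ :=
  ∑ i : Fin d, ((g (x + basisVec i) - g x) + (g (x - basisVec i) - g x))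

/-! ### Simple random walk in continuous time -/

/-- The uniform distribution on the `2d` unit vectors `± e_i`. -/
def stepPMF (d : ℕ) [NeZero d] : PMF (Lattice d) :=
  (PMF.uniformOfFintype (Fin d × Bool)).map
    fun a => if a.2 then basisVec a.1 else -basisVec a.1

/-- The distribution of the discrete-time simple random walk from `0` after `m` steps. -/
def walkPMF (d : ℕ) [NeZero d] : ℕ → PMF (Lattice d)
  | 0 => PMF.pure 0
  | m + 1 => (walkPMF d m).bind fun x => (stepPMF d).map fun e => x + e

/-- The distribution of the displacement of the simple random walk after a Poisson number of steps
with mean `r`. -/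
def displacementLaw (d : ℕ) [NeZero d] (r : ℝ≥0) : Measure (Lattice d) :=
  (poissonMeasure r).bind fun m => (walkPMF d m).toMeasure

/-- `Z` is a continuous-time simple random walk on `ℤ^d` with step rate `2dν` started at `0`: it has
right-continuous paths and independent increments, and on a time interval of length `h` it performs
a Poisson number of simple random walk steps, with mean `2dνh`. -/
structure IsSimpleRandomWalk {d : ℕ} [NeZero d] {Ω : Type*} [MeasurableSpace Ω] (P : Measure Ω)
    (ν : ℝ≥0) (Z : ℝ≥0 → Ω → Lattice d) : Prop where
  measurable : ∀ t, Measurable (Z t)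
  rightContinuous : ∀ ω t, ContinuousWithinAt (fun s => Z s ω) (Set.Ici t) t
  start : ∀ᵐ ω ∂P, Z 0 ω = 0
  indepIncrements : HasIndepIncrements Z P
  law : ∀ s t, s ≤ t → HasLaw (Z t - Z s) (displacementLaw d (2 * d * ν * (t - s))) P

/-! ### The parabolic Anderson equation -/

/-- The catalytic medium `ξ(x,t)`: the number of `k` with `Y_k(t) = x`, along a realization `y` of
the catalysts. -/
def catalysts {d n : ℕ} (y : Fin n → ℝ≥0 → Lattice d) (x : Lattice d) (t : ℝ) : ℝ :=
  ∑ k : Fin n, if y k t.toNNReal = x then 1 else 0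

/-- `u` is a solution on `ℤ^d × [0,∞)` of `∂u/∂t = κ Δu + ξ u`, `u(·,0) = 1`. As `ξ` is
right-continuous with jumps in time, `∂/∂t` is the right derivative of a continuous function.
Solutions are taken in the usual class of functions that are bounded on `ℤ^d × [0,T]` for
every `T`. -/
structure IsSolution {d : ℕ} (κ : ℝ≥0) (ξ : Lattice d → ℝ → ℝ) (u : Lattice d → ℝ → ℝ) :
    Prop where
  initial : ∀ x, u x 0 = 1
  continuousOn : ∀ x, ContinuousOn (u x) (Set.Ici 0)
  equation : ∀ x t, 0 ≤ t → HasDerivWithinAt (u x)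
    (κ * laplacian (fun z => u z t) x + ξ x t * u x t) (Set.Ici t) t
  locallyBounded : ∀ T : ℝ, ∃ C : ℝ, ∀ x, ∀ t ∈ Set.Icc 0 T, |u x t| ≤ C

/-! ### The variational problem and the operator -/

/-- The configurations `(x, y) ∈ ℤ^{dp} × ℤ^{dn}`. -/
abbrev Config (d n p : ℕ) : Type := (Fin p → Lattice d) × (Fin n → Lattice d)

/-- The real Hilbert space `l²(ℤ^{dp} × ℤ^{dn})`. -/
abbrev L2 (d n p : ℕ) : Type := lp (fun _ : Config d n p => ℝ) 2

/-- The unit vector in the direction `e_i` of the coordinate `x_j`. -/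
def xVec {d n p : ℕ} (j : Fin p) (i : Fin d) : Config d n p := (Pi.single j (basisVec i), 0)

/-- The unit vector in the direction `e_i` of the coordinate `y_k`. -/
def yVec {d n p : ℕ} (k : Fin n) (i : Fin d) : Config d n p := (0, Pi.single k (basisVec i))

/-- `I_p(x,y)`, the number of pairs `(j,k)` with `x_j = y_k`. -/
def interaction {d n p : ℕ} (z : Config d n p) : ℝ :=
  ∑ j : Fin p, ∑ k : Fin n, if z.1 j - z.2 k = 0 then 1 else 0

/-- `‖∇_x f‖₂²`. -/
def gradXSq {d n p : ℕ} (f : Config d n p → ℝ) : ℝ :=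
  ∑' z : Config d n p, ∑ j : Fin p, ∑ i : Fin d, (f (z + xVec j i) - f z) ^ 2

/-- `‖∇_y f‖₂²`. -/
def gradYSq {d n p : ℕ} (f : Config d n p → ℝ) : ℝ :=
  ∑' z : Config d n p, ∑ k : Fin n, ∑ i : Fin d, (f (z + yVec k i) - f z) ^ 2

/-- The functional `-κ ‖∇_x f‖₂² - ρ ‖∇_y f‖₂² + ∑ I_p f²`. -/
def energy {d n p : ℕ} (κ ρ : ℝ≥0) (f : Config d n p → ℝ) : ℝ :=
  -κ * gradXSq f - ρ * gradYSq f + ∑' z : Config d n p, interaction z * f z ^ 2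

/-- `Δ_x f = ∑_j Δ_{x_j} f`. -/
def laplacianX {d n p : ℕ} (f : Config d n p → ℝ) (z : Config d n p) : ℝ :=
  ∑ j : Fin p, ∑ i : Fin d, ((f (z + xVec j i) - f z) + (f (z - xVec j i) - f z))

/-- `Δ_y f = ∑_k Δ_{y_k} f`. -/
def laplacianY {d n p : ℕ} (f : Config d n p → ℝ) (z : Config d n p) : ℝ :=
  ∑ k : Fin n, ∑ i : Fin d, ((f (z + yVec k i) - f z) + (f (z - yVec k i) - f z))

/-- Translation `(T_a f)(z) = f(z + a)` on `l²`. -/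
def translation {d n p : ℕ} (a : Config d n p) : L2 d n p →L[ℝ] L2 d n p :=
  LinearMap.mkContinuous
    { toFun := fun f => ⟨fun z => f (z + a), by
        have h := (lp.memℓp f).summable (by norm_num)
        exact memℓp_gen ((Equiv.addRight a).summable_iff.mpr h)⟩
      map_add' := fun f g => rfl
      map_smul' := fun c f => rfl }
    1 (by
      intro f
      refine lp.norm_le_of_tsum_le (by norm_num) (by positivity) (le_of_eq ?_)
      rw [one_mul, lp.norm_rpow_eq_tsum (by norm_num)]
      exact (Equiv.addRight a).tsum_eq (fun z => ‖f z‖ ^ (2 : ℝ≥0∞).toReal))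

theorem abs_interaction_le {d n p : ℕ} (z : Config d n p) : ‖interaction z‖ ≤ (p : ℝ) * n := by
  unfold interaction
  refine (norm_sum_le _ _).trans ?_
  calc _ ≤ ∑ _j : Fin p, (n : ℝ) := by
        refine Finset.sum_le_sum fun j _ => (norm_sum_le _ _).trans ?_
        calc _ ≤ ∑ _k : Fin n, (1 : ℝ) :=
              Finset.sum_le_sum fun k _ => by split_ifs <;> simp
          _ = n := by simp
    _ = _ := by simp

/-- Multiplication by `I_p` on `l²`. -/
def interactionMul (d n p : ℕ) : L2 d n p →L[ℝ] L2 d n p :=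
  LinearMap.mkContinuous
    { toFun := fun f => ⟨fun z => interaction z * f z,
        ((lp.memℓp f).const_smul ((p : ℝ) * n)).mono' (fun z => by
          have h := abs_interaction_le z
          have h0 : (0 : ℝ) ≤ (p : ℝ) * n := by positivity
          rw [Pi.smul_apply, norm_mul, norm_smul, Real.norm_of_nonneg h0]
          gcongr)⟩
      map_add' := fun f g => by ext z; exact mul_add _ _ _
      map_smul' := fun c f => by ext z; exact mul_left_comm _ _ _ }
    ((p : ℝ) * n) (by
      intro f
      have h0 : (0 : ℝ) ≤ (p : ℝ) * n := by positivity
      have h1 : ‖((p : ℝ) * n) • f‖ = (p : ℝ) * n * ‖f‖ := by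
        rw [lp.norm_const_smul (by norm_num), Real.norm_of_nonneg h0]
      refine le_trans (lp.norm_mono (by norm_num) fun z => ?_) h1.le
      have h := abs_interaction_le z
      change ‖interaction z * f z‖ ≤ ‖((p : ℝ) * n) • f z‖
      rw [norm_mul, norm_smul, Real.norm_of_nonneg h0]
      gcongr)

/-- The bounded operator `L_p = κ Δ_x + ρ Δ_y + I_p` on `l²(ℤ^{dp} × ℤ^{dn})`. -/
def andersonOp (d n p : ℕ) (κ ρ : ℝ≥0) : L2 d n p →L[ℝ] L2 d n p :=
  (κ : ℝ) • (∑ j : Fin p, ∑ i : Fin d,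
      ((translation (xVec j i) - ContinuousLinearMap.id ℝ (L2 d n p)) +
        (translation (-xVec j i) - ContinuousLinearMap.id ℝ (L2 d n p)))) +
    (ρ : ℝ) • (∑ k : Fin n, ∑ i : Fin d,
      ((translation (yVec k i) - ContinuousLinearMap.id ℝ (L2 d n p)) +
        (translation (-yVec k i) - ContinuousLinearMap.id ℝ (L2 d n p)))) +
    interactionMul d n p

/-- The pointwise formula for `L_p f`. -/
theorem andersonOp_apply {d n p : ℕ} (κ ρ : ℝ≥0) (f : L2 d n p) (z : Config d n p) :
    andersonOp d n p κ ρ f z =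
      κ * laplacianX f z + ρ * laplacianY f z + interaction z * f z := by
  simp only [andersonOp, laplacianX, laplacianY, _root_.add_apply,
    _root_.smul_apply, _root_.sum_apply, lp.coeFn_add, lp.coeFn_smul,
    lp.coeFn_sum, _root_.sub_apply, lp.coeFn_sub, Pi.add_apply, Pi.smul_apply,
    Finset.sum_apply, Pi.sub_apply, smul_eq_mul, ContinuousLinearMap.id_apply, sub_eq_add_neg z]
  rfl

end PAM

end

open MeasureTheory ProbabilityTheory Filter Topology
open scoped NNReal ENNReal

noncomputable section

namespace PAM

/-! Let `moment` be m_t(x,y) = 𝔼[∏_j u(x_j,t); Y(t) = y]. The product rule for the p factors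
contributes κΔ_x + I_p, because on {Y(t) = y} the medium at the sites x_j adds up to I_p(x,y). The
Markov property of the catalysts contributes ρΔ_y. Hence ∂m/∂t = L_p m with m_0 = 1{y = 0}
(`hasDerivWithinAt_moment`, `moment_zero`), and 𝔼[u(0,t)^p] is the sum of m_t(0,y) over y
(`hasSum_moment`). What remains is the exponential growth of this evolution; the obstacle is that
m_0 is not in l², and neither is the functional "sum over y at x = 0".

Both defects disappear after conjugation with the weight exp(θ(|y|₁ - |x|₁)), θ > 0: the weighted
initial condition is in l², and undoing the weight at x = 0 leaves the summable factor exp(-θ|y|₁).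
A bounded solution dominated by the weights is unique, so m is given by the semigroup of the
conjugated operator (`eq_exp_tiltedOp_apply`, `moment_eq`). That operator differs from L_p in norm
by O(exp|θ| - 1) (`norm_tiltedOp_sub_le`), so its quadratic form is at most S + ε for small θ, where
S is the supremum of the form of L_p. This is the upper bound `exists_integral_sol_pow_le`.

For the lower bound, positivity permits cutting the initial condition and the final sum down to
finite sets, which leaves ⟨χ₁, exp(tL_p) χ₂⟩. Unit time at either end spreads χ₁ and χ₂ above
multiples of a nonnegative, finitely supported near-maximizer g, and convexity gives ⟨g, exp(sL_p)
g⟩ ≥ exp(bs)‖g‖² (`exp_mul_norm_sq_le_inner_exp`). If κ = 0 or ρ = 0 nothing spreads in x or in y;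
then `exists_frozen_test` supplies a near-maximizer whose immobile particles all sit at 0.

Summation by parts identifies the variational functional with the form of L_p (`energy_eq_inner`),
and for a bounded self-adjoint operator the supremum of the form is the top of the spectrum. -/

variable {d n p : ℕ}

/-! ### Bounded self-adjoint operators on a real Hilbert space and their exponentials -/

section Hilbert

variable {H : Type*} [NormedAddCommGroup H] [InnerProductSpace ℝ H]

theorem inner_apply_le_mul_norm_sq {T : H →L[ℝ] H} {S : ℝ}
    (hS : ∀ f : H, ‖f‖ = 1 → inner ℝ f (T f) ≤ S) (f : H) :
    inner ℝ f (T f) ≤ S * ‖f‖ ^ 2 := by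
  by_cases hf : f = 0
  · simp [hf]
  have hf' : 0 < ‖f‖ := norm_pos_iff.2 hf
  have h := hS (‖f‖⁻¹ • f) (norm_smul_inv_norm hf)
  simp only [map_smul, inner_smul_left, inner_smul_right, conj_trivial] at h
  rw [← mul_assoc, ← mul_inv, ← pow_two, inv_mul_le_iff₀ (by positivity)] at h
  linarith

variable [CompleteSpace H]

/-- A nonnegative symmetric form satisfies `‖T f‖² ≤ ‖T‖ ⟨f, T f⟩`. -/
theorem norm_sq_apply_le_of_nonneg {T : H →L[ℝ] H} (hT : IsSelfAdjoint T)
    (hpos : ∀ f, 0 ≤ inner ℝ f (T f)) (f : H) :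
    ‖T f‖ ^ 2 ≤ ‖T‖ * inner ℝ f (T f) := by
  have hsymm := hT.isSymmetric
  -- The form is evaluated at f + s T f; afterwards s = -1/‖T‖ minimizes the resulting quadratic in
  -- s.
  have key : ∀ s : ℝ, 0 ≤ inner ℝ f (T f) + 2 * s * ‖T f‖ ^ 2 + s ^ 2 * (‖T‖ * ‖T f‖ ^ 2) := by
    intro s
    have h := hpos (f + s • T f)
    have h1 : inner ℝ (T f) (T (T f)) ≤ ‖T‖ * ‖T f‖ ^ 2 := by
      calc _ ≤ ‖T f‖ * ‖T (T f)‖ := real_inner_le_norm _ _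
        _ ≤ ‖T f‖ * (‖T‖ * ‖T f‖) := by gcongr; exact T.le_opNorm _
        _ = _ := by ring
    have h2 : inner ℝ f (T (T f)) = ‖T f‖ ^ 2 := by
      rw [← real_inner_self_eq_norm_sq]; exact (hsymm f (T f)).symm
    simp only [map_add, map_smul, inner_add_left, inner_add_right, inner_smul_left,
      inner_smul_right, h2, real_inner_self_eq_norm_sq, conj_trivial] at h
    nlinarith [mul_le_mul_of_nonneg_left h1 (sq_nonneg s)]
  rcases (norm_nonneg T).eq_or_lt with h0 | h0
  · have : T = 0 := by rwa [eq_comm, norm_eq_zero] at h0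
    simp [this]
  · have h := key (-‖T‖⁻¹)
    have e : inner ℝ f (T f) + 2 * (-‖T‖⁻¹) * ‖T f‖ ^ 2 + (-‖T‖⁻¹) ^ 2 * (‖T‖ * ‖T f‖ ^ 2)
        = inner ℝ f (T f) - ‖T‖⁻¹ * ‖T f‖ ^ 2 := by field_simp; ring
    rw [e] at h
    have h3 := mul_le_mul_of_nonneg_left (sub_nonneg.1 h) h0.le
    rwa [← mul_assoc, mul_inv_cancel₀ h0.ne', one_mul] at h3

/-- The supremum of the numerical range of a bounded self-adjoint operator is the largest element
of its spectrum. -/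
theorem isGreatest_spectrum_of_isLUB {T : H →L[ℝ] H} (hT : IsSelfAdjoint T) {S : ℝ}
    (hS : IsLUB {r : ℝ | ∃ f : H, ‖f‖ = 1 ∧ r = inner ℝ f (T f)} S) :
    IsGreatest (spectrum ℝ T) S := by
  have hle : ∀ f, inner ℝ f (T f) ≤ S * ‖f‖ ^ 2 :=
    inner_apply_le_mul_norm_sq fun f hf => hS.1 ⟨f, hf, rfl⟩
  constructor
  · rw [spectrum.mem_iff]
    rintro ⟨u, hu⟩
    -- If R = S - T had an inverse V, a unit vector f would satisfy 1 ≤ ‖V‖²‖R f‖² ≤ ‖V‖²‖R‖ (S -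
    -- ⟨f, T f⟩). So the numerical range would stay a fixed distance below S, although S is its
    -- supremum.
    set R : H →L[ℝ] H := algebraMap ℝ (H →L[ℝ] H) S - T with hR
    have hRsa : IsSelfAdjoint R := by
      refine IsSelfAdjoint.sub ?_ hT
      exact IsSelfAdjoint.algebraMap _ (IsSelfAdjoint.all S)
    have hRapp : ∀ f, R f = S • f - T f := fun f => by simp [hR, Algebra.algebraMap_eq_smul_one]
    have hRq : ∀ f, inner ℝ f (R f) = S * ‖f‖ ^ 2 - inner ℝ f (T f) := fun f => by
      rw [hRapp, inner_sub_right, inner_smul_right, real_inner_self_eq_norm_sq]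
    have hpos : ∀ f, 0 ≤ inner ℝ f (R f) := fun f => by rw [hRq]; linarith [hle f]
    set V : H →L[ℝ] H := ((u⁻¹ : (H →L[ℝ] H)ˣ) : H →L[ℝ] H) with hV
    have hVR : ∀ f, V (R f) = f := fun f => by
      have : V * R = 1 := by rw [hV, ← hu]; simp
      simpa using congrArg (fun A : H →L[ℝ] H => A f) this
    obtain ⟨r, ⟨f0, hf0, rfl⟩⟩ := hS.nonempty
    have hbound : ∀ f : H, ‖f‖ = 1 →
        1 ≤ ‖V‖ ^ 2 * (‖R‖ * (S - inner ℝ f (T f))) := by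
      intro f hf
      have h1 := norm_sq_apply_le_of_nonneg hRsa hpos f
      rw [hRq, hf] at h1
      have h2 : 1 ≤ ‖V‖ * ‖R f‖ := by
        calc 1 = ‖V (R f)‖ := by rw [hVR, hf]
          _ ≤ _ := V.le_opNorm _
      calc (1 : ℝ) = 1 ^ 2 := by norm_num
        _ ≤ (‖V‖ * ‖R f‖) ^ 2 := by gcongr
        _ = ‖V‖ ^ 2 * ‖R f‖ ^ 2 := by ring
        _ ≤ _ := by gcongr; simpa using h1
    set K := ‖V‖ ^ 2 * ‖R‖ with hK
    have hK0 : 0 < K := by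
      have h := hbound f0 hf0
      rw [← mul_assoc, ← hK] at h
      rcases (show 0 ≤ K by positivity).eq_or_lt with h0 | h0
      · rw [← h0] at h; linarith
      · exact h0
    have hub : S - K⁻¹ ∈ upperBounds {r : ℝ | ∃ f : H, ‖f‖ = 1 ∧ r = inner ℝ f (T f)} := by
      rintro _ ⟨f, hf, rfl⟩
      have h := hbound f hf
      rw [← mul_assoc, ← hK] at h
      have : K⁻¹ ≤ S - inner ℝ f (T f) := by
        rw [inv_le_iff_one_le_mul₀' hK0]; exact h
      linarith
    have := hS.2 hub
    have : 0 < K⁻¹ := inv_pos.2 hK0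
    linarith
  · intro l hl
    by_contra! hlt
    apply hl
    -- Lax–Milgram: for l > S the form of l - T is coercive with constant l - S, so l - T is
    -- invertible.
    let B : H →L[ℝ] H →L[ℝ] ℝ := (innerSL ℝ).comp (algebraMap ℝ (H →L[ℝ] H) l - T)
    have hBapp : ∀ f g, B f g = l * inner ℝ f g - inner ℝ (T f) g := fun f g => by
      simp [B, Algebra.algebraMap_eq_smul_one]
    have hco : IsCoercive B := by
      refine ⟨l - S, by linarith, fun f => ?_⟩
      rw [hBapp, real_inner_self_eq_norm_sq, real_inner_comm]
      nlinarith [hle f]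
    let e := hco.continuousLinearEquivOfBilin
    have he : (e : H →L[ℝ] H) = algebraMap ℝ (H →L[ℝ] H) l - T := by
      ext f
      refine ext_inner_right ℝ fun g => ?_
      exact hco.continuousLinearEquivOfBilin_apply f g
    rw [resolventSet, Set.mem_ofPred_eq, ← he]
    exact (ContinuousLinearEquiv.unitsEquiv ℝ H).symm e |>.isUnit

/-- If `⟨f, A f⟩ ≤ β ‖f‖²` then `‖exp(tA) g‖ ≤ exp(βt) ‖g‖`. -/
theorem norm_exp_smul_apply_le {A : H →L[ℝ] H} {β : ℝ}
    (hA : ∀ f, inner ℝ f (A f) ≤ β * ‖f‖ ^ 2) (g : H) {t : ℝ} (ht : 0 ≤ t) :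
    ‖NormedSpace.exp (t • A) g‖ ≤ Real.exp (β * t) * ‖g‖ := by
  -- The bound says that exp(-2βs)‖exp(sA)g‖² does not increase.
  let φ : ℝ → ℝ := fun s => Real.exp (-(2 * β) * s) * ‖NormedSpace.exp (s • A) g‖ ^ 2
  have hE : ∀ s, HasDerivAt (fun s : ℝ => NormedSpace.exp (s • A) g)
      (A (NormedSpace.exp (s • A) g)) s := fun s => by
    have h := hasDerivAt_exp_smul_const' (𝕂 := ℝ) A s
    exact (ContinuousLinearMap.apply ℝ H g).hasFDerivAt.comp_hasDerivAt s h
  have hφ : ∀ s, HasDerivAt φ (Real.exp (-(2 * β) * s) * (-(2 * β)) *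
      ‖NormedSpace.exp (s • A) g‖ ^ 2 + Real.exp (-(2 * β) * s) *
        (2 * inner ℝ (NormedSpace.exp (s • A) g) (A (NormedSpace.exp (s • A) g)))) s := fun s => by
    refine HasDerivAt.mul ?_ (hE s).norm_sq
    have : HasDerivAt (fun s : ℝ => -(2 * β) * s) (-(2 * β)) s := by
      simpa using (hasDerivAt_id s).const_mul (-(2 * β))
    exact this.exp
  have hanti : Antitone φ := by
    refine antitone_of_deriv_nonpos (fun s => (hφ s).differentiableAt) fun s => ?_
    rw [(hφ s).deriv]
    have := hA (NormedSpace.exp (s • A) g)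
    have h2 := Real.exp_pos (-(2 * β) * s)
    nlinarith
  have h := hanti ht
  simp only [φ, mul_zero, Real.exp_zero, one_mul, zero_smul, NormedSpace.exp_zero,
    one_apply_eq_self] at h
  have hsq : ‖NormedSpace.exp (t • A) g‖ ^ 2 ≤ (Real.exp (β * t) * ‖g‖) ^ 2 := by
    have e : (Real.exp (β * t) * ‖g‖) ^ 2 = Real.exp (2 * β * t) * ‖g‖ ^ 2 := by
      rw [mul_pow, ← Real.exp_nat_mul]; congr 2; push_cast; ring
    rw [e]
    have e2 : Real.exp (2 * β * t) * Real.exp (-(2 * β) * t) = 1 := by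
      rw [← Real.exp_add]; simp
    calc _ = Real.exp (2 * β * t) * Real.exp (-(2 * β) * t) * ‖NormedSpace.exp (t • A) g‖ ^ 2 := by
          rw [e2, one_mul]
      _ ≤ _ := by rw [mul_assoc]; gcongr
  exact le_of_sq_le_sq hsq (by positivity)

theorem exp_smul_add_algebraMap (A : H →L[ℝ] H) (c t : ℝ) :
    NormedSpace.exp (t • (A + c • (1 : H →L[ℝ] H))) =
      Real.exp (c * t) • NormedSpace.exp (t • A) := by
  have h : t • (A + c • (1 : H →L[ℝ] H)) = t • A + algebraMap ℝ (H →L[ℝ] H) (c * t) := by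
    rw [smul_add, Algebra.algebraMap_eq_smul_one, smul_smul, mul_comm]
  let _ : NormedAlgebra ℚ (H →L[ℝ] H) := NormedAlgebra.restrictScalars ℚ ℝ _
  rw [h, NormedSpace.exp_add_of_commute (Algebra.commute_algebraMap_right _ _),
    ← NormedSpace.algebraMap_exp_comm, ← Real.exp_eq_exp_ℝ, Algebra.algebraMap_eq_smul_one]
  simp

theorem exp_smul_mul_exp_smul (A : H →L[ℝ] H) (s t : ℝ) :
    NormedSpace.exp (s • A) * NormedSpace.exp (t • A) = NormedSpace.exp ((s + t) • A) := by
  let _ : NormedAlgebra ℚ (H →L[ℝ] H) := NormedAlgebra.restrictScalars ℚ ℝ _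
  rw [add_smul, NormedSpace.exp_add_of_commute]
  exact ((Commute.refl A).smul_left s).smul_right t

theorem inner_exp_smul_comm {A : H →L[ℝ] H} (hA : IsSelfAdjoint A) (t : ℝ) (f g : H) :
    inner ℝ (NormedSpace.exp (t • A) f) g = inner ℝ f (NormedSpace.exp (t • A) g) := by
  have : IsSelfAdjoint (NormedSpace.exp (t • A)) :=
    (IsSelfAdjoint.smul (IsSelfAdjoint.all t) hA).exp
  exact this.isSymmetric f g

/-- If `A` is self-adjoint and `a ‖f‖² ≤ ⟨f, A f⟩` then
`exp(at) ‖f‖² ≤ ⟨f, exp(tA) f⟩`. -/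
theorem exp_mul_norm_sq_le_inner_exp {A : H →L[ℝ] H} (hA : IsSelfAdjoint A) {a : ℝ} {f : H}
    (hf : a * ‖f‖ ^ 2 ≤ inner ℝ f (A f)) {t : ℝ} (ht : 0 ≤ t) :
    -- After the shift B = A - a the function q(s) = ⟨f, exp(sB) f⟩ has q'(0) ≥ 0 and q'' ≥ 0, so it
    -- increases on [0,∞). This replaces Jensen's inequality for the spectral measure of f.
    Real.exp (a * t) * ‖f‖ ^ 2 ≤ inner ℝ f (NormedSpace.exp (t • A) f) := by
  set B : H →L[ℝ] H := A + (-a) • (1 : H →L[ℝ] H) with hBdef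
  have hB : IsSelfAdjoint B :=
    hA.add (IsSelfAdjoint.smul (IsSelfAdjoint.all _) (IsSelfAdjoint.one _))
  have hBf : 0 ≤ inner ℝ f (B f) := by
    simp only [hBdef, _root_.add_apply, _root_.smul_apply,
      one_apply_eq_self, inner_add_right, inner_smul_right,
      real_inner_self_eq_norm_sq]
    linarith
  have hE : ∀ (g : H) (s : ℝ), HasDerivAt (fun s : ℝ => NormedSpace.exp (s • B) g)
      (NormedSpace.exp (s • B) (B g)) s := fun g s => by
    have h := hasDerivAt_exp_smul_const (𝕂 := ℝ) B s
    exact (ContinuousLinearMap.apply ℝ H g).hasFDerivAt.comp_hasDerivAt s h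
  have hq : ∀ (g : H) (s : ℝ), HasDerivAt (fun s : ℝ => inner ℝ f (NormedSpace.exp (s • B) g))
      (inner ℝ f (NormedSpace.exp (s • B) (B g))) s := fun g s =>
    (innerSL ℝ f).hasFDerivAt.comp_hasDerivAt s (hE g s)
  have hcomm : ∀ (s : ℝ) (g : H), B (NormedSpace.exp (s • B) g) =
      NormedSpace.exp (s • B) (B g) := fun s g => by
    have : Commute B (NormedSpace.exp (s • B)) :=
      ((Commute.refl B).smul_right s).exp_right
    exact congrArg (fun T : H →L[ℝ] H => T g) this.eq
  have hmono1 : Monotone fun s : ℝ => inner ℝ f (NormedSpace.exp (s • B) (B f)) := by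
    refine monotone_of_deriv_nonneg (fun s => (hq _ s).differentiableAt) fun s => ?_
    rw [(hq _ s).deriv]
    -- q'' is a square: half of the semigroup and one factor B move to the left side of the inner
    -- product.
    have h2 : inner ℝ f (NormedSpace.exp (s • B) (B (B f))) =
        ‖NormedSpace.exp ((s / 2) • B) (B f)‖ ^ 2 := by
      have e : NormedSpace.exp (s • B) = NormedSpace.exp ((s / 2) • B) *
          NormedSpace.exp ((s / 2) • B) := by
        rw [exp_smul_mul_exp_smul]; congr 2; ring
      rw [← real_inner_self_eq_norm_sq, inner_exp_smul_comm hB, e]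
      rw [mul_apply_eq_comp, ← hcomm, ← hcomm]
      exact (hB.isSymmetric f _).symm
    rw [h2]; positivity
  have hmono : MonotoneOn (fun s : ℝ => inner ℝ f (NormedSpace.exp (s • B) f)) (Set.Ici 0) := by
    refine monotoneOn_of_deriv_nonneg (convex_Ici 0)
      (fun s _ => (hq f s).continuousAt.continuousWithinAt)
      (fun s _ => (hq f s).differentiableAt.differentiableWithinAt) fun s hs => ?_
    rw [(hq f s).deriv]
    rw [interior_Ici, Set.mem_Ioi] at hs
    have := hmono1 hs.le
    simp only [zero_smul, NormedSpace.exp_zero, one_apply_eq_self] at this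
    linarith
  have h := hmono (Set.mem_Ici.2 le_rfl) (Set.mem_Ici.2 ht) ht
  simp only [zero_smul, NormedSpace.exp_zero, one_apply_eq_self,
    real_inner_self_eq_norm_sq] at h
  rw [hBdef, exp_smul_add_algebraMap, _root_.smul_apply, inner_smul_right] at h
  have e2 : Real.exp (a * t) * Real.exp (-a * t) = 1 := by rw [← Real.exp_add]; simp
  calc _ ≤ Real.exp (a * t) * (Real.exp (-a * t) * inner ℝ f (NormedSpace.exp (t • A) f)) := by
        gcongr
    _ = _ := by rw [← mul_assoc, e2, one_mul]

end Hilbert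

/-! ### The generator as a finite sum over directions -/

/-- The signed coordinate directions of the configuration space. -/
abbrev Dir (d n p : ℕ) : Type := (Fin p × Fin d ⊕ Fin n × Fin d) × Bool

/-- The unit vector of an unsigned direction. -/
def unitVec (q : Fin p × Fin d ⊕ Fin n × Fin d) : Config d n p :=
  q.elim (fun q => xVec q.1 q.2) (fun q => yVec q.1 q.2)

/-- The displacement of a direction. -/
def shift (a : Dir d n p) : Config d n p := if a.2 then unitVec a.1 else -unitVec a.1

/-- The jump rate of a direction. -/
def rate (κ ρ : ℝ≥0) (a : Dir d n p) : ℝ := a.1.elim (fun _ => (κ : ℝ)) (fun _ => (ρ : ℝ))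

theorem rate_nonneg (κ ρ : ℝ≥0) (a : Dir d n p) : 0 ≤ rate κ ρ a := by
  rcases a with ⟨q | q, b⟩ <;> simp [rate]

theorem sum_dir (F : Dir d n p → ℝ) :
    ∑ a, F a = (∑ j : Fin p, ∑ i : Fin d, (F (.inl (j, i), true) + F (.inl (j, i), false))) +
      ∑ k : Fin n, ∑ i : Fin d, (F (.inr (k, i), true) + F (.inr (k, i), false)) := by
  simp [Fintype.sum_prod_type, Fintype.sum_sum_type]

theorem laplacian_add_interaction_eq (κ ρ : ℝ≥0) (f : Config d n p → ℝ) (z : Config d n p) :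
    κ * laplacianX f z + ρ * laplacianY f z + interaction z * f z =
      ∑ a, rate κ ρ a * (f (z + shift a) - f z) + interaction z * f z := by
  rw [sum_dir]
  simp only [laplacianX, laplacianY, Finset.mul_sum, rate, shift, unitVec, Sum.elim_inl,
    Sum.elim_inr, if_true, Bool.false_eq_true, if_false, mul_add, sub_eq_add_neg z]

/-- The total jump rate. -/
def totalRate (d n p : ℕ) (κ ρ : ℝ≥0) : ℝ := ∑ a : Dir d n p, rate κ ρ a

theorem totalRate_nonneg (κ ρ : ℝ≥0) : 0 ≤ totalRate d n p κ ρ :=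
  Finset.sum_nonneg fun a _ => rate_nonneg κ ρ a

theorem interaction_nonneg (z : Config d n p) : 0 ≤ interaction z :=
  Finset.sum_nonneg fun _ _ => Finset.sum_nonneg fun _ _ => by split_ifs <;> simp

theorem interaction_le (z : Config d n p) : interaction z ≤ (p : ℝ) * n :=
  (le_abs_self _).trans (abs_interaction_le z)

/-! ### Multiplication operators -/

/-- Multiplication by a bounded function on `l²`. -/
def mulOp (b : Config d n p → ℝ) (C : ℝ) (hb : ∀ z, |b z| ≤ C) : L2 d n p →L[ℝ] L2 d n p :=
  LinearMap.mkContinuous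
    { toFun := fun f => ⟨fun z => b z * f z,
        ((lp.memℓp f).const_smul C).mono' (fun z => by
          have h0 : 0 ≤ C := (abs_nonneg _).trans (hb z)
          rw [Pi.smul_apply, norm_mul, norm_smul, Real.norm_of_nonneg h0]
          gcongr
          exact hb z)⟩
      map_add' := fun f g => by ext z; exact mul_add _ _ _
      map_smul' := fun c f => by ext z; exact mul_left_comm _ _ _ }
    C (by
      intro f
      have h0 : 0 ≤ C := (abs_nonneg _).trans (hb 0)
      have h1 : ‖C • f‖ = C * ‖f‖ := by
        rw [lp.norm_const_smul (by norm_num), Real.norm_of_nonneg h0]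
      refine le_trans (lp.norm_mono (by norm_num) fun z => ?_) h1.le
      change ‖b z * f z‖ ≤ ‖C • f z‖
      rw [norm_mul, norm_smul, Real.norm_of_nonneg h0]
      gcongr
      exact hb z)

@[simp] theorem mulOp_apply (b : Config d n p → ℝ) (C : ℝ) (hb : ∀ z, |b z| ≤ C) (f : L2 d n p)
    (z : Config d n p) : mulOp b C hb f z = b z * f z := rfl

theorem norm_mulOp_le (b : Config d n p → ℝ) (C : ℝ) (hb : ∀ z, |b z| ≤ C) :
    ‖mulOp b C hb‖ ≤ C :=
  LinearMap.mkContinuous_norm_le _ ((abs_nonneg _).trans (hb 0)) _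

@[simp] theorem translation_apply (a : Config d n p) (f : L2 d n p) (z : Config d n p) :
    translation a f z = f (z + a) := rfl

theorem norm_translation_le (a : Config d n p) : ‖translation a‖ ≤ 1 :=
  LinearMap.mkContinuous_norm_le _ zero_le_one _

@[simp] theorem interactionMul_apply (f : L2 d n p) (z : Config d n p) :
    interactionMul d n p f z = interaction z * f z := rfl

/-! ### Conjugation by an exponential weight -/

/-- `|y|₁ - |x|₁`. -/
def tilt (z : Config d n p) : ℝ :=
  (∑ k, ∑ i, |(z.2 k i : ℝ)|) - ∑ j, ∑ i, |(z.1 j i : ℝ)|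

theorem abs_sum_sub_sum_single_le {m : ℕ} (x : Fin m → Lattice d) (j : Fin m) (i : Fin d)
    (s : ℤ) (hs : |s| = 1) :
    |(∑ k, ∑ l, |(((x + s • Pi.single j (basisVec i) : Fin m → Lattice d) k l : ℤ) : ℝ)|) -
      (∑ k, ∑ l, |((x k l : ℤ) : ℝ)|)| ≤ 1 := by
  rw [← Finset.sum_sub_distrib]
  simp_rw [← Finset.sum_sub_distrib]
  rw [Finset.sum_eq_single j, Finset.sum_eq_single i]
  · refine (abs_abs_sub_abs_le_abs_sub _ _).trans ?_
    have hs' : |(s : ℝ)| = 1 := by exact_mod_cast congrArg (Int.cast : ℤ → ℝ) hs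
    simp [basisVec, hs']
  · intro l _ hl; simp [basisVec, hl]
  · simp
  · intro k _ hk; simp [hk]
  · simp

/-- A unit step changes one coordinate of one particle by one. Hence the weights at neighbouring
configurations have ratio between exp(-|θ|) and exp|θ|, which keeps the conjugated operator bounded.
-/
theorem abs_tilt_add_shift_sub_le (a : Dir d n p) (z : Config d n p) :
    |tilt (z + shift a) - tilt z| ≤ 1 := by
  rcases a with ⟨⟨j, i⟩ | ⟨k, i⟩, b⟩
  · have h := abs_sum_sub_sum_single_le z.1 j i (if b then 1 else -1) (by cases b <;> simp)
    rw [abs_sub_comm] at h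
    convert h using 2
    cases b <;> simp [tilt, shift, unitVec, xVec]
  · have h := abs_sum_sub_sum_single_le z.2 k i (if b then 1 else -1) (by cases b <;> simp)
    convert h using 2
    cases b <;> simp [tilt, shift, unitVec, yVec]

/-- The quotient of the weights `exp(θ (|y|₁ - |x|₁))` at neighbouring configurations. -/
def tiltRatio (θ : ℝ) (a : Dir d n p) (z : Config d n p) : ℝ :=
  Real.exp (θ * (tilt z - tilt (z + shift a)))

theorem abs_tiltRatio_sub_one_le (θ : ℝ) (a : Dir d n p) (z : Config d n p) :
    |tiltRatio θ a z - 1| ≤ Real.exp |θ| - 1 := by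
  set s := θ * (tilt z - tilt (z + shift a)) with hs
  have h1 : |s| ≤ |θ| := by
    rw [hs, abs_mul, abs_sub_comm]
    exact mul_le_of_le_one_right (abs_nonneg _) (abs_tilt_add_shift_sub_le a z)
  obtain ⟨h2, h3⟩ := abs_le.1 h1
  have h4 : Real.exp s ≤ Real.exp |θ| := Real.exp_le_exp.2 h3
  have h5 : Real.exp (-|θ|) ≤ Real.exp s := Real.exp_le_exp.2 h2
  -- For ratios below 1 the claim needs 1 - exp(-|θ|) ≤ exp|θ| - 1, that is, cosh ≥ 1.
  have h6 : 2 ≤ Real.exp |θ| + Real.exp (-|θ|) := by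
    have := Real.one_le_cosh |θ|
    rw [Real.cosh_eq] at this
    linarith
  have : tiltRatio θ a z = Real.exp s := rfl
  rw [this, abs_le]
  constructor <;> linarith

theorem abs_tiltRatio_le (θ : ℝ) (a : Dir d n p) (z : Config d n p) :
    |tiltRatio θ a z| ≤ Real.exp |θ| := by
  have h := abs_tiltRatio_sub_one_le θ a z
  have : 0 < tiltRatio θ a z := Real.exp_pos _
  rw [abs_of_pos this]
  linarith [(abs_le.1 h).2]

/-- The operator `W L_p W⁻¹` with the weight `W = exp(θ (|y|₁ - |x|₁))`. -/
def tiltedOp (d n p : ℕ) (κ ρ : ℝ≥0) (θ : ℝ) : L2 d n p →L[ℝ] L2 d n p :=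
  ∑ a : Dir d n p, rate κ ρ a • (mulOp (tiltRatio θ a) _ (abs_tiltRatio_le θ a) *
    translation (shift a) - 1) + interactionMul d n p

theorem tiltedOp_apply (κ ρ : ℝ≥0) (θ : ℝ) (f : L2 d n p) (z : Config d n p) :
    tiltedOp d n p κ ρ θ f z =
      ∑ a, rate κ ρ a * (tiltRatio θ a z * f (z + shift a) - f z) + interaction z * f z := by
  simp only [tiltedOp, _root_.add_apply, _root_.sum_apply, _root_.smul_apply,
    _root_.sub_apply, lp.coeFn_add, lp.coeFn_sum, lp.coeFn_smul, lp.coeFn_sub, Pi.add_apply,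
    Finset.sum_apply, Pi.smul_apply, Pi.sub_apply, smul_eq_mul, mul_apply_eq_comp,
    mulOp_apply, translation_apply, one_apply_eq_self, interactionMul_apply]

theorem andersonOp_apply_eq_sum (κ ρ : ℝ≥0) (f : L2 d n p) (z : Config d n p) :
    andersonOp d n p κ ρ f z =
      ∑ a, rate κ ρ a * (f (z + shift a) - f z) + interaction z * f z := by
  rw [andersonOp_apply, laplacian_add_interaction_eq]

theorem andersonOp_eq_sum (κ ρ : ℝ≥0) :
    andersonOp d n p κ ρ =
      ∑ a : Dir d n p, rate κ ρ a • (translation (shift a) - 1) + interactionMul d n p := by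
  refine ContinuousLinearMap.ext fun f => lp.ext (funext fun z => ?_)
  rw [andersonOp_apply_eq_sum]
  simp only [_root_.add_apply, _root_.sum_apply, _root_.smul_apply,
    _root_.sub_apply, lp.coeFn_add, lp.coeFn_sum, lp.coeFn_smul, lp.coeFn_sub, Pi.add_apply,
    Finset.sum_apply, Pi.smul_apply, Pi.sub_apply, smul_eq_mul,
    translation_apply, one_apply_eq_self, interactionMul_apply]

theorem tiltedOp_zero (κ ρ : ℝ≥0) : tiltedOp d n p κ ρ 0 = andersonOp d n p κ ρ := by
  refine ContinuousLinearMap.ext fun f => lp.ext (funext fun z => ?_)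
  rw [andersonOp_apply_eq_sum, tiltedOp_apply]
  simp [tiltRatio]

/-- Conjugation leaves the diagonal terms alone and multiplies each hopping term by a factor within
exp|θ| - 1 of 1, while translations are contractions. As θ → 0 the growth rate of the conjugated
semigroup is therefore controlled by the form of L_p. -/
theorem norm_tiltedOp_sub_le (κ ρ : ℝ≥0) (θ : ℝ) :
    ‖tiltedOp d n p κ ρ θ - andersonOp d n p κ ρ‖ ≤
      totalRate d n p κ ρ * (Real.exp |θ| - 1) := by
  have h : tiltedOp d n p κ ρ θ - andersonOp d n p κ ρ = ∑ a : Dir d n p, rate κ ρ a •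
      (mulOp (fun z => tiltRatio θ a z - 1) _ (abs_tiltRatio_sub_one_le θ a) *
        translation (shift a)) := by
    rw [andersonOp_eq_sum, tiltedOp, add_sub_add_right_eq_sub, ← Finset.sum_sub_distrib]
    refine Finset.sum_congr rfl fun a _ => ?_
    rw [← smul_sub]
    congr 1
    refine ContinuousLinearMap.ext fun f => lp.ext (funext fun z => ?_)
    simp only [_root_.sub_apply, lp.coeFn_sub, Pi.sub_apply, mul_apply_eq_comp,
      mulOp_apply, translation_apply, one_apply_eq_self]
    ring
  have h0 : 0 ≤ Real.exp |θ| - 1 := by linarith [Real.one_le_exp (abs_nonneg θ)]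
  rw [h, totalRate, Finset.sum_mul]
  refine (norm_sum_le _ _).trans (Finset.sum_le_sum fun a _ => ?_)
  rw [norm_smul, Real.norm_of_nonneg (rate_nonneg κ ρ a)]
  refine mul_le_mul_of_nonneg_left ((norm_mul_le _ _).trans ?_) (rate_nonneg κ ρ a)
  calc _ ≤ (Real.exp |θ| - 1) * 1 := mul_le_mul (norm_mulOp_le _ _ _) (norm_translation_le _)
        (norm_nonneg _) h0
    _ = _ := mul_one _

/-! ### Self-adjointness and the energy form -/

theorem inner_eq_tsum (f g : L2 d n p) : inner ℝ f g = ∑' z, f z * g z := by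
  rw [lp.inner_eq_tsum]
  exact tsum_congr fun z => by simp [mul_comm]

theorem summable_mul (f g : L2 d n p) : Summable fun z => f z * g z := by
  refine (lp.summable_inner (𝕜 := ℝ) f g).congr fun z => ?_
  simp [mul_comm]

theorem norm_sq_eq_tsum (f : L2 d n p) : ‖f‖ ^ 2 = ∑' z, f z ^ 2 := by
  rw [← real_inner_self_eq_norm_sq, inner_eq_tsum]
  exact tsum_congr fun z => (sq _).symm

theorem inner_translation (a : Config d n p) (f g : L2 d n p) :
    inner ℝ (translation a f) g = inner ℝ f (translation (-a) g) := by
  rw [inner_eq_tsum, inner_eq_tsum, ← (Equiv.addRight a).tsum_eq (fun z => f z * _)]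
  simp

theorem shift_neg (q : Fin p × Fin d ⊕ Fin n × Fin d) (b : Bool) :
    -(shift (q, b) : Config d n p) = shift (q, !b) := by
  cases b <;> simp [shift]

theorem isSelfAdjoint_andersonOp (κ ρ : ℝ≥0) : IsSelfAdjoint (andersonOp d n p κ ρ) := by
  rw [ContinuousLinearMap.isSelfAdjoint_iff_isSymmetric]
  intro f g
  change inner ℝ (andersonOp d n p κ ρ f) g = inner ℝ f (andersonOp d n p κ ρ g)
  rw [andersonOp_eq_sum]
  simp only [_root_.add_apply, _root_.sum_apply, _root_.smul_apply, _root_.sub_apply,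
    one_apply_eq_self, inner_add_left, inner_add_right, sum_inner, inner_sum, inner_smul_left,
    inner_smul_right, inner_sub_left, inner_sub_right, conj_trivial, inner_translation]
  congr 1
  -- The adjoint of a translation is the opposite translation, and opposite directions have equal
  -- rates.
  · let e : Dir d n p ≃ Dir d n p := Equiv.prodCongr (Equiv.refl _) Equiv.boolNot
    rw [← e.sum_comp]
    refine Finset.sum_congr rfl fun a _ => ?_
    have h1 : rate κ ρ (e a) = rate κ ρ a := rfl
    have h2 : -(shift (e a) : Config d n p) = shift a := by
      rw [show e a = (a.1, !a.2) from rfl, shift_neg, Bool.not_not]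
    rw [h1, h2]
  · rw [inner_eq_tsum, inner_eq_tsum]
    exact tsum_congr fun z => by simp; ring

theorem norm_translation (a : Config d n p) (f : L2 d n p) : ‖translation a f‖ = ‖f‖ := by
  have h : ‖translation a f‖ ^ 2 = ‖f‖ ^ 2 := by
    rw [← real_inner_self_eq_norm_sq, ← real_inner_self_eq_norm_sq, inner_translation]
    congr 1
    ext z
    simp
  exact (sq_eq_sq₀ (norm_nonneg _) (norm_nonneg _)).1 h

theorem tsum_diff_sq (v : Config d n p) (f : L2 d n p) :
    ∑' z, (f (z + v) - f z) ^ 2 = 2 * ‖f‖ ^ 2 - 2 * inner ℝ f (translation v f) := by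
  have h := norm_sq_eq_tsum (translation v f - f)
  rw [norm_sub_sq_real, norm_translation, real_inner_comm] at h
  simp only [lp.coeFn_sub, Pi.sub_apply, translation_apply] at h
  linarith

theorem summable_diff_sq (v : Config d n p) (f : L2 d n p) :
    Summable fun z => (f (z + v) - f z) ^ 2 :=
  (summable_mul (translation v f - f) (translation v f - f)).congr fun z => by
    simp [sq]

theorem gradXSq_eq (f : L2 d n p) : gradXSq f =
    ∑ j, ∑ i, (2 * ‖f‖ ^ 2 - 2 * inner ℝ f (translation (xVec j i) f)) := by
  rw [gradXSq, Summable.tsum_finsetSum fun j _ => summable_sum fun i _ => summable_diff_sq _ f]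
  refine Finset.sum_congr rfl fun j _ => ?_
  rw [Summable.tsum_finsetSum fun i _ => summable_diff_sq _ f]
  exact Finset.sum_congr rfl fun i _ => tsum_diff_sq _ f

theorem gradYSq_eq (f : L2 d n p) : gradYSq f =
    ∑ k, ∑ i, (2 * ‖f‖ ^ 2 - 2 * inner ℝ f (translation (yVec k i) f)) := by
  rw [gradYSq, Summable.tsum_finsetSum fun j _ => summable_sum fun i _ => summable_diff_sq _ f]
  refine Finset.sum_congr rfl fun j _ => ?_
  rw [Summable.tsum_finsetSum fun i _ => summable_diff_sq _ f]
  exact Finset.sum_congr rfl fun i _ => tsum_diff_sq _ f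

/-- Summation by parts: the squared differences along v sum to 2‖f‖² - 2⟨f, T_v f⟩, and T_v and
T_{-v} have the same quadratic form, so each forward gradient term accounts for both neighbours in
the Laplacian. -/
theorem energy_eq_inner (κ ρ : ℝ≥0) (f : L2 d n p) :
    energy κ ρ f = inner ℝ f (andersonOp d n p κ ρ f) := by
  have hneg : ∀ v : Config d n p, inner ℝ f (translation (-v) f) = inner ℝ f (translation v f) :=
    fun v => by rw [← inner_translation, real_inner_comm]
  have hI : inner ℝ f (interactionMul d n p f) = ∑' z, interaction z * f z ^ 2 := by
    rw [inner_eq_tsum]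
    exact tsum_congr fun z => by simp; ring
  rw [energy, gradXSq_eq, gradYSq_eq, andersonOp]
  simp only [_root_.add_apply, _root_.sum_apply, _root_.smul_apply, _root_.sub_apply,
    ContinuousLinearMap.id_apply, inner_add_right, inner_sum, inner_smul_right, inner_sub_right,
    hneg, hI, real_inner_self_eq_norm_sq]
  rw [neg_mul, sub_eq_add_neg (-_), ← mul_neg, ← mul_neg, ← Finset.sum_neg_distrib,
    ← Finset.sum_neg_distrib]
  simp only [← Finset.sum_neg_distrib]
  congr 3
  · exact Finset.sum_congr rfl fun _ _ => Finset.sum_congr rfl fun _ _ => by ring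
  · exact Finset.sum_congr rfl fun _ _ => Finset.sum_congr rfl fun _ _ => by ring

/-! ### Positivity of the semigroups -/

/-- Evaluation at a configuration, as a continuous functional on `l²`. -/
def evalCLM (z : Config d n p) : L2 d n p →L[ℝ] ℝ :=
  LinearMap.mkContinuous
    { toFun := fun f => f z
      map_add' := fun _ _ => rfl
      map_smul' := fun _ _ => rfl } 1
    (fun f => by rw [one_mul]; exact lp.norm_apply_le_norm (by norm_num) f z)

@[simp] theorem evalCLM_apply (z : Config d n p) (f : L2 d n p) : evalCLM z f = f z := rfl

/-- All terms of the exponential series are nonnegative when B preserves positivity, so the series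
may be cut after its linear term. The linear term is what later carries positivity from a site to
its neighbours. -/
theorem add_mul_le_exp_smul_apply {B : L2 d n p →L[ℝ] L2 d n p}
    (hB : ∀ g : L2 d n p, (∀ z, 0 ≤ g z) → ∀ z, 0 ≤ B g z) {g : L2 d n p} (hg : ∀ z, 0 ≤ g z)
    {t : ℝ} (ht : 0 ≤ t) (z : Config d n p) :
    g z + t * B g z ≤ NormedSpace.exp (t • B) g z := by
  have hpow : ∀ m : ℕ, ∀ z, 0 ≤ (B ^ m) g z := by
    intro m
    induction m with
    | zero => simpa using hg
    | succ m ih => intro z; rw [pow_succ']; exact hB _ ih z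
  have hs := NormedSpace.exp_series_hasSum_exp' (𝕂 := ℝ) (t • B)
  have hs1 := ((evalCLM z).comp (ContinuousLinearMap.apply ℝ (L2 d n p) g)).hasSum hs
  have hterm : ∀ m : ℕ, ((evalCLM z).comp (ContinuousLinearMap.apply ℝ (L2 d n p) g))
      (((m.factorial : ℝ))⁻¹ • (t • B) ^ m) = (m.factorial : ℝ)⁻¹ * (t ^ m * (B ^ m) g z) := by
    intro m
    simp [smul_pow, -_root_.smul_apply]
  have h2 := sum_le_hasSum (Finset.range 2) (fun m _ => by
    rw [hterm]
    have := hpow m z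
    positivity) hs1
  rw [Finset.sum_range_succ, Finset.sum_range_one] at h2
  simp only [hterm] at h2
  simpa using h2

/-- Adding the total jump rate cancels the negative diagonal, leaving only nonnegative coefficients.
The second half isolates one jump, to be used for propagation of positivity. -/
theorem add_totalRate_nonneg (κ ρ : ℝ≥0) (θ : ℝ) {g : L2 d n p} (hg : ∀ z, 0 ≤ g z)
    (z : Config d n p) :
    0 ≤ (tiltedOp d n p κ ρ θ + totalRate d n p κ ρ • (1 : L2 d n p →L[ℝ] L2 d n p)) g z ∧
    ∀ a, rate κ ρ a * (tiltRatio θ a z * g (z + shift a)) ≤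
      (tiltedOp d n p κ ρ θ + totalRate d n p κ ρ • (1 : L2 d n p →L[ℝ] L2 d n p)) g z := by
  have h : (tiltedOp d n p κ ρ θ + totalRate d n p κ ρ • (1 : L2 d n p →L[ℝ] L2 d n p)) g z =
      ∑ a, rate κ ρ a * (tiltRatio θ a z * g (z + shift a)) + interaction z * g z := by
    have h1 : (tiltedOp d n p κ ρ θ + totalRate d n p κ ρ • (1 : L2 d n p →L[ℝ] L2 d n p)) g z =
        tiltedOp d n p κ ρ θ g z + totalRate d n p κ ρ * g z := rfl
    rw [h1, tiltedOp_apply, totalRate, Finset.sum_mul]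
    simp only [mul_sub, Finset.sum_sub_distrib]
    ring
  have hterm : ∀ a : Dir d n p, 0 ≤ rate κ ρ a * (tiltRatio θ a z * g (z + shift a)) := fun a =>
    mul_nonneg (rate_nonneg κ ρ a) (mul_nonneg (Real.exp_pos _).le (hg _))
  have hI : 0 ≤ interaction z * g z := mul_nonneg (interaction_nonneg z) (hg z)
  rw [h]
  refine ⟨add_nonneg (Finset.sum_nonneg fun a _ => hterm a) hI, fun a => ?_⟩
  exact (Finset.single_le_sum (fun a _ => hterm a) (Finset.mem_univ a)).trans
    (le_add_of_nonneg_right hI)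

theorem exp_tiltedOp_apply_ge (κ ρ : ℝ≥0) (θ : ℝ) {g : L2 d n p} (hg : ∀ z, 0 ≤ g z)
    {t : ℝ} (ht : 0 ≤ t) (z : Config d n p) :
    Real.exp (-totalRate d n p κ ρ * t) * (g z + t * (tiltedOp d n p κ ρ θ +
      totalRate d n p κ ρ • (1 : L2 d n p →L[ℝ] L2 d n p)) g z) ≤
      NormedSpace.exp (t • tiltedOp d n p κ ρ θ) g z := by
  have h := add_mul_le_exp_smul_apply
    (fun g hg z => (add_totalRate_nonneg κ ρ θ (g := g) hg z).1) hg ht z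
  rw [exp_smul_add_algebraMap] at h
  have h1 : (Real.exp (totalRate d n p κ ρ * t) •
      NormedSpace.exp (t • tiltedOp d n p κ ρ θ)) g z =
      Real.exp (totalRate d n p κ ρ * t) * NormedSpace.exp (t • tiltedOp d n p κ ρ θ) g z := rfl
  rw [h1] at h
  have e : Real.exp (-totalRate d n p κ ρ * t) * Real.exp (totalRate d n p κ ρ * t) = 1 := by
    rw [← Real.exp_add]; simp
  calc _ ≤ Real.exp (-totalRate d n p κ ρ * t) * (Real.exp (totalRate d n p κ ρ * t) *
        NormedSpace.exp (t • tiltedOp d n p κ ρ θ) g z) := by gcongr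
    _ = _ := by rw [← mul_assoc, e, one_mul]

theorem exp_tiltedOp_apply_ge_self (κ ρ : ℝ≥0) (θ : ℝ) {g : L2 d n p} (hg : ∀ z, 0 ≤ g z)
    {t : ℝ} (ht : 0 ≤ t) (z : Config d n p) :
    Real.exp (-totalRate d n p κ ρ * t) * g z ≤
      NormedSpace.exp (t • tiltedOp d n p κ ρ θ) g z := by
  refine le_trans ?_ (exp_tiltedOp_apply_ge κ ρ θ hg ht z)
  gcongr
  exact le_add_of_nonneg_right (mul_nonneg ht (add_totalRate_nonneg κ ρ θ hg z).1)

theorem exp_tiltedOp_apply_nonneg (κ ρ : ℝ≥0) (θ : ℝ) {g : L2 d n p} (hg : ∀ z, 0 ≤ g z)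
    {t : ℝ} (ht : 0 ≤ t) (z : Config d n p) :
    0 ≤ NormedSpace.exp (t • tiltedOp d n p κ ρ θ) g z :=
  (mul_nonneg (Real.exp_pos _).le (hg z)).trans (exp_tiltedOp_apply_ge_self κ ρ θ hg ht z)

theorem exp_andersonOp_apply_nonneg (κ ρ : ℝ≥0) {g : L2 d n p} (hg : ∀ z, 0 ≤ g z)
    {t : ℝ} (ht : 0 ≤ t) (z : Config d n p) :
    0 ≤ NormedSpace.exp (t • andersonOp d n p κ ρ) g z := by
  rw [← tiltedOp_zero]; exact exp_tiltedOp_apply_nonneg κ ρ 0 hg ht z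

/-- Half of the time is spent becoming positive at the neighbour, the other half on one jump.
Positivity is assumed at every positive time so that the step can be iterated without losing time.
-/
theorem exp_andersonOp_apply_pos_of_shift (κ ρ : ℝ≥0) {g : L2 d n p} (hg : ∀ z, 0 ≤ g z)
    {a : Dir d n p} (ha : 0 < rate κ ρ a) {z : Config d n p}
    (h : ∀ t : ℝ, 0 < t → 0 < NormedSpace.exp (t • andersonOp d n p κ ρ) g (z + shift a))
    {t : ℝ} (ht : 0 < t) : 0 < NormedSpace.exp (t • andersonOp d n p κ ρ) g z := by
  have h2 : 0 < t / 2 := by positivity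
  set g' := NormedSpace.exp ((t / 2) • andersonOp d n p κ ρ) g with hg'
  have hg'0 : ∀ z, 0 ≤ g' z := exp_andersonOp_apply_nonneg κ ρ hg h2.le
  have e : NormedSpace.exp (t • andersonOp d n p κ ρ) g =
      NormedSpace.exp ((t / 2) • andersonOp d n p κ ρ) g' := by
    have := exp_smul_mul_exp_smul (andersonOp d n p κ ρ) (t / 2) (t / 2)
    rw [add_halves] at this
    rw [← this]; rfl
  rw [e]
  have h3 := exp_tiltedOp_apply_ge κ ρ 0 hg'0 h2.le z
  have h4 := (add_totalRate_nonneg κ ρ 0 hg'0 z).2 a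
  rw [tiltedOp_zero] at h3 h4
  refine lt_of_lt_of_le ?_ h3
  have h5 : 0 < rate κ ρ a * (tiltRatio 0 a z * g' (z + shift a)) :=
    mul_pos ha (mul_pos (Real.exp_pos _) (h _ h2))
  refine mul_pos (Real.exp_pos _) (add_pos_of_nonneg_of_pos (hg'0 z) (mul_pos h2 ?_))
  exact h5.trans_le h4

/-! ### Reachability -/

/-- Every configuration is an integer combination of unit vectors, so it can be reached from 0 one
coordinate at a time. -/
theorem lattice_induction {m : ℕ} (Q : (Fin m → Lattice d) → Prop) (h0 : Q 0)
    (hs : ∀ x (j : Fin m) (i : Fin d), Q x → Q (x + Pi.single j (basisVec i)) ∧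
      Q (x - Pi.single j (basisVec i)))
    (x : Fin m → Lattice d) : Q x := by
  have hz : ∀ (j : Fin m) (i : Fin d) (c : ℤ) (x : Fin m → Lattice d), Q x →
      Q (x + c • Pi.single j (basisVec i)) := by
    intro j i c
    induction c using Int.induction_on with
    | zero => simp
    | succ c ih =>
      intro x hx
      rw [add_smul, one_smul, ← add_assoc]
      exact (hs _ j i (ih x hx)).1
    | pred c ih =>
      intro x hx
      rw [sub_smul, one_smul, ← add_sub_assoc]
      exact (hs _ j i (ih x hx)).2
  have hsum : ∀ s : Finset (Fin m × Fin d),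
      Q (∑ q ∈ s, x q.1 q.2 • Pi.single q.1 (basisVec q.2)) := by
    intro s
    induction s using Finset.induction_on with
    | empty => simpa using h0
    | insert q s hq ih => rw [Finset.sum_insert hq, add_comm]; exact hz _ _ _ _ ih
  have hx : x = ∑ q ∈ (Finset.univ : Finset (Fin m × Fin d)),
      x q.1 q.2 • (Pi.single q.1 (basisVec q.2) : Fin m → Lattice d) := by
    ext j i
    rw [Finset.sum_apply, Finset.sum_apply, Fintype.sum_prod_type, Finset.sum_eq_single j,
      Finset.sum_eq_single i]
    · simp [basisVec]
    · intro l _ hl; simp [basisVec, hl.symm]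
    · simp
    · intro l _ hl
      exact Finset.sum_eq_zero fun i _ => by simp [hl.symm]
    · simp
  rw [hx]
  exact hsum _

theorem exp_andersonOp_apply_pos_self (κ ρ : ℝ≥0) {g : L2 d n p} (hg : ∀ z, 0 ≤ g z)
    {z : Config d n p} (hz : 0 < g z) {t : ℝ} (ht : 0 ≤ t) :
    0 < NormedSpace.exp (t • andersonOp d n p κ ρ) g z := by
  have := exp_tiltedOp_apply_ge_self κ ρ 0 hg ht z
  rw [tiltedOp_zero] at this
  exact (mul_pos (Real.exp_pos _) hz).trans_le this

/-- Only moves of x are used here, with y kept fixed. For κ = 0 there are none, whence the condition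
`hx`. -/
theorem exp_andersonOp_apply_pos_of_fst (κ ρ : ℝ≥0) {g : L2 d n p} (hg : ∀ z, 0 ≤ g z)
    (x : Fin p → Lattice d) (y : Fin n → Lattice d) (hx : κ = 0 → x = 0)
    (hz : 0 < g (0, y)) {t : ℝ} (ht : 0 < t) :
    0 < NormedSpace.exp (t • andersonOp d n p κ ρ) g (x, y) := by
  rcases eq_or_ne κ 0 with hκ | hκ
  · rw [hx hκ]; exact exp_andersonOp_apply_pos_self κ ρ hg hz ht.le
  have hκ' : 0 < (κ : ℝ) := by positivity
  refine lattice_induction (fun x => ∀ t : ℝ, 0 < t →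
    0 < NormedSpace.exp (t • andersonOp d n p κ ρ) g (x, y))
    (fun t ht => exp_andersonOp_apply_pos_self κ ρ hg hz ht.le) (fun x j i hx => ⟨?_, ?_⟩) x t ht
  · refine fun t ht => exp_andersonOp_apply_pos_of_shift κ ρ hg (a := (.inl (j, i), false)) hκ'
      (fun t ht => ?_) ht
    simpa [shift, unitVec, xVec] using hx t ht
  · refine fun t ht => exp_andersonOp_apply_pos_of_shift κ ρ hg (a := (.inl (j, i), true)) hκ'
      (fun t ht => ?_) ht
    simpa [shift, unitVec, xVec] using hx t ht

theorem exp_andersonOp_apply_pos_of_snd (κ ρ : ℝ≥0) {g : L2 d n p} (hg : ∀ z, 0 ≤ g z)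
    (x : Fin p → Lattice d) (y : Fin n → Lattice d) (hy : ρ = 0 → y = 0)
    (hz : 0 < g (x, 0)) {t : ℝ} (ht : 0 < t) :
    0 < NormedSpace.exp (t • andersonOp d n p κ ρ) g (x, y) := by
  rcases eq_or_ne ρ 0 with hρ | hρ
  · rw [hy hρ]; exact exp_andersonOp_apply_pos_self κ ρ hg hz ht.le
  have hρ' : 0 < (ρ : ℝ) := by positivity
  refine lattice_induction (fun y => ∀ t : ℝ, 0 < t →
    0 < NormedSpace.exp (t • andersonOp d n p κ ρ) g (x, y))
    (fun t ht => exp_andersonOp_apply_pos_self κ ρ hg hz ht.le) (fun y j i hy => ⟨?_, ?_⟩) y t ht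
  · refine fun t ht => exp_andersonOp_apply_pos_of_shift κ ρ hg (a := (.inr (j, i), false)) hρ'
      (fun t ht => ?_) ht
    simpa [shift, unitVec, yVec] using hy t ht
  · refine fun t ht => exp_andersonOp_apply_pos_of_shift κ ρ hg (a := (.inr (j, i), true)) hρ'
      (fun t ht => ?_) ht
    simpa [shift, unitVec, yVec] using hy t ht

/-! ### Test functions -/

/-- Passing to |f| preserves the norm and the diagonal part of the form and can only increase the
hopping terms f(z) f(z + a), whose rates are nonnegative. -/
theorem exists_nonneg_test (κ ρ : ℝ≥0) (f : L2 d n p) {b : ℝ}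
    (hf : b * ‖f‖ ^ 2 < inner ℝ f (andersonOp d n p κ ρ f)) :
    ∃ g : L2 d n p, (∀ z, 0 ≤ g z) ∧ (∀ z, f z = 0 → g z = 0) ∧
      b * ‖g‖ ^ 2 < inner ℝ g (andersonOp d n p κ ρ g) := by
  let g : L2 d n p := ⟨fun z => |f z|, (lp.memℓp f).mono' (fun z => by simp)⟩
  have hgz : ∀ z, g z = |f z| := fun z => rfl
  refine ⟨g, fun z => abs_nonneg _, fun z hz => by rw [hgz, hz, abs_zero], ?_⟩
  have h1 : ‖g‖ ^ 2 = ‖f‖ ^ 2 := by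
    rw [norm_sq_eq_tsum, norm_sq_eq_tsum]
    exact tsum_congr fun z => by rw [hgz, sq_abs]
  rw [h1]
  refine hf.trans_le ?_
  rw [inner_eq_tsum, inner_eq_tsum]
  refine Summable.tsum_le_tsum (fun z => ?_) (summable_mul _ _) (summable_mul _ _)
  rw [andersonOp_apply_eq_sum, andersonOp_apply_eq_sum, mul_add, mul_add, Finset.mul_sum,
    Finset.mul_sum]
  refine add_le_add (Finset.sum_le_sum fun a _ => ?_) (le_of_eq ?_)
  · have h2 : f z * f (z + shift a) ≤ |f z| * |f (z + shift a)| := by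
      rw [← abs_mul]; exact le_abs_self _
    have h3 := mul_le_mul_of_nonneg_left h2 (rate_nonneg κ ρ a)
    rw [hgz, hgz]
    nlinarith [abs_mul_abs_self (f z), rate_nonneg κ ρ a]
  · rw [hgz]
    linear_combination (-interaction z) * (abs_mul_abs_self (f z))

/-- Truncations to finite sets converge to f in l² and the form is continuous, so the strict
inequality survives for a large enough set. -/
theorem exists_finite_test (κ ρ : ℝ≥0) (f : L2 d n p) (hf0 : ∀ z, 0 ≤ f z) {b : ℝ}
    (hf : b * ‖f‖ ^ 2 < inner ℝ f (andersonOp d n p κ ρ f)) :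
    ∃ (A : Finset (Config d n p)) (g : L2 d n p), (∀ z, 0 ≤ g z) ∧ (∀ z, f z = 0 → g z = 0) ∧
      (∀ z, z ∉ A → g z = 0) ∧
      b * ‖g‖ ^ 2 < inner ℝ g (andersonOp d n p κ ρ g) := by
  classical
  have hs : Tendsto (fun A : Finset (Config d n p) => ∑ z ∈ A, lp.single 2 z (f z)) atTop (𝓝 f) :=
    lp.hasSum_single (by norm_num) f
  have hc : Continuous fun g : L2 d n p =>
      inner ℝ g (andersonOp d n p κ ρ g) - b * ‖g‖ ^ 2 := by fun_prop
  have h := (hc.tendsto f).comp hs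
  obtain ⟨A, hA⟩ := (h.eventually (lt_mem_nhds (sub_pos.2 hf))).exists
  have hval : ∀ z, (∑ z ∈ A, lp.single 2 z (f z) : L2 d n p) z = if z ∈ A then f z else 0 := by
    intro z
    rw [lp.coeFn_sum, Finset.sum_apply]
    simp [Pi.single_apply]
  refine ⟨A, ∑ z ∈ A, lp.single 2 z (f z), fun z => ?_, fun z hz => ?_, fun z hz => ?_,
    sub_pos.1 hA⟩
  · rw [hval]; split_ifs; exacts [hf0 z, le_rfl]
  · rw [hval, hz]; simp
  · rw [hval, if_neg hz]

/-- When the X-coordinates never jump, the operator acts separately on each fibre {x} × Y. The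
restriction of f to the fibre over x is carried to the fibre over 0 in N ways, translated by `c x
j`. In the applications this amounts to placing all frozen particles at the position of the j-th
one. By `hI` the interaction averaged over j is the original one, so the average over j of the forms
of the transplants is the form of f on that fibre. If no function on the fibre over 0 exceeded b,
summing over j and over the fibres would contradict `hf`. -/
theorem exists_frozen_test {X Y : Type*} [AddCommGroup X] [AddCommGroup Y]
    (e : X × Y ≃+ Config d n p) (N : ℕ) (c : X → Fin N → Y) (κ ρ : ℝ≥0)
    (hrate : ∀ a : Dir d n p, rate κ ρ a ≠ 0 → (e.symm (shift a)).1 = 0)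
    (hN : 1 ≤ N)
    (hI : ∀ x y, ∑ j, interaction (e (0, y - c x j)) = N * interaction (e (x, y)))
    (f : L2 d n p) {b : ℝ} (hf : b * ‖f‖ ^ 2 < inner ℝ f (andersonOp d n p κ ρ f)) :
    ∃ g : L2 d n p, (∀ z, (e.symm z).1 ≠ 0 → g z = 0) ∧
      b * ‖g‖ ^ 2 < inner ℝ g (andersonOp d n p κ ρ g) := by
  classical
  let L := andersonOp d n p κ ρ
  let χ : Config d n p → ℝ := fun z => if (e.symm z).1 = 0 then 1 else 0
  have hχ : ∀ z, |χ z| ≤ 1 := fun z => by simp only [χ]; split_ifs <;> simp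
  let g : X → Fin N → L2 d n p := fun x j => mulOp χ 1 hχ (translation (e (x, c x j)) f)
  have hg : ∀ x j x' y, g x j (e (x', y)) = if x' = 0 then f (e (x, y + c x j)) else 0 := by
    intro x j x' y
    have h1 : g x j (e (x', y)) = χ (e (x', y)) * f (e (x', y) + e (x, c x j)) := rfl
    rw [h1, ← map_add, Prod.mk_add_mk]
    by_cases hx : x' = 0 <;> simp [χ, hx]
  -- Only directions inside Y have nonzero rate, so the jump part commutes with the transplantation
  -- and only the potential changes.
  have hLg : ∀ x j y, L (g x j) (e (0, y)) = L f (e (x, y + c x j)) +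
      (interaction (e (0, y)) - interaction (e (x, y + c x j))) * f (e (x, y + c x j)) := by
    intro x j y
    have h1 : ∀ a : Dir d n p, rate κ ρ a * (g x j (e (0, y) + shift a) - g x j (e (0, y))) =
        rate κ ρ a * (f (e (x, y + c x j) + shift a) - f (e (x, y + c x j))) := by
      intro a
      rcases eq_or_ne (rate κ ρ a) 0 with h0 | h0
      · simp [h0]
      have ha : shift a = e (0, (e.symm (shift a)).2) := by
        rw [← hrate a h0]; simp
      rw [ha, ← map_add, ← map_add, Prod.mk_add_mk, Prod.mk_add_mk, add_zero, add_zero, hg, hg,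
        if_pos rfl, if_pos rfl, add_right_comm]
    simp only [L]
    rw [andersonOp_apply_eq_sum, andersonOp_apply_eq_sum, Finset.sum_congr rfl fun a _ => h1 a, hg,
      if_pos rfl]
    ring
  -- sums over a slice
  have hslice : ∀ F : Config d n p → ℝ, Summable F →
      (∀ x, Summable fun y => F (e (x, y))) ∧ HasSum (fun x => ∑' y, F (e (x, y))) (∑' z, F z) := by
    intro F hF
    have h1 : Summable fun q : X × Y => F (e q) := e.toEquiv.summable_iff.2 hF
    refine ⟨fun x => h1.prod_factor x, ?_⟩
    have h2 : ∑' z, F z = ∑' q : X × Y, F (e q) := (e.toEquiv.tsum_eq F).symm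
    rw [h2, h1.tsum_prod]
    exact h1.prod.hasSum
  have hzero : ∀ (F : Config d n p → ℝ), (∀ x y, x ≠ 0 → F (e (x, y)) = 0) →
      ∑' z, F z = ∑' y, F (e (0, y)) := by
    intro F hF
    rw [← e.toEquiv.tsum_eq F]
    have hinj : Function.Injective fun y : Y => ((0, y) : X × Y) := fun y y' h => by
      simpa using h
    refine (hinj.tsum_eq (f := fun q => F (e q)) ?_).symm
    rintro ⟨x, y⟩ hq
    by_cases hx : x = 0
    · exact ⟨y, by rw [hx]⟩
    · exact absurd (hF x y hx) hq
  have hsq : Summable fun z => f z ^ 2 := (summable_mul f f).congr fun z => (sq _).symm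
  have hfL : Summable fun z => f z * L f z := summable_mul _ _
  have hIsq : ∀ v : Y, ∀ x, Summable fun y => interaction (e (0, y - v)) * f (e (x, y)) ^ 2 := by
    intro v x
    refine Summable.of_nonneg_of_le (fun y => mul_nonneg (interaction_nonneg _) (sq_nonneg _))
      (fun y => mul_le_mul_of_nonneg_right (interaction_le _) (sq_nonneg _))
      (((hslice _ hsq).1 x).mul_left _)
  have hIsq' : ∀ x, Summable fun y => interaction (e (x, y)) * f (e (x, y)) ^ 2 := by
    intro x
    refine Summable.of_nonneg_of_le (fun y => mul_nonneg (interaction_nonneg _) (sq_nonneg _))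
      (fun y => mul_le_mul_of_nonneg_right (interaction_le _) (sq_nonneg _))
      (((hslice _ hsq).1 x).mul_left _)
  have hnorm : ∀ x j, ‖g x j‖ ^ 2 = ∑' y, f (e (x, y)) ^ 2 := by
    intro x j
    rw [norm_sq_eq_tsum, hzero _ (fun x' y hx => by rw [hg, if_neg hx]; ring),
      ← (Equiv.addRight (c x j)).tsum_eq (fun y => f (e (x, y)) ^ 2)]
    exact tsum_congr fun y => by rw [hg, if_pos rfl]; rfl
  have hform : ∀ x j, inner ℝ (g x j) (L (g x j)) = ∑' y, (f (e (x, y)) * L f (e (x, y)) -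
      interaction (e (x, y)) * f (e (x, y)) ^ 2 +
      interaction (e (0, y - c x j)) * f (e (x, y)) ^ 2) := by
    intro x j
    rw [inner_eq_tsum, hzero _ (fun x' y hx => by rw [hg, if_neg hx]; ring)]
    refine Eq.trans (tsum_congr fun y => ?_) ((Equiv.addRight (c x j)).tsum_eq _)
    rw [hg, if_pos rfl, hLg]
    simp only [Equiv.coe_addRight, add_sub_cancel_right]
    ring
  -- Summing over j replaces the transplanted potential by N times the original one, and the two
  -- corrections cancel.
  have hsum : ∀ x, ∑ j, inner ℝ (g x j) (L (g x j)) = N * ∑' y, f (e (x, y)) * L f (e (x, y)) := by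
    intro x
    have hfx := (hslice _ hfL).1 x
    simp only [hform]
    rw [← Summable.tsum_finsetSum fun j _ => (hfx.sub (hIsq' x)).add (hIsq _ x), ← tsum_mul_left]
    refine tsum_congr fun y => ?_
    rw [Finset.sum_add_distrib, ← Finset.sum_mul, hI]
    simp
    ring
  by_contra! hcon
  have hle : ∀ x, (N : ℝ) * ∑' y, f (e (x, y)) * L f (e (x, y)) ≤
      N * (b * ∑' y, f (e (x, y)) ^ 2) := by
    intro x
    rw [← hsum]
    calc _ ≤ ∑ j : Fin N, b * ‖g x j‖ ^ 2 := Finset.sum_le_sum fun j _ => by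
          refine hcon (g x j) fun z hz => ?_
          have := hg x j (e.symm z).1 (e.symm z).2
          rwa [Prod.mk.eta, e.apply_symm_apply, if_neg hz] at this
      _ = _ := by simp [hnorm]
  have hNpos : (0 : ℝ) < N := by exact_mod_cast hN
  have h1 := hasSum_le (fun x => le_of_mul_le_mul_left (hle x) hNpos) (hslice _ hfL).2
    ((hslice _ hsq).2.mul_left b)
  rw [← norm_sq_eq_tsum, ← inner_eq_tsum] at h1
  exact absurd hf (not_lt.2 h1)

/-- With all p particles placed at x_j, the number of catalysts at x_j is counted p times; summing
over j gives p I_p(x,y). -/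
theorem sum_interaction_sub_fst (x : Fin p → Lattice d) (y : Fin n → Lattice d) :
    ∑ j, interaction (((0, y - fun _ => x j) : Config d n p)) = p * interaction (x, y) := by
  have h : ∀ j, interaction (((0, y - fun _ => x j) : Config d n p)) =
      p * ∑ k, if x j - y k = 0 then (1 : ℝ) else 0 := by
    intro j
    simp [interaction]
  simp only [h, ← Finset.mul_sum]
  rfl

theorem sum_interaction_sub_snd (x : Fin p → Lattice d) (y : Fin n → Lattice d) :
    ∑ k, interaction (((x - fun _ => y k, 0) : Config d n p)) = n * interaction (x, y) := by
  have h : ∀ k, interaction (((x - fun _ => y k, 0) : Config d n p)) =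
      n * ∑ j, if x j - y k = 0 then (1 : ℝ) else 0 := by
    intro k
    simp only [interaction, Pi.sub_apply, Pi.zero_apply, sub_zero, Finset.sum_const,
      Finset.card_univ, Fintype.card_fin, nsmul_eq_mul, Finset.mul_sum]
  simp only [h, ← Finset.mul_sum]
  rw [Finset.sum_comm]
  rfl

/-- Near-maximizers of the energy may be taken nonnegative, finitely supported, and supported on
the configurations where the immobile particles sit at `0`. -/
theorem exists_test (hn : 1 ≤ n) (hp : 1 ≤ p) (κ ρ : ℝ≥0) (f : L2 d n p) {b : ℝ}
    (hf : b * ‖f‖ ^ 2 < inner ℝ f (andersonOp d n p κ ρ f)) :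
    ∃ (A : Finset (Config d n p)) (g : L2 d n p), (∀ z, 0 ≤ g z) ∧ (∀ z, z ∉ A → g z = 0) ∧
      (κ = 0 → ∀ z, z.1 ≠ 0 → g z = 0) ∧ (ρ = 0 → ∀ z, z.2 ≠ 0 → g z = 0) ∧
      b * ‖g‖ ^ 2 < inner ℝ g (andersonOp d n p κ ρ g) := by
  classical
  have main : ∃ h : L2 d n p, (κ = 0 → ∀ z, z.1 ≠ 0 → h z = 0) ∧
      (ρ = 0 → ∀ z, z.2 ≠ 0 → h z = 0) ∧ b * ‖h‖ ^ 2 < inner ℝ h (andersonOp d n p κ ρ h) := by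
    rcases eq_or_ne κ 0 with hκ | hκ
    · rcases eq_or_ne ρ 0 with hρ | hρ
      · have hr : ∀ a : Dir d n p, rate κ ρ a = 0 := by
          rintro ⟨q | q, s⟩ <;> simp [rate, hκ, hρ]
        have hL : ∀ (f : L2 d n p) z, andersonOp d n p κ ρ f z = interaction z * f z :=
            fun f z => by
          rw [andersonOp_apply_eq_sum]; simp [hr]
        -- Without any motion L_p is multiplication by I_p, which is at most pn, with equality at
        -- the origin; a point mass there beats every b < pn.
        have hle : inner ℝ f (andersonOp d n p κ ρ f) ≤ (p * n) * ‖f‖ ^ 2 := by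
          rw [inner_eq_tsum, norm_sq_eq_tsum, ← tsum_mul_left]
          refine Summable.tsum_le_tsum (fun z => ?_) (summable_mul _ _)
            (((summable_mul f f).congr fun z => (sq _).symm).mul_left _)
          rw [hL]
          nlinarith [interaction_le z, mul_self_nonneg (f z)]
        have hf1 : 0 < ‖f‖ ^ 2 := by
          rcases eq_or_ne f 0 with h0 | h0
          · simp [h0] at hf
          · have := norm_pos_iff.2 h0; positivity
        have hb : b < p * n := lt_of_mul_lt_mul_right (hf.trans_le hle) hf1.le
        refine ⟨lp.single 2 0 1, fun _ z hz => ?_, fun _ z hz => ?_, ?_⟩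
        · exact lp.single_apply_ne _ _ _ fun h => hz (by rw [h]; rfl)
        · exact lp.single_apply_ne _ _ _ fun h => hz (by rw [h]; rfl)
        · rw [lp.norm_single (by norm_num), inner_eq_tsum, tsum_eq_single 0, hL]
          · simpa [interaction] using hb
          · intro z hz
            rw [lp.single_apply_ne _ _ _ hz, zero_mul]
      · obtain ⟨g, hg1, hg2⟩ := exists_frozen_test (AddEquiv.refl (Config d n p)) p
          (fun x j _ => x j) κ ρ (by
            rintro ⟨q | ⟨k, i⟩, s⟩ h
            · exact absurd (by simp [rate, hκ]) h
            · cases s <;> simp [shift, unitVec, yVec]) hp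
          (fun x y => sum_interaction_sub_fst x y) f hf
        exact ⟨g, fun _ => hg1, fun h => absurd h hρ, hg2⟩
    · rcases eq_or_ne ρ 0 with hρ | hρ
      · obtain ⟨g, hg1, hg2⟩ := exists_frozen_test
          (AddEquiv.prodComm : (Fin n → Lattice d) × (Fin p → Lattice d) ≃+ Config d n p) n
          (fun y k _ => y k) κ ρ (by
            rintro ⟨⟨j, i⟩ | q, s⟩ h
            · cases s <;> simp [shift, unitVec, xVec]
            · exact absurd (by simp [rate, hρ]) h) hn
          (fun y x => sum_interaction_sub_snd x y) f hf
        exact ⟨g, fun h => absurd h hκ, fun _ => hg1, hg2⟩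
      · exact ⟨f, fun h => absurd h hκ, fun h => absurd h hρ, hf⟩
  obtain ⟨h, h1, h2, h3⟩ := main
  obtain ⟨h', k0, k1, k3⟩ := exists_nonneg_test κ ρ h h3
  obtain ⟨A, g, g0, g1, g2, g3⟩ := exists_finite_test κ ρ h' k0 k3
  exact ⟨A, g, g0, g2, fun hκ z hz => g1 z (k1 z (h1 hκ z hz)),
    fun hρ z hz => g1 z (k1 z (h2 hρ z hz)), g3⟩

/-! ### Linear evolution equations in weighted sup-norm classes -/

/-- A solution of a bounded linear evolution equation (with right derivatives) that starts at `0`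
and is dominated by a weight vanishes. -/
theorem eq_zero_of_linear_evolution {Z : Type*} (A : ℝ → (Z → ℝ) → Z → ℝ) (W : Z → ℝ)
    (hW : ∀ z, 0 ≤ W z) {M T : ℝ}
    (hA : ∀ t f c, 0 ≤ c → (∀ z, |f z| ≤ c * W z) → ∀ z, |A t f z| ≤ M * (c * W z))
    (hM : 0 ≤ M) (g : Z → ℝ → ℝ) (h0 : ∀ z, g z 0 = 0)
    (hc : ∀ z, ContinuousOn (g z) (Set.Icc 0 T))
    (hd : ∀ z, ∀ t ∈ Set.Ico 0 T, HasDerivWithinAt (g z) (A t (fun z' => g z' t) z) (Set.Ici t) t)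
    {C : ℝ} (hC : ∀ z, ∀ t ∈ Set.Icc 0 T, |g z t| ≤ C * W z) :
    ∀ z, ∀ t ∈ Set.Icc 0 T, g z t = 0 := by
  -- Iterated Grönwall: each use of the equation integrates the previous bound once more, and (Mt)^m
  -- / m! tends to 0.
  have key : ∀ m : ℕ, ∀ z, ∀ t ∈ Set.Icc 0 T,
      |g z t| ≤ |C| * ((M * t) ^ m / m.factorial) * W z := by
    intro m
    induction m with
    | zero =>
      intro z t ht
      simpa using (hC z t ht).trans (mul_le_mul_of_nonneg_right (le_abs_self C) (hW z))
    | succ m ih =>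
      intro z
      have hB : ∀ t : ℝ, HasDerivAt
          (fun t : ℝ => |C| * ((M * t) ^ (m + 1) / (m + 1).factorial) * W z)
          (M * (|C| * ((M * t) ^ m / m.factorial) * W z)) t := by
        intro t
        have h1 : HasDerivAt (fun t : ℝ => (M * t) ^ (m + 1))
            (((m + 1 : ℕ) : ℝ) * (M * t) ^ m * M) t := by
          have := ((hasDerivAt_id t).const_mul M).fun_pow (m + 1)
          simpa using this
        have h2 := ((h1.div_const ((m + 1).factorial : ℝ)).const_mul |C|).mul_const (W z)
        refine h2.congr_deriv ?_
        have h3 : ((m + 1).factorial : ℝ) = ((m + 1 : ℕ) : ℝ) * m.factorial := by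
          rw [Nat.factorial_succ]; push_cast; ring
        rw [h3]
        have h4 : ((m + 1 : ℕ) : ℝ) ≠ 0 := by positivity
        have h5 : (m.factorial : ℝ) ≠ 0 := by positivity
        field_simp
      refine image_norm_le_of_norm_deriv_right_le_deriv_boundary (hc z) (hd z) ?_ hB ?_
      · simp [h0]
      · intro t ht
        have ht' : t ∈ Set.Icc 0 T := ⟨ht.1, ht.2.le⟩
        have hMt : 0 ≤ M * t := mul_nonneg hM ht.1
        exact hA t _ _ (by positivity) (fun z' => ih z' t ht') z
  intro z t ht
  have hlim : Tendsto (fun m : ℕ => |C| * ((M * t) ^ m / m.factorial) * W z) atTop (𝓝 0) := by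
    have := ((FloorSemiring.tendsto_pow_div_factorial_atTop (M * t)).const_mul |C|).mul_const (W z)
    simpa using this
  have : |g z t| ≤ 0 := ge_of_tendsto' hlim fun m => key m z t ht
  simpa using this

theorem abs_laplacian_le {g : Lattice d → ℝ} {c : ℝ} (hg : ∀ z, |g z| ≤ c) (x : Lattice d) :
    |laplacian g x| ≤ 4 * d * c := by
  unfold laplacian
  refine (Finset.abs_sum_le_sum_abs _ _).trans ?_
  calc _ ≤ ∑ _i : Fin d, 4 * c := Finset.sum_le_sum fun i _ => by
        have h1 := abs_le.1 (hg (x + basisVec i))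
        have h2 := abs_le.1 (hg (x - basisVec i))
        have h3 := abs_le.1 (hg x)
        rw [abs_le]
        constructor <;> linarith
    _ = _ := by simp; ring

theorem laplacian_sub (f g : Lattice d → ℝ) (x : Lattice d) :
    laplacian (fun z => f z - g z) x = laplacian f x - laplacian g x := by
  simp only [laplacian, ← Finset.sum_sub_distrib]
  exact Finset.sum_congr rfl fun i _ => by ring

theorem abs_catalysts_le (y : Fin n → ℝ≥0 → Lattice d) (x : Lattice d) (t : ℝ) :
    |catalysts y x t| ≤ n := by
  unfold catalysts
  refine (Finset.abs_sum_le_sum_abs _ _).trans ?_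
  calc _ ≤ ∑ _k : Fin n, (1 : ℝ) := Finset.sum_le_sum fun k _ => by split_ifs <;> simp
    _ = n := by simp

/-- The difference solves a linear equation that is bounded in the sup norm. Agreement of the media
on [0,T) alone is required, so the lemma yields uniqueness and also shows that the solution at time
T depends only on the past of the medium. -/
theorem IsSolution.eq_of_agree {κ : ℝ≥0} {ξ ξ' : Lattice d → ℝ → ℝ} {u v : Lattice d → ℝ → ℝ}
    (hu : IsSolution κ ξ u) (hv : IsSolution κ ξ' v) {N T : ℝ} (hN : ∀ x t, |ξ x t| ≤ N)
    (hagree : ∀ x, ∀ t ∈ Set.Ico 0 T, ξ x t = ξ' x t) :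
    ∀ x, ∀ t ∈ Set.Icc 0 T, u x t = v x t := by
  obtain ⟨Cu, hCu⟩ := hu.locallyBounded T
  obtain ⟨Cv, hCv⟩ := hv.locallyBounded T
  have hN0 : 0 ≤ N := (abs_nonneg _).trans (hN 0 0)
  have h := eq_zero_of_linear_evolution (Z := Lattice d)
    (fun t f x => κ * laplacian f x + ξ x t * f x) (fun _ => 1) (fun _ => zero_le_one)
    (M := κ * (4 * d) + N) (T := T) ?_ (by positivity) (fun x t => u x t - v x t)
    (fun x => by simp [hu.initial, hv.initial])
    (fun x => ((hu.continuousOn x).mono Set.Icc_subset_Ici_self).sub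
      ((hv.continuousOn x).mono Set.Icc_subset_Ici_self)) ?_ (C := Cu + Cv) ?_
  · intro x t ht
    exact sub_eq_zero.1 (h x t ht)
  · intro t f c _ hf x
    have hf' : ∀ z, |f z| ≤ c := fun z => by simpa using hf z
    have h1 := abs_laplacian_le hf' x
    calc _ ≤ |κ * laplacian f x| + |ξ x t * f x| := abs_add_le _ _
      _ = κ * |laplacian f x| + |ξ x t| * |f x| := by
          rw [abs_mul, abs_mul, NNReal.abs_eq]
      _ ≤ κ * (4 * d * c) + N * c := by
          gcongr
          · exact hN x t
          · exact hf' x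
      _ = _ := by ring
  · intro x t ht
    refine ((hu.equation x t ht.1).sub (hv.equation x t ht.1)).congr_deriv ?_
    rw [laplacian_sub, hagree x t ht]
    ring
  · intro x t ht
    rw [mul_one]
    exact (abs_sub _ _).trans (add_le_add (hCu x t ht) (hCv x t ht))

/-! ### Picard iteration -/

section Picard

variable {Ω : Type*}

/-- The right-hand side of the equation. -/
def evolutionRHS (κ : ℝ≥0) (ξ w : Lattice d → ℝ → Ω → ℝ) (x : Lattice d) (s : ℝ) (ω : Ω) : ℝ :=
  κ * laplacian (fun z => w z s ω) x + ξ x s ω * w x s ω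

/-- The terms of the Picard series. -/
def picard (κ : ℝ≥0) (ξ : Lattice d → ℝ → Ω → ℝ) : ℕ → Lattice d → ℝ → Ω → ℝ
  | 0 => fun _ _ _ => 1
  | m + 1 => fun x t ω => ∫ s in (0 : ℝ)..max t 0, evolutionRHS κ ξ (picard κ ξ m) x s ω

/-- The Picard series. -/
def picardSum (κ : ℝ≥0) (ξ : Lattice d → ℝ → Ω → ℝ) (x : Lattice d) (t : ℝ) (ω : Ω) : ℝ :=
  ∑' m, picard κ ξ m x t ω

theorem abs_evolutionRHS_le (κ : ℝ≥0) {ξ w : Lattice d → ℝ → Ω → ℝ} {N c : ℝ} {x : Lattice d}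
    {s : ℝ} {ω : Ω} (hN : |ξ x s ω| ≤ N) (hw : ∀ z, |w z s ω| ≤ c) :
    |evolutionRHS κ ξ w x s ω| ≤ (κ * (4 * d) + N) * c := by
  unfold evolutionRHS
  have h1 := abs_laplacian_le hw x
  have hN0 : 0 ≤ N := (abs_nonneg _).trans hN
  calc _ ≤ |κ * laplacian (fun z => w z s ω) x| + |ξ x s ω * w x s ω| := abs_add_le _ _
    _ = κ * |laplacian (fun z => w z s ω) x| + |ξ x s ω| * |w x s ω| := by
        rw [abs_mul, abs_mul, NNReal.abs_eq]
    _ ≤ κ * (4 * d * c) + N * c := by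
        gcongr
        exact hw x
    _ = _ := by ring

variable [MeasurableSpace Ω]

theorem measurable_evolutionRHS (κ : ℝ≥0) {ξ w : Lattice d → ℝ → Ω → ℝ}
    (hξ : ∀ x, Measurable fun q : ℝ × Ω => ξ x q.1 q.2)
    (hw : ∀ x, Measurable fun q : ℝ × Ω => w x q.1 q.2) (x : Lattice d) :
    Measurable fun q : ℝ × Ω => evolutionRHS κ ξ w x q.1 q.2 := by
  unfold evolutionRHS laplacian
  have h : ∀ z, Measurable fun q : ℝ × Ω => w z q.1 q.2 := hw
  refine Measurable.add (Measurable.const_mul (Finset.measurable_sum _ fun i _ => ?_) _)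
    ((hξ x).mul (hw x))
  exact ((hw _).sub (hw _)).add ((hw _).sub (hw _))

theorem measurable_evolutionRHS_path (κ : ℝ≥0) {ξ w : Lattice d → ℝ → Ω → ℝ}
    (hξ : ∀ x, Measurable fun q : ℝ × Ω => ξ x q.1 q.2)
    (hw : ∀ x, Measurable fun q : ℝ × Ω => w x q.1 q.2) (x : Lattice d) (ω : Ω) :
    Measurable fun s : ℝ => evolutionRHS κ ξ w x s ω :=
  (measurable_evolutionRHS κ hξ hw x).comp (by fun_prop : Measurable fun s : ℝ => (s, ω))

theorem intervalIntegrable_of_abs_le {F G : ℝ → ℝ} (hF : Measurable F) (hG : Continuous G)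
    (h : ∀ s, |F s| ≤ G s) (a b : ℝ) : IntervalIntegrable F volume a b := by
  refine (hG.intervalIntegrable a b).mono_fun hF.aestronglyMeasurable
    (Eventually.of_forall fun s => ?_)
  exact (h s).trans (le_abs_self _)

variable (κ : ℝ≥0) {ξ : Lattice d → ℝ → Ω → ℝ} {N : ℝ}

/-- Measurability and the bound go through one induction, since both are needed for the next
integral to make sense. The truncation `max t 0` makes the iterates constant for negative times, so
that the statements hold on the whole line. -/
theorem picard_spec (hξ : ∀ x, Measurable fun q : ℝ × Ω => ξ x q.1 q.2)
    (hN : ∀ x t ω, |ξ x t ω| ≤ N) (m : ℕ) :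
    (∀ x, Measurable fun q : ℝ × Ω => picard κ ξ m x q.1 q.2) ∧
    (∀ x t ω, |picard κ ξ m x t ω| ≤ ((κ * (4 * d) + N) * max t 0) ^ m / m.factorial) := by
  set M : ℝ := κ * (4 * d) + N with hMdef
  induction m with
  | zero => exact ⟨fun x => measurable_const, fun x t ω => by simp [picard]⟩
  | succ m ih =>
    obtain ⟨ih1, ih2⟩ := ih
    have hmeas := measurable_evolutionRHS κ hξ ih1
    have hbd : ∀ x s ω, |evolutionRHS κ ξ (picard κ ξ m) x s ω| ≤
        M * ((M * max s 0) ^ m / m.factorial) := fun x s ω =>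
      abs_evolutionRHS_le κ (hN x s ω) (fun z => ih2 z s ω)
    have hG : Continuous fun s : ℝ => M * ((M * max s 0) ^ m / m.factorial) := by fun_prop
    have hinteg : ∀ x ω a b, IntervalIntegrable
        (fun s => evolutionRHS κ ξ (picard κ ξ m) x s ω) volume a b := fun x ω a b =>
      intervalIntegrable_of_abs_le (measurable_evolutionRHS_path κ hξ ih1 x ω)
        hG (fun s => hbd x s ω) a b
    refine ⟨fun x => ?_, fun x t ω => ?_⟩
    -- Joint measurability follows from continuity in t and measurability in ω.
    · refine measurable_uncurry_of_continuous_of_measurable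
        (u := fun t ω => picard κ ξ (m + 1) x t ω) (fun ω => ?_) (fun t => ?_)
      · exact (intervalIntegral.continuous_primitive (hinteg x ω) 0).comp (by fun_prop)
      · simp only [picard, intervalIntegral.integral_of_le (le_max_right t 0)]
        exact (StronglyMeasurable.integral_prod_left' (μ := volume.restrict (Set.Ioc 0 (max t 0)))
          (hmeas x).stronglyMeasurable).measurable
    · simp only [picard]
      have h1 := intervalIntegral.norm_integral_le_of_norm_le (μ := volume) (le_max_right t 0)
        (f := fun s => evolutionRHS κ ξ (picard κ ξ m) x s ω)
        (Eventually.of_forall fun s _ => hbd x s ω) (hG.intervalIntegrable 0 (max t 0))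
      refine h1.trans (le_of_eq ?_)
      have h2 : ∫ s in (0 : ℝ)..max t 0, M * ((M * max s 0) ^ m / m.factorial) =
          ∫ s in (0 : ℝ)..max t 0, (M ^ (m + 1) / m.factorial) * s ^ m := by
        refine intervalIntegral.integral_congr fun s hs => ?_
        rw [Set.uIcc_of_le (le_max_right t 0)] at hs
        simp only [max_eq_left hs.1]
        rw [mul_pow, pow_succ]
        ring
      rw [h2, intervalIntegral.integral_const_mul, integral_pow, Nat.factorial_succ]
      have h5 : (m.factorial : ℝ) ≠ 0 := by positivity
      have h6 : (m : ℝ) + 1 ≠ 0 := by positivity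
      push_cast
      rw [zero_pow m.succ_ne_zero, sub_zero, mul_pow]
      field_simp

theorem summable_picardBound (M t : ℝ) :
    HasSum (fun m : ℕ => (M * max t 0) ^ m / m.factorial) (Real.exp (M * max t 0)) := by
  rw [Real.exp_eq_exp_ℝ]
  exact NormedSpace.expSeries_div_hasSum_exp (M * max t 0)

theorem hasSum_picard (hξ : ∀ x, Measurable fun q : ℝ × Ω => ξ x q.1 q.2)
    (hN : ∀ x t ω, |ξ x t ω| ≤ N) (x : Lattice d) (t : ℝ) (ω : Ω) :
    HasSum (fun m => picard κ ξ m x t ω) (picardSum κ ξ x t ω) :=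
  (Summable.of_norm_bounded (f := fun m => picard κ ξ m x t ω)
    (summable_picardBound (κ * (4 * d) + N) t).summable
    fun m => (picard_spec κ hξ hN m).2 x t ω).hasSum

theorem abs_picardSum_le (hξ : ∀ x, Measurable fun q : ℝ × Ω => ξ x q.1 q.2)
    (hN : ∀ x t ω, |ξ x t ω| ≤ N) (x : Lattice d) (t : ℝ) (ω : Ω) :
    |picardSum κ ξ x t ω| ≤ Real.exp ((κ * (4 * d) + N) * max t 0) := by
  have := tsum_of_norm_bounded (f := fun m => picard κ ξ m x t ω)
    (summable_picardBound (κ * (4 * d) + N) t)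
    fun m => (picard_spec κ hξ hN m).2 x t ω
  exact this

theorem measurable_picardSum (hξ : ∀ x, Measurable fun q : ℝ × Ω => ξ x q.1 q.2)
    (hN : ∀ x t ω, |ξ x t ω| ≤ N) (x : Lattice d) :
    Measurable fun q : ℝ × Ω => picardSum κ ξ x q.1 q.2 := by
  refine measurable_of_tendsto_metrizable (f := fun M (q : ℝ × Ω) =>
    ∑ m ∈ Finset.range M, picard κ ξ m x q.1 q.2)
    (fun M => Finset.measurable_sum _ fun m _ => (picard_spec κ hξ hN m).1 x) ?_
  rw [tendsto_pi_nhds]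
  exact fun q => (hasSum_picard κ hξ hN x q.1 q.2).tendsto_sum_nat

theorem picardSum_eq_integral (hξ : ∀ x, Measurable fun q : ℝ × Ω => ξ x q.1 q.2)
    (hN : ∀ x t ω, |ξ x t ω| ≤ N) (x : Lattice d) (t : ℝ) (ω : Ω) :
    picardSum κ ξ x t ω =
      1 + ∫ s in (0 : ℝ)..max t 0, evolutionRHS κ ξ (picardSum κ ξ) x s ω := by
  set M : ℝ := κ * (4 * d) + N with hMdef
  have hM0 : 0 ≤ M := by
    have : 0 ≤ N := (abs_nonneg _).trans (hN x t ω)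
    positivity
  have h1 : HasSum (fun m => picard κ ξ (m + 1) x t ω)
      (∫ s in (0 : ℝ)..max t 0, evolutionRHS κ ξ (picardSum κ ξ) x s ω) := by
    refine intervalIntegral.hasSum_integral_of_dominated_convergence
      (fun m s => M * ((M * max t 0) ^ m / m.factorial)) (fun m => ?_) (fun m => ?_) ?_ ?_ ?_
    · exact (measurable_evolutionRHS_path κ hξ (picard_spec κ hξ hN m).1 x ω).aestronglyMeasurable
    · refine Eventually.of_forall fun s hs => ?_
      rw [Set.uIoc_of_le (le_max_right t 0)] at hs
      refine (abs_evolutionRHS_le κ (hN x s ω) fun z => (picard_spec κ hξ hN m).2 z s ω).trans ?_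
      have : max s 0 ≤ max t 0 := max_le hs.2 (le_max_right _ _)
      have h0 : 0 ≤ max s 0 := le_max_right _ _
      gcongr
    · exact Eventually.of_forall fun s _ => ((summable_picardBound M t).summable.mul_left M)
    · simp
    · refine Eventually.of_forall fun s _ => ?_
      unfold evolutionRHS laplacian
      have h : ∀ z, HasSum (fun m => picard κ ξ m z s ω) (picardSum κ ξ z s ω) :=
        fun z => hasSum_picard κ hξ hN z s ω
      exact ((hasSum_sum fun i _ => ((h _).sub (h _)).add ((h _).sub (h _))).mul_left _).add
        ((h x).mul_left _)
  have h2 := hasSum_picard κ hξ hN x t ω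
  rw [← hasSum_nat_add_iff' 1] at h2
  have h3 := h2.unique h1
  simp only [Finset.sum_range_one, picard] at h3
  linarith

theorem isSolution_picardSum (hξ : ∀ x, Measurable fun q : ℝ × Ω => ξ x q.1 q.2)
    (hN : ∀ x t ω, |ξ x t ω| ≤ N)
    (hrc : ∀ x ω t, 0 ≤ t → ContinuousWithinAt (fun s => ξ x s ω) (Set.Ici t) t) (ω : Ω) :
    IsSolution κ (fun x t => ξ x t ω) (fun x t => picardSum κ ξ x t ω) := by
  set M : ℝ := κ * (4 * d) + N with hMdef
  have hmeas : ∀ x, Measurable fun s => evolutionRHS κ ξ (picardSum κ ξ) x s ω := fun x =>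
    measurable_evolutionRHS_path κ hξ (measurable_picardSum κ hξ hN) x ω
  have hG : Continuous fun s : ℝ => M * Real.exp (M * max s 0) := by fun_prop
  have hbd : ∀ x s, |evolutionRHS κ ξ (picardSum κ ξ) x s ω| ≤ M * Real.exp (M * max s 0) :=
    fun x s => abs_evolutionRHS_le κ (hN x s ω) fun z => abs_picardSum_le κ hξ hN z s ω
  have hinteg : ∀ x a b, IntervalIntegrable
      (fun s => evolutionRHS κ ξ (picardSum κ ξ) x s ω) volume a b := fun x a b =>
    intervalIntegrable_of_abs_le (hmeas x) hG (hbd x) a b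
  have hcont : ∀ x, Continuous fun t => picardSum κ ξ x t ω := by
    intro x
    simp_rw [picardSum_eq_integral κ hξ hN x _ ω]
    exact continuous_const.add
      ((intervalIntegral.continuous_primitive (hinteg x) 0).comp (by fun_prop))
  refine ⟨fun x => ?_, fun x => (hcont x).continuousOn, fun x t ht => ?_, fun T => ?_⟩
  · rw [picardSum_eq_integral κ hξ hN]; simp
  · have hrhs : ContinuousWithinAt (fun s => evolutionRHS κ ξ (picardSum κ ξ) x s ω)
        (Set.Ici t) t := by
      unfold evolutionRHS laplacian
      refine ContinuousWithinAt.add ?_ ((hrc x ω t ht).mul (hcont x).continuousWithinAt)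
      refine Continuous.continuousWithinAt ?_
      exact continuous_const.mul (continuous_finsetSum _ fun i _ =>
        ((hcont _).sub (hcont _)).add ((hcont _).sub (hcont _)))
    -- The integrand jumps with the medium but is right-continuous at t, which is enough for the
    -- right derivative.
    have h1 := intervalIntegral.integral_hasDerivWithinAt_right (hinteg x 0 t) (s := Set.Ici t)
      (t := Set.Ioi t) ((hmeas x).stronglyMeasurable.stronglyMeasurableAtFilter)
      (hrhs.mono Set.Ioi_subset_Ici_self)
    refine (h1.const_add 1).congr (fun s hs => ?_) ?_
    · rw [picardSum_eq_integral κ hξ hN, max_eq_left (ht.trans hs)]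
    · rw [picardSum_eq_integral κ hξ hN, max_eq_left ht]
  · refine ⟨Real.exp (M * max T 0), fun x t ht => (abs_picardSum_le κ hξ hN x t ω).trans ?_⟩
    have hM0 : 0 ≤ M := by
      have : 0 ≤ N := (abs_nonneg _).trans (hN x t ω)
      positivity
    have : max t 0 ≤ max T 0 := max_le_max ht.2 le_rfl
    gcongr

end Picard

/-! ### Measurability of right-continuous processes -/

/-- The times (⌊(N+1)t⌋ + 1)/(N+1) take countably many values and approach t from the right, so
right-continuity makes Z the limit of jointly measurable processes. -/
theorem measurable_uncurry_of_rightContinuous {Ω : Type*} [MeasurableSpace Ω]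
    {Z : ℝ≥0 → Ω → Lattice d} (hm : ∀ t, Measurable (Z t))
    (hrc : ∀ ω t, ContinuousWithinAt (fun s => Z s ω) (Set.Ici t) t) :
    Measurable fun q : ℝ≥0 × Ω => Z q.1 q.2 := by
  have hstep : ∀ N : ℕ, Measurable fun q : ℝ≥0 × Ω =>
      Z (((⌊((N + 1 : ℕ) : ℝ≥0) * q.1⌋₊ + 1 : ℕ) : ℝ≥0) / ((N + 1 : ℕ) : ℝ≥0)) q.2 := by
    intro N
    have h1 : Measurable fun q : ℕ × Ω =>
        Z (((q.1 + 1 : ℕ) : ℝ≥0) / ((N + 1 : ℕ) : ℝ≥0)) q.2 :=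
      measurable_from_prod_countable_right fun k =>
        hm (((k + 1 : ℕ) : ℝ≥0) / ((N + 1 : ℕ) : ℝ≥0))
    exact h1.comp ((Nat.measurable_floor.comp (measurable_fst.const_mul _)).prodMk measurable_snd)
  refine measurable_of_tendsto_metrizable hstep ?_
  rw [tendsto_pi_nhds]
  rintro ⟨t, ω⟩
  refine (hrc ω t).tendsto.comp (tendsto_nhdsWithin_iff.2 ⟨?_, Eventually.of_forall fun N => ?_⟩)
  · refine tendsto_of_tendsto_of_tendsto_of_le_of_le (g := fun _ => t)
      (h := fun N : ℕ => t + 1 / ((N + 1 : ℕ) : ℝ≥0)) tendsto_const_nhds ?_ (fun N => ?_)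
      (fun N => ?_)
    · have : Tendsto (fun N : ℕ => t + 1 / ((N : ℝ≥0) + 1)) atTop (𝓝 (t + 0)) :=
        tendsto_const_nhds.add tendsto_one_div_add_atTop_nhds_zero_nat
      simpa using this
    · simp only
      rw [le_div_iff₀ (by positivity), mul_comm]
      exact_mod_cast (Nat.lt_floor_add_one _).le
    · simp only
      rw [div_le_iff₀ (by positivity), add_mul, div_mul_cancel₀ _ (by positivity)]
      push_cast
      gcongr
      have := Nat.floor_le (a := ((N : ℝ≥0) + 1) * t) (by positivity)
      rw [mul_comm t]
      exact this
  · rw [Set.mem_Ici, le_div_iff₀ (by positivity), mul_comm]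
    exact_mod_cast (Nat.lt_floor_add_one _).le

theorem measurable_catalysts {Ω : Type*} [MeasurableSpace Ω]
    {Z : Fin n → ℝ≥0 → Ω → Lattice d} (hm : ∀ k t, Measurable (Z k t))
    (hrc : ∀ k ω t, ContinuousWithinAt (fun s => Z k s ω) (Set.Ici t) t) (x : Lattice d) :
    Measurable fun q : ℝ × Ω => catalysts (fun k t => Z k t q.2) x q.1 := by
  unfold catalysts
  refine Finset.measurable_sum _ fun k _ => ?_
  have h1 : Measurable fun q : ℝ × Ω => Z k q.1.toNNReal q.2 :=
    (measurable_uncurry_of_rightContinuous (hm k) (hrc k)).comp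
      ((measurable_real_toNNReal.comp measurable_fst).prodMk measurable_snd)
  exact Measurable.ite (h1 (measurableSet_singleton x)) measurable_const measurable_const

theorem eventually_eq_of_rightContinuous {y : ℝ≥0 → Lattice d} {t : ℝ≥0}
    (h : ContinuousWithinAt y (Set.Ici t) t) : ∀ᶠ s in 𝓝[≥] t, y s = y t :=
  h.eventually (IsOpen.mem_nhds (isOpen_discrete {y t}) rfl)

theorem tendsto_toNNReal_nhdsGE (t : ℝ) :
    Tendsto Real.toNNReal (𝓝[≥] t) (𝓝[≥] t.toNNReal) :=
  tendsto_nhdsWithin_iff.2 ⟨(continuous_real_toNNReal.tendsto t).mono_left nhdsWithin_le_nhds,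
    eventually_mem_nhdsWithin.mono fun _ hs => Real.toNNReal_mono hs⟩

theorem rightContinuous_catalysts {y : Fin n → ℝ≥0 → Lattice d}
    (hrc : ∀ k t, ContinuousWithinAt (y k) (Set.Ici t) t) (x : Lattice d) (t : ℝ) :
    ContinuousWithinAt (catalysts y x) (Set.Ici t) t := by
  have h : ∀ᶠ s in 𝓝[≥] t, ∀ k, y k s.toNNReal = y k t.toNNReal :=
    eventually_all.2 fun k =>
      (tendsto_toNNReal_nhdsGE t).eventually (eventually_eq_of_rightContinuous (hrc k _))
  refine ContinuousWithinAt.congr_of_eventuallyEq (f := fun _ => catalysts y x t)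
    continuousWithinAt_const ?_ rfl
  filter_upwards [h] with s hs
  simp only [catalysts, hs]

/-! ### The solution driven by a family of processes -/

section Solution

variable {Ω : Type*}

/-- The catalytic medium of a family of processes. -/
def medium (Y : Fin n → ℝ≥0 → Ω → Lattice d) (x : Lattice d) (t : ℝ) (ω : Ω) : ℝ :=
  catalysts (fun k s => Y k s ω) x t

/-- The solution of the parabolic Anderson equation driven by a family of processes. -/
def sol (κ : ℝ≥0) (Y : Fin n → ℝ≥0 → Ω → Lattice d) : Lattice d → ℝ → Ω → ℝ :=
  picardSum κ (medium Y)

/-- The growth rate in the a priori bound for solutions. -/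
def growth (d n : ℕ) (κ : ℝ≥0) : ℝ := κ * (4 * d) + n

theorem growth_nonneg (κ : ℝ≥0) : 0 ≤ growth d n κ := by unfold growth; positivity

variable [MeasurableSpace Ω] {Y : Fin n → ℝ≥0 → Ω → Lattice d}

theorem isSolution_sol (κ : ℝ≥0) (hm : ∀ k t, Measurable (Y k t))
    (hrc : ∀ k ω t, ContinuousWithinAt (fun s => Y k s ω) (Set.Ici t) t) (ω : Ω) :
    IsSolution κ (catalysts fun k t => Y k t ω) (fun x t => sol κ Y x t ω) :=
  isSolution_picardSum κ (ξ := medium Y) (N := n) (measurable_catalysts hm hrc)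
    (fun x t _ => abs_catalysts_le _ x t)
    (fun x ω t _ => rightContinuous_catalysts (fun k t => hrc k ω t) x t) ω

theorem abs_sol_le (κ : ℝ≥0) (hm : ∀ k t, Measurable (Y k t))
    (hrc : ∀ k ω t, ContinuousWithinAt (fun s => Y k s ω) (Set.Ici t) t) (x : Lattice d) (t : ℝ)
    (ω : Ω) : |sol κ Y x t ω| ≤ Real.exp (growth d n κ * max t 0) :=
  abs_picardSum_le κ (ξ := medium Y) (N := n) (measurable_catalysts hm hrc)
    (fun x t _ => abs_catalysts_le _ x t) x t ω

theorem measurable_sol (κ : ℝ≥0) (hm : ∀ k t, Measurable (Y k t))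
    (hrc : ∀ k ω t, ContinuousWithinAt (fun s => Y k s ω) (Set.Ici t) t) (x : Lattice d) (t : ℝ) :
    Measurable (sol κ Y x t) := by
  have h := measurable_picardSum κ (ξ := medium Y) (N := n) (measurable_catalysts hm hrc)
    (fun x t _ => abs_catalysts_le _ x t) x
  exact h.comp (measurable_prodMk_left (x := t))

/-- The path of the processes up to time `s`. -/
def past (Y : Fin n → ℝ≥0 → Ω → Lattice d) (s : ℝ≥0) (ω : Ω) (q : Fin n × Set.Iic s) :
    Lattice d := Y q.1 q.2 ω

/-- The paths are stopped at time s. The stopped family is measurable with respect to the past and,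
by `IsSolution.eq_of_agree`, drives the same solution up to time s. -/
theorem measurable_sol_past (κ : ℝ≥0) (hm : ∀ k t, Measurable (Y k t))
    (hrc : ∀ k ω t, ContinuousWithinAt (fun s => Y k s ω) (Set.Ici t) t) (x : Lattice d)
    (s : ℝ≥0) :
    Measurable[MeasurableSpace.comap (past Y s) inferInstance] (sol κ Y x s) := by
  let Z : Fin n → ℝ≥0 → Ω → Lattice d := fun k r ω => Y k (min r s) ω
  have hZrc : ∀ k ω t, ContinuousWithinAt (fun r => Z k r ω) (Set.Ici t) t := by
    intro k ω t
    refine ContinuousWithinAt.comp (t := Set.Ici (min t s)) (g := fun r => Y k r ω)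
      (f := fun r : ℝ≥0 => min r s) (hrc k ω (min t s))
      (Continuous.continuousWithinAt (by fun_prop)) fun r hr => ?_
    exact min_le_min_right s hr
  have hZm : ∀ k t, Measurable[MeasurableSpace.comap (past Y s) inferInstance] (Z k t) := by
    intro k t
    have h1 : Z k t =
        (fun w : Fin n × Set.Iic s → Lattice d => w (k, ⟨min t s, min_le_right t s⟩)) ∘
        past Y s := rfl
    rw [h1]
    exact (measurable_pi_apply _).comp (comap_measurable _)
  have h := @measurable_sol d n Ω (MeasurableSpace.comap (past Y s) inferInstance) Z κ hZm hZrc x s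
  have heq : sol κ Y x s = sol κ Z x s := by
    funext ω
    have h1 := isSolution_sol κ hm hrc ω
    have h2 := @isSolution_sol d n Ω (MeasurableSpace.comap (past Y s) inferInstance) Z κ hZm hZrc ω
    refine h1.eq_of_agree h2 (T := s) (N := n) (abs_catalysts_le _) (fun x t ht => ?_) x s
      ⟨s.2, le_rfl⟩
    have h3 : min t.toNNReal s = t.toNNReal := min_eq_left (by
      rw [← NNReal.coe_le_coe, Real.coe_toNNReal t ht.1]; exact ht.2.le)
    simp only [catalysts, Z, h3]
  rw [heq]
  exact h

end Solution

/-! ### Independence of the past and the increments -/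

/-- One partition passes through all past times in J and has s, t as its points N and N + 1. The
past is then a function of the increments with index below N, and the future increment is the one
with index N. -/
theorem exists_monotone_covering (J : Finset ℝ≥0) : ∀ s t : ℝ≥0, (∀ r ∈ J, r ≤ s) → s ≤ t →
    ∃ (τ : ℕ → ℝ≥0) (N : ℕ), Monotone τ ∧ τ 0 = 0 ∧ τ N = s ∧ τ (N + 1) = t ∧
      ∀ r ∈ J, ∃ i ≤ N, τ i = r := by
  induction J using Finset.induction_on_max with
  | empty =>
    intro s t _ hst
    refine ⟨fun i => if i = 0 then 0 else if i = 1 then s else t, 1, ?_, by simp, by simp, by simp,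
      by simp⟩
    refine monotone_nat_of_le_succ fun i => ?_
    rcases i with _ | _ | i <;> simp [hst]
  | insert a J ha ih =>
    intro s t hJ hst
    obtain ⟨τ, N, hτ, h0, hN, hN1, hcov⟩ := ih a s (fun r hr => (ha r hr).le)
      (hJ a (Finset.mem_insert_self _ _))
    refine ⟨fun i => if i ≤ N + 1 then τ i else t, N + 1, ?_, by simp [h0], by simp [hN1],
      by simp, fun r hr => ?_⟩
    · refine monotone_nat_of_le_succ fun i => ?_
      by_cases h : i + 1 ≤ N + 1
      · simp only [if_pos h, if_pos ((Nat.le_succ i).trans h)]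
        exact hτ (Nat.le_succ i)
      · simp only [if_neg h]
        split_ifs with h2
        · exact (hτ h2).trans (hN1.le.trans hst)
        · exact le_rfl
    · rcases Finset.mem_insert.1 hr with rfl | hr
      · exact ⟨N, Nat.le_succ N, by simp [hN]⟩
      · obtain ⟨i, hi, hir⟩ := hcov r hr
        exact ⟨i, hi.trans (Nat.le_succ N), by simp [hi.trans (Nat.le_succ N), hir]⟩

theorem indepFun_past_increment [NeZero d] {ρ : ℝ≥0} {Ω : Type*} [MeasurableSpace Ω]
    {P : Measure Ω} [IsProbabilityMeasure P] {Y : Fin n → ℝ≥0 → Ω → Lattice d}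
    (hY : ∀ k, IsSimpleRandomWalk P ρ (Y k)) (hindep : iIndepFun (fun k ω t => Y k t ω) P)
    {s t : ℝ≥0} (hst : s ≤ t) :
    IndepFun (past Y s) (fun ω k => Y k t ω - Y k s ω) P := by
  classical
  have hm : ∀ k t, Measurable (Y k t) := fun k => (hY k).measurable
  refine IndepFun.process_indepFun (X := fun (q : Fin n × Set.Iic s) ω => Y q.1 q.2 ω)
    (fun q => hm _ _) (measurable_pi_lambda _ fun k => (hm k t).sub (hm k s)) fun I => ?_
  obtain ⟨τ, N, hτ, h0, hN, hN1, hcov⟩ := exists_monotone_covering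
    (I.image fun q => (q.2 : ℝ≥0)) s t (fun r hr => by
      obtain ⟨q, -, rfl⟩ := Finset.mem_image.1 hr
      exact q.2.2) hst
  have hidx : ∀ q : I, ∃ i ≤ N, τ i = (q.1.2 : ℝ≥0) := fun q =>
    hcov _ (Finset.mem_image.2 ⟨q.1, q.2, rfl⟩)
  choose idx hidxN hidxτ using hidx
  let F : Fin n → ℕ → Ω → Lattice d := fun k l ω => Y k (τ (l + 1)) ω - Y k (τ l) ω
  have hFm : ∀ k l, Measurable (F k l) := fun k l => (hm _ _).sub (hm _ _)
  -- Independence between catalysts and independence of the increments of each one combine into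
  -- joint independence over pairs (catalyst, interval).
  have hF : iIndepFun (fun (q : Fin n × ℕ) ω => F q.1 q.2 ω) P := by
    refine iIndepFun_uncurry' hFm ?_ fun k => (hY k).indepIncrements.nat hτ
    exact hindep.comp (fun _ (w : ℝ≥0 → Lattice d) l => w (τ (l + 1)) - w (τ l)) fun _ =>
      measurable_pi_lambda _ fun l => (measurable_pi_apply _).sub (measurable_pi_apply _)
  have h1 := hF.indepFun_finset (Finset.univ ×ˢ Finset.range N) (Finset.univ ×ˢ {N})
    (Finset.disjoint_left.2 fun q hq hq' => by
      simp only [Finset.mem_product, Finset.mem_univ, true_and, Finset.mem_range,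
        Finset.mem_singleton] at hq hq'
      omega) (fun q => hFm _ _)
  have hmem : ∀ (q : I) (l : ℕ), l ∈ Finset.range (idx q) →
      (q.1.1, l) ∈ (Finset.univ : Finset (Fin n)) ×ˢ Finset.range N := fun q l hl => by
    have := hidxN q
    simp only [Finset.mem_product, Finset.mem_univ, true_and, Finset.mem_range] at hl ⊢
    omega
  let φ : (((Finset.univ : Finset (Fin n)) ×ˢ Finset.range N : Finset (Fin n × ℕ)) → Lattice d) →
      (I → Lattice d) := fun δ q => ∑ l ∈ (Finset.range (idx q)).attach,
        δ ⟨(q.1.1, l.1), hmem q l.1 l.2⟩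
  let ψ : (((Finset.univ : Finset (Fin n)) ×ˢ {N} : Finset (Fin n × ℕ)) → Lattice d) →
      (Fin n → Lattice d) := fun δ k => δ ⟨(k, N), by simp⟩
  have hφ : Measurable φ := measurable_pi_lambda _ fun q =>
    Finset.measurable_sum _ fun l _ => measurable_pi_apply _
  have hψ : Measurable ψ := measurable_pi_lambda _ fun k => measurable_pi_apply _
  refine (h1.comp hφ hψ).congr ?_ (Eventually.of_forall fun ω => ?_)
  -- Past positions are telescoping sums of increments only because the walks start at 0, which
  -- holds almost surely.
  · have hstart : ∀ᵐ ω ∂P, ∀ k, Y k 0 ω = 0 := ae_all_iff.2 fun k => (hY k).start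
    filter_upwards [hstart] with ω hω
    funext q
    simp only [φ, F, Function.comp_apply]
    rw [Finset.sum_attach (Finset.range (idx q))
      (fun l => Y q.1.1 (τ (l + 1)) ω - Y q.1.1 (τ l) ω),
      Finset.sum_range_sub (fun l => Y q.1.1 (τ l) ω), h0, hω, sub_zero, hidxτ]
  · funext k
    simp only [ψ, F, Function.comp_apply, hN, hN1]

section

/-! ### Small-time behaviour of the increments -/

theorem integrable_of_abs_le {α : Type*} [MeasurableSpace α] {μ : Measure α} [IsFiniteMeasure μ]
    {f : α → ℝ} (hf : Measurable f) {C : ℝ} (hC : ∀ a, |f a| ≤ C) : Integrable f μ :=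
  Integrable.of_bound hf.aestronglyMeasurable C (Eventually.of_forall hC)

theorem abs_integral_le_of_abs_le {α : Type*} [MeasurableSpace α] {μ : Measure α}
    [IsProbabilityMeasure μ] {f : α → ℝ} {C : ℝ} (hC : ∀ a, |f a| ≤ C) : |∫ a, f a ∂μ| ≤ C := by
  have := norm_integral_le_of_norm_le_const (μ := μ) (f := f) (Eventually.of_forall hC)
  simpa using this

variable [NeZero d]

/-- The kernel of the discrete-time walk. -/
def walkKernel (d : ℕ) [NeZero d] : Kernel ℕ (Lattice d) :=
  ⟨fun m => (walkPMF d m).toMeasure, measurable_of_countable _⟩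

instance : IsMarkovKernel (walkKernel d) :=
  ⟨fun m => PMF.toMeasure.isProbabilityMeasure (walkPMF d m)⟩

theorem displacementLaw_eq (r : ℝ≥0) :
    displacementLaw d r = (walkKernel d ∘ₖ Kernel.const Unit (poissonMeasure r)) () := by
  rw [Kernel.comp_apply]; rfl

instance (r : ℝ≥0) : IsProbabilityMeasure (displacementLaw d r) := by
  rw [displacementLaw_eq]; infer_instance

theorem hasSum_integral_displacementLaw (r : ℝ≥0) {φ : Lattice d → ℝ} {C : ℝ}
    (hC : ∀ a, |φ a| ≤ C) :
    HasSum (fun m : ℕ => (Real.exp (-r) * r ^ m / m.factorial) *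
      ∫ a, φ a ∂(walkPMF d m).toMeasure) (∫ a, φ a ∂displacementLaw d r) := by
  have hinteg : Integrable φ (displacementLaw d r) :=
    integrable_of_abs_le (measurable_of_countable _) hC
  rw [displacementLaw_eq] at hinteg ⊢
  rw [ProbabilityTheory.Kernel.integral_comp hinteg]
  have h2 : Integrable (fun m => ∫ a, φ a ∂walkKernel d m) (poissonMeasure r) :=
    integrable_of_abs_le (measurable_of_countable _) fun m => abs_integral_le_of_abs_le hC
  exact hasSum_integral_poissonMeasure h2

theorem integral_walkPMF_zero (φ : Lattice d → ℝ) : ∫ a, φ a ∂(walkPMF d 0).toMeasure = φ 0 := by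
  rw [walkPMF, PMF.toMeasure_pure, integral_dirac]

theorem integral_walkPMF_one (φ : Lattice d → ℝ) :
    2 * d * ∫ a, φ a ∂(walkPMF d 1).toMeasure =
      ∑ i : Fin d, (φ (basisVec i) + φ (-basisVec i)) := by
  have h1 : walkPMF d 1 = (PMF.uniformOfFintype (Fin d × Bool)).map
      fun a => if a.2 then basisVec a.1 else -basisVec a.1 := by
    simp only [walkPMF, PMF.pure_bind, zero_add]
    exact PMF.map_id _
  have hmeas : Measurable fun a : Fin d × Bool =>
      if a.2 then (basisVec a.1 : Lattice d) else -basisVec a.1 := measurable_of_countable _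
  rw [h1, ← PMF.toMeasure_map _ _ hmeas, integral_map hmeas.aemeasurable
    (measurable_of_countable _).aestronglyMeasurable, PMF.integral_eq_sum, Fintype.sum_prod_type]
  simp only [Fintype.sum_bool, PMF.uniformOfFintype_apply, Fintype.card_prod, Fintype.card_fin,
    Fintype.card_bool, if_true, Bool.false_eq_true, if_false, smul_eq_mul,
    ← Finset.mul_sum]
  have hd : (d : ℝ) ≠ 0 := by exact_mod_cast NeZero.ne d
  rw [← mul_assoc]
  have : 2 * (d : ℝ) * ((((d * 2 : ℕ) : ℝ≥0∞))⁻¹).toReal = 1 := by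
    rw [ENNReal.toReal_inv, ENNReal.toReal_natCast]
    push_cast
    field_simp
  rw [this, one_mul]

/-- First-order expansion in the Poisson mean r: two or more steps have total weight 1 - exp(-r)(1 +
r), and replacing exp(-r) r by r costs a further term of order r². Each is multiplied by an
oscillation of at most 2C. -/
theorem abs_integral_displacementLaw_sub_le (r : ℝ≥0) {φ : Lattice d → ℝ} {C : ℝ}
    (hC : ∀ a, |φ a| ≤ C) :
    |∫ a, φ a ∂displacementLaw d r - φ 0 - r * (∫ a, φ a ∂(walkPMF d 1).toMeasure - φ 0)| ≤
      4 * C * r ^ 2 := by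
  set A : ℕ → ℝ := fun m => ∫ a, φ a ∂(walkPMF d m).toMeasure with hA
  set w : ℕ → ℝ := fun m => Real.exp (-r) * r ^ m / m.factorial with hw
  have hA0 : A 0 = φ 0 := integral_walkPMF_zero φ
  have hAC : ∀ m, |A m - A 0| ≤ 2 * C := fun m => by
    have h1 : |A m| ≤ C := abs_integral_le_of_abs_le hC
    have h2 : |A 0| ≤ C := abs_integral_le_of_abs_le hC
    rw [abs_le] at h1 h2 ⊢
    constructor <;> linarith
  have hw0 : ∀ m, 0 ≤ w m := fun m => by simp only [hw]; positivity
  have hw1 : HasSum w 1 := hasSum_one_poissonMeasure r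
  have hs : HasSum (fun m => w m * A m) (∫ a, φ a ∂displacementLaw d r) :=
    hasSum_integral_displacementLaw r hC
  have hs1 : HasSum (fun m => w m * (A m - A 0)) (∫ a, φ a ∂displacementLaw d r - A 0) := by
    have := hs.sub (hw1.mul_right (A 0))
    simpa [mul_sub] using this
  have hs2 := (hasSum_nat_add_iff' 2).2 hs1
  have hw2 := (hasSum_nat_add_iff' 2).2 hw1
  simp only [Finset.sum_range_succ, Finset.sum_range_zero, sub_self, mul_zero, zero_add] at hs2 hw2
  have hbound : |∫ a, φ a ∂displacementLaw d r - A 0 - w 1 * (A 1 - A 0)| ≤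
      (1 - (w 0 + w 1)) * (2 * C) := by
    rw [← hs2.tsum_eq]
    refine tsum_of_norm_bounded (f := fun m => w (m + 2) * (A (m + 2) - A 0))
      (hw2.mul_right (2 * C)) fun m => ?_
    rw [norm_mul, Real.norm_of_nonneg (hw0 _)]
    exact mul_le_mul_of_nonneg_left (hAC _) (hw0 _)
  have e0 : w 0 = Real.exp (-r) := by simp [hw]
  have e1 : w 1 = Real.exp (-r) * r := by simp [hw]
  have hexp : 1 - (r : ℝ) ≤ Real.exp (-r) := by
    have := Real.add_one_le_exp (-(r : ℝ)); linarith
  have hexp1 : Real.exp (-(r : ℝ)) ≤ 1 := by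
    rw [Real.exp_le_one_iff]; simp
  have hr : (0 : ℝ) ≤ r := r.2
  rw [e0, e1] at hbound
  rw [e1] at *
  have hC0 : 0 ≤ C := (abs_nonneg _).trans (hC 0)
  have h1 := hAC 1
  rw [← hA0]
  change |∫ a, φ a ∂displacementLaw d r - A 0 - r * (A 1 - A 0)| ≤ _
  have key : |(r - Real.exp (-r) * r) * (A 1 - A 0)| ≤ (r - Real.exp (-r) * r) * (2 * C) := by
    rw [abs_mul, abs_of_nonneg (by nlinarith)]
    exact mul_le_mul_of_nonneg_left h1 (by nlinarith)
  have htri : |∫ a, φ a ∂displacementLaw d r - A 0 - r * (A 1 - A 0)| ≤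
      (1 - (Real.exp (-r) + Real.exp (-r) * r)) * (2 * C) +
        (r - Real.exp (-r) * r) * (2 * C) := by
    have : ∫ a, φ a ∂displacementLaw d r - A 0 - r * (A 1 - A 0) =
      (∫ a, φ a ∂displacementLaw d r - A 0 - Real.exp (-r) * r * (A 1 - A 0)) -
        (r - Real.exp (-r) * r) * (A 1 - A 0) := by ring
    rw [this]
    exact (abs_sub _ _).trans (add_le_add hbound key)
  refine htri.trans ?_
  -- Only exp(-r) ≥ 1 - r is used: the left side is 1 + r - exp(-r)(1 + 2r).
  have h3 : (1 - (Real.exp (-r) + Real.exp (-r) * r)) + (r - Real.exp (-r) * r) ≤ 2 * r ^ 2 := by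
    nlinarith
  nlinarith

theorem integral_displacementLaw_ne_zero_le (r : ℝ≥0) :
    (displacementLaw d r).real {a | a ≠ 0} ≤ r + 4 * r ^ 2 := by
  classical
  have h := abs_integral_displacementLaw_sub_le r
    (φ := Set.indicator {a : Lattice d | a ≠ 0} fun _ => (1 : ℝ)) (C := 1) (fun a => by
      by_cases ha : a = 0 <;> simp [ha])
  have h1 : ∫ a, Set.indicator {a : Lattice d | a ≠ 0} (fun _ => (1 : ℝ)) a
      ∂(walkPMF d 1).toMeasure ≤ 1 := by
    refine (le_abs_self _).trans (abs_integral_le_of_abs_le fun a => ?_)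
    by_cases ha : a = 0 <;> simp [ha]
  have h2 : ∫ a, Set.indicator {a : Lattice d | a ≠ 0} (fun _ => (1 : ℝ)) a ∂displacementLaw d r =
      (displacementLaw d r).real {a | a ≠ 0} := by
    rw [integral_indicator_const _ (Set.to_countable _).measurableSet]; simp
  rw [h2] at h
  have h3 := (abs_le.1 h).2
  have h0 : Set.indicator {a : Lattice d | a ≠ 0} (fun _ => (1 : ℝ)) 0 = 0 := by simp
  rw [h0] at h3
  have hr : (0 : ℝ) ≤ r := r.2
  nlinarith [mul_le_mul_of_nonneg_left h1 hr]

/-- If at most one catalyst moves, φ(a) - φ(0) is exactly the sum of its one-catalyst variations.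
Two catalysts move with probability of order r², by pairwise independence. Thus, to first order, the
catalysts contribute additively. -/
theorem abs_integral_increments_sub_le {Ω : Type*} [MeasurableSpace Ω] {P : Measure Ω}
    [IsProbabilityMeasure P] {D : Fin n → Ω → Lattice d} (hDm : ∀ k, Measurable (D k)) {r : ℝ≥0}
    (hlaw : ∀ k, HasLaw (D k) (displacementLaw d r) P)
    (hpair : ∀ k l, k ≠ l → IndepFun (D k) (D l) P)
    {φ : (Fin n → Lattice d) → ℝ} {C : ℝ} (hC : ∀ a, |φ a| ≤ C) :
    |∫ ω, φ (fun k => D k ω) ∂P - φ 0 -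
      ∑ k, r * (∫ a, φ (Pi.single k a) ∂(walkPMF d 1).toMeasure - φ 0)| ≤
      n * (4 * C * r ^ 2) + (2 + 2 * n) * C * (n * (n * (r + 4 * r ^ 2) ^ 2)) := by
  classical
  have hC0 : 0 ≤ C := (abs_nonneg _).trans (hC 0)
  let R : (Fin n → Lattice d) → ℝ := fun a =>
    φ a - φ 0 - ∑ k, (φ (Pi.single k (a k)) - φ 0)
  let B : (Fin n → Lattice d) → ℝ := fun a =>
    ∑ k, ∑ l, if k ≠ l ∧ a k ≠ 0 ∧ a l ≠ 0 then (1 : ℝ) else 0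
  have hB0 : ∀ (a : Fin n → Lattice d) (k l : Fin n),
      (0 : ℝ) ≤ if k ≠ l ∧ a k ≠ 0 ∧ a l ≠ 0 then (1 : ℝ) else 0 :=
    fun a k l => by split_ifs <;> simp
  -- The remainder R vanishes unless two components are nonzero, and B is then at least 1 because it
  -- counts such ordered pairs.
  have hR : ∀ a, |R a| ≤ (2 + 2 * n) * C * B a := by
    intro a
    by_cases h : ∃ k l, k ≠ l ∧ a k ≠ 0 ∧ a l ≠ 0
    · obtain ⟨k, l, hkl⟩ := h
      have h1 : 1 ≤ B a := by
        calc (1 : ℝ) = if k ≠ l ∧ a k ≠ 0 ∧ a l ≠ 0 then (1 : ℝ) else 0 := by rw [if_pos hkl]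
          _ ≤ ∑ l, if k ≠ l ∧ a k ≠ 0 ∧ a l ≠ 0 then (1 : ℝ) else 0 :=
            Finset.single_le_sum (fun l _ => hB0 a k l) (Finset.mem_univ l)
          _ ≤ _ := Finset.single_le_sum
            (f := fun k => ∑ l, if k ≠ l ∧ a k ≠ 0 ∧ a l ≠ 0 then (1 : ℝ) else 0)
            (fun k _ => Finset.sum_nonneg fun l _ => hB0 a k l) (Finset.mem_univ k)
      have h2 : ∀ b, |φ b - φ 0| ≤ 2 * C := fun b => by
        have h3 := abs_le.1 (hC b)
        have h4 := abs_le.1 (hC 0)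
        rw [abs_le]; constructor <;> linarith
      have h5 : |R a| ≤ (2 + 2 * n) * C := by
        calc |R a| ≤ |φ a - φ 0| + |∑ k, (φ (Pi.single k (a k)) - φ 0)| := abs_sub _ _
          _ ≤ 2 * C + ∑ _k : Fin n, 2 * C := add_le_add (h2 a)
              ((Finset.abs_sum_le_sum_abs _ _).trans (Finset.sum_le_sum fun k _ => h2 _))
          _ = _ := by simp; ring
      exact h5.trans (le_mul_of_one_le_right (by positivity) h1)
    · push Not at h
      have h1 : R a = 0 := by
        by_cases ha : a = 0
        · simp [R, ha]
        · obtain ⟨k, hk⟩ : ∃ k, a k ≠ 0 := by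
            by_contra! h0; exact ha (funext h0)
          have hl : ∀ l, l ≠ k → a l = 0 := fun l hlk => h k l hlk.symm hk
          have hak : Pi.single k (a k) = a := by
            funext l
            rcases eq_or_ne l k with rfl | hlk
            · simp
            · rw [Pi.single_eq_of_ne hlk, hl l hlk]
          have hsum : ∑ l, (φ (Pi.single l (a l)) - φ 0) = φ a - φ 0 := by
            rw [Finset.sum_eq_single k, hak]
            · intro l _ hlk
              rw [hl l hlk, Pi.single_zero, sub_self]
            · simp
          simp only [R, hsum, sub_self]
      rw [h1, abs_zero]
      exact mul_nonneg (by positivity)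
        (Finset.sum_nonneg fun k _ => Finset.sum_nonneg fun l _ => hB0 a k l)
  have hDv : Measurable fun ω k => D k ω := measurable_pi_lambda _ hDm
  have hφm : Measurable fun ω => φ (fun k => D k ω) :=
    (measurable_of_countable φ).comp hDv
  have hφi : Integrable (fun ω => φ (fun k => D k ω)) P :=
    integrable_of_abs_le hφm fun ω => hC _
  have hki' : ∀ k, Integrable (fun ω => φ (Pi.single k (D k ω))) P := fun k =>
    integrable_of_abs_le ((measurable_of_countable fun a => φ (Pi.single k a)).comp (hDm k))
      fun ω => hC _
  have hki : ∀ k, Integrable (fun ω => φ (Pi.single k (D k ω)) - φ 0) P := fun k =>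
    (hki' k).sub (integrable_const _)
  have hφ0 : Integrable (fun ω => φ (fun k => D k ω) - φ 0) P := hφi.sub (integrable_const _)
  have hk : ∀ k, ∫ ω, (φ (Pi.single k (D k ω)) - φ 0) ∂P =
      ∫ a, φ (Pi.single k a) ∂displacementLaw d r - φ 0 := fun k => by
    rw [integral_sub (hki' k) (integrable_const _)]
    have := (hlaw k).integral_comp (f := fun a => φ (Pi.single k a))
      (measurable_of_countable _).aestronglyMeasurable
    simp only [Function.comp_def] at this
    rw [this]
    simp
  have hRint : ∫ ω, R (fun k => D k ω) ∂P = ∫ ω, φ (fun k => D k ω) ∂P - φ 0 -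
      ∑ k, (∫ a, φ (Pi.single k a) ∂displacementLaw d r - φ 0) := by
    simp only [R]
    rw [integral_sub hφ0 (integrable_finsetSum _ fun k _ => hki k),
      integral_sub hφi (integrable_const _), integral_finsetSum _ fun k _ => hki k]
    simp [hk]
  have hq : ∀ k, P.real {ω | D k ω ≠ 0} ≤ r + 4 * r ^ 2 := fun k => by
    have h1 := (hlaw k).measure_eq (p := fun a => a ≠ 0) (Set.to_countable _).measurableSet
    rw [measureReal_def, h1]
    exact integral_displacementLaw_ne_zero_le r
  have hEm : ∀ k, MeasurableSet {ω | D k ω ≠ 0} := fun k =>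
    hDm k (measurableSet_singleton 0).compl
  have hterm : ∀ k l, Integrable (fun ω => if k ≠ l ∧ D k ω ≠ 0 ∧ D l ω ≠ 0 then (1 : ℝ) else 0) P ∧
      ∫ ω, (if k ≠ l ∧ D k ω ≠ 0 ∧ D l ω ≠ 0 then (1 : ℝ) else 0) ∂P ≤ (r + 4 * r ^ 2) ^ 2 := by
    intro k l
    by_cases hkl : k = l
    · simp only [hkl, ne_eq, not_true_eq_false, false_and, if_false]
      exact ⟨integrable_const _, by simp; positivity⟩
    have he : (fun ω => if k ≠ l ∧ D k ω ≠ 0 ∧ D l ω ≠ 0 then (1 : ℝ) else 0) =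
        Set.indicator ({ω | D k ω ≠ 0} ∩ {ω | D l ω ≠ 0}) fun _ => 1 := by
      funext ω
      simp [Set.indicator_apply, hkl]
    rw [he]
    refine ⟨(integrable_const _).indicator ((hEm k).inter (hEm l)), ?_⟩
    rw [integral_indicator_const _ ((hEm k).inter (hEm l)), smul_eq_mul, mul_one]
    have hi := (hpair k l hkl).measure_inter_preimage_eq_mul _ _
      (measurableSet_singleton (0 : Lattice d)).compl
      (measurableSet_singleton (0 : Lattice d)).compl
    have hi' : P.real ({ω | D k ω ≠ 0} ∩ {ω | D l ω ≠ 0}) =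
        P.real {ω | D k ω ≠ 0} * P.real {ω | D l ω ≠ 0} := by
      rw [measureReal_def, measureReal_def, measureReal_def, ← ENNReal.toReal_mul]
      exact congrArg _ hi
    rw [hi', sq]
    exact mul_le_mul (hq k) (hq l) measureReal_nonneg (by positivity)
  have hBint : ∫ ω, B (fun k => D k ω) ∂P ≤ n * (n * (r + 4 * r ^ 2) ^ 2) := by
    simp only [B]
    rw [integral_finsetSum _ fun k _ => integrable_finsetSum _ fun l _ => (hterm k l).1]
    calc _ ≤ ∑ _k : Fin n, ∑ _l : Fin n, ((r : ℝ) + 4 * r ^ 2) ^ 2 := by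
          refine Finset.sum_le_sum fun k _ => ?_
          rw [integral_finsetSum _ fun l _ => (hterm k l).1]
          exact Finset.sum_le_sum fun l _ => (hterm k l).2
      _ = _ := by simp
  have hRle : |∫ ω, R (fun k => D k ω) ∂P| ≤
      (2 + 2 * n) * C * (n * (n * (r + 4 * r ^ 2) ^ 2)) := by
    calc _ ≤ ∫ ω, (2 + 2 * n) * C * B (fun k => D k ω) ∂P := by
          refine norm_integral_le_of_norm_le (f := fun ω => R fun k => D k ω) ?_
            (Eventually.of_forall fun ω => hR _)
          exact (integrable_finsetSum _ fun k _ => integrable_finsetSum _ fun l _ =>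
            (hterm k l).1).const_mul _
      _ = (2 + 2 * n) * C * ∫ ω, B (fun k => D k ω) ∂P := integral_const_mul _ _
      _ ≤ _ := mul_le_mul_of_nonneg_left hBint (by positivity)
  have hone : ∀ k, |∫ a, φ (Pi.single k a) ∂displacementLaw d r - φ 0 -
      r * (∫ a, φ (Pi.single k a) ∂(walkPMF d 1).toMeasure - φ 0)| ≤ 4 * C * r ^ 2 := fun k => by
    have := abs_integral_displacementLaw_sub_le r (φ := fun a => φ (Pi.single k a))
      (fun a => hC _)
    simpa using this
  have hsplit : ∫ ω, φ (fun k => D k ω) ∂P - φ 0 -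
      ∑ k, r * (∫ a, φ (Pi.single k a) ∂(walkPMF d 1).toMeasure - φ 0) =
      (∑ k, (∫ a, φ (Pi.single k a) ∂displacementLaw d r - φ 0 -
        r * (∫ a, φ (Pi.single k a) ∂(walkPMF d 1).toMeasure - φ 0))) +
        ∫ ω, R (fun k => D k ω) ∂P := by
    rw [hRint]
    simp only [Finset.sum_sub_distrib]
    ring
  rw [hsplit]
  refine (abs_add_le _ _).trans (add_le_add ?_ hRle)
  refine (Finset.abs_sum_le_sum_abs _ _).trans ((Finset.sum_le_sum fun k _ => hone k).trans ?_)
  simp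

end

/-! ### Products of solutions -/

section Product

variable {Ω : Type*}

/-- The product of the solution over `p` sites. -/
def solProd (κ : ℝ≥0) (Y : Fin n → ℝ≥0 → Ω → Lattice d) (x : Fin p → Lattice d) (t : ℝ) (ω : Ω) :
    ℝ := ∏ j, sol κ Y (x j) t ω

/-- The right derivative of `solProd`. -/
def solProdDeriv (κ : ℝ≥0) (Y : Fin n → ℝ≥0 → Ω → Lattice d) (x : Fin p → Lattice d) (t : ℝ)
    (ω : Ω) : ℝ :=
  ∑ j, (∏ l ∈ Finset.univ.erase j, sol κ Y (x l) t ω) *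
    evolutionRHS κ (medium Y) (sol κ Y) (x j) t ω

theorem prod_add_single (s : Lattice d → ℝ) (x : Fin p → Lattice d) (j : Fin p) (a : Lattice d) :
    ∏ l, s ((x + Pi.single j a : Fin p → Lattice d) l) =
      (∏ l ∈ Finset.univ.erase j, s (x l)) * s (x j + a) := by
  rw [← Finset.prod_erase_mul _ _ (Finset.mem_univ j)]
  congr 1
  · refine Finset.prod_congr rfl fun l hl => ?_
    rw [Pi.add_apply, Pi.single_eq_of_ne (Finset.ne_of_mem_erase hl), add_zero]
  · simp

/-- Moving x_j changes only the j-th factor, so the product rule yields the Laplacian in x of the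
product itself, plus the total medium at the sites. -/
theorem solProdDeriv_eq (κ : ℝ≥0) (Y : Fin n → ℝ≥0 → Ω → Lattice d) (x : Fin p → Lattice d)
    (t : ℝ) (ω : Ω) :
    solProdDeriv κ Y x t ω =
      κ * (∑ j : Fin p, ∑ i : Fin d, (
        (solProd κ Y (x + Pi.single j (basisVec i)) t ω - solProd κ Y x t ω) +
        (solProd κ Y (x - Pi.single j (basisVec i)) t ω - solProd κ Y x t ω))) +
      (∑ j, medium Y (x j) t ω) * solProd κ Y x t ω := by
  unfold solProdDeriv
  rw [Finset.mul_sum, Finset.sum_mul, ← Finset.sum_add_distrib]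
  refine Finset.sum_congr rfl fun j _ => ?_
  have h0 : solProd κ Y x t ω =
      (∏ l ∈ Finset.univ.erase j, sol κ Y (x l) t ω) * sol κ Y (x j) t ω := by
    have := prod_add_single (fun z => sol κ Y z t ω) x j 0
    simpa [solProd] using this
  have h1 : ∀ a, solProd κ Y (x + Pi.single j a) t ω =
      (∏ l ∈ Finset.univ.erase j, sol κ Y (x l) t ω) * sol κ Y (x j + a) t ω := fun a =>
    prod_add_single (fun z => sol κ Y z t ω) x j a
  have h2 : ∀ a, solProd κ Y (x - Pi.single j a) t ω =
      (∏ l ∈ Finset.univ.erase j, sol κ Y (x l) t ω) * sol κ Y (x j - a) t ω := fun a => by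
    rw [sub_eq_add_neg, ← Pi.single_neg, h1, ← sub_eq_add_neg]
  simp only [h0, h1, h2, evolutionRHS, laplacian, mul_add, Finset.mul_sum]
  congr 1
  · exact Finset.sum_congr rfl fun i _ => by ring
  · ring

variable [MeasurableSpace Ω] {Y : Fin n → ℝ≥0 → Ω → Lattice d} (κ : ℝ≥0)

theorem abs_sol_le_of_le (hm : ∀ k t, Measurable (Y k t))
    (hrc : ∀ k ω t, ContinuousWithinAt (fun s => Y k s ω) (Set.Ici t) t)
    {t T : ℝ} (hT : 0 ≤ T) (ht : t ≤ T) (x : Lattice d) (ω : Ω) :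
    |sol κ Y x t ω| ≤ Real.exp (growth d n κ * T) := by
  refine (abs_sol_le κ hm hrc x t ω).trans ?_
  have := growth_nonneg (d := d) (n := n) κ
  have : max t 0 ≤ T := max_le ht hT
  gcongr

theorem abs_solProd_le (hm : ∀ k t, Measurable (Y k t))
    (hrc : ∀ k ω t, ContinuousWithinAt (fun s => Y k s ω) (Set.Ici t) t)
    {t T : ℝ} (hT : 0 ≤ T) (ht : t ≤ T) (x : Fin p → Lattice d) (ω : Ω) :
    |solProd κ Y x t ω| ≤ Real.exp (growth d n κ * T) ^ p := by
  rw [solProd, Finset.abs_prod]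
  calc _ ≤ ∏ _j : Fin p, Real.exp (growth d n κ * T) :=
        Finset.prod_le_prod (fun j _ => abs_nonneg _)
          fun j _ => abs_sol_le_of_le κ hm hrc hT ht (x j) ω
    _ = _ := by simp

theorem hasDerivWithinAt_solProd (hm : ∀ k t, Measurable (Y k t))
    (hrc : ∀ k ω t, ContinuousWithinAt (fun s => Y k s ω) (Set.Ici t) t)
    {t : ℝ} (ht : 0 ≤ t) (x : Fin p → Lattice d) (ω : Ω) :
    HasDerivWithinAt (fun s => solProd κ Y x s ω) (solProdDeriv κ Y x t ω) (Set.Ici t) t := by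
  have h := HasDerivWithinAt.fun_finsetProd (u := Finset.univ) (x := t) (s := Set.Ici t)
    (f := fun (j : Fin p) s => sol κ Y (x j) s ω)
    (f' := fun j => evolutionRHS κ (medium Y) (sol κ Y) (x j) t ω)
    (fun j _ => (isSolution_sol κ hm hrc ω).equation (x j) t ht)
  simpa [solProd, solProdDeriv] using h

theorem continuousOn_solProd (hm : ∀ k t, Measurable (Y k t))
    (hrc : ∀ k ω t, ContinuousWithinAt (fun s => Y k s ω) (Set.Ici t) t)
    (x : Fin p → Lattice d) (ω : Ω) :
    ContinuousOn (fun s => solProd κ Y x s ω) (Set.Ici 0) :=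
  continuousOn_finsetProd _ fun j _ => (isSolution_sol κ hm hrc ω).continuousOn (x j)

theorem abs_solProdDeriv_le (hm : ∀ k t, Measurable (Y k t))
    (hrc : ∀ k ω t, ContinuousWithinAt (fun s => Y k s ω) (Set.Ici t) t)
    {t T : ℝ} (hT : 0 ≤ T) (ht : t ≤ T) (x : Fin p → Lattice d)
    (ω : Ω) : |solProdDeriv κ Y x t ω| ≤
      p * (Real.exp (growth d n κ * T) ^ p * (growth d n κ * Real.exp (growth d n κ * T))) := by
  have hG := growth_nonneg (d := d) (n := n) κ
  have hE : 1 ≤ Real.exp (growth d n κ * T) := Real.one_le_exp (mul_nonneg hG hT)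
  unfold solProdDeriv
  refine (Finset.abs_sum_le_sum_abs _ _).trans ?_
  calc _ ≤ ∑ _j : Fin p, Real.exp (growth d n κ * T) ^ p *
        (growth d n κ * Real.exp (growth d n κ * T)) := Finset.sum_le_sum fun j _ => by
        rw [abs_mul]
        refine mul_le_mul ?_ ?_ (abs_nonneg _) (by positivity)
        · rw [Finset.abs_prod]
          calc _ ≤ ∏ _l ∈ Finset.univ.erase j, Real.exp (growth d n κ * T) :=
                Finset.prod_le_prod (fun j _ => abs_nonneg _)
                  fun l _ => abs_sol_le_of_le κ hm hrc hT ht (x l) ω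
            _ = Real.exp (growth d n κ * T) ^ (Finset.univ.erase j).card := by simp
            _ ≤ _ := pow_le_pow_right₀ hE (by
                calc _ ≤ (Finset.univ : Finset (Fin p)).card :=
                      Finset.card_le_card (Finset.erase_subset _ _)
                  _ = p := by simp)
        · exact abs_evolutionRHS_le κ (abs_catalysts_le _ _ _)
            fun z => abs_sol_le_of_le κ hm hrc hT ht z ω
    _ = _ := by simp

theorem abs_solProd_sub_le (hm : ∀ k t, Measurable (Y k t))
    (hrc : ∀ k ω t, ContinuousWithinAt (fun s => Y k s ω) (Set.Ici t) t)
    {s t T : ℝ} (ht : 0 ≤ t) (hts : t ≤ s) (hsT : s ≤ T)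
    (x : Fin p → Lattice d) (ω : Ω) : |solProd κ Y x s ω - solProd κ Y x t ω| ≤
      p * (Real.exp (growth d n κ * T) ^ p * (growth d n κ * Real.exp (growth d n κ * T))) *
        (s - t) := by
  refine norm_image_sub_le_of_norm_deriv_right_le_segment
    (f := fun s => solProd κ Y x s ω) (f' := fun s => solProdDeriv κ Y x s ω) (a := t) (b := s)
    ((continuousOn_solProd κ hm hrc x ω).mono fun r hr => ht.trans hr.1)
    (fun r hr => hasDerivWithinAt_solProd κ hm hrc (ht.trans hr.1) x ω)
    (fun r hr => abs_solProdDeriv_le κ hm hrc (ht.trans (hts.trans hsT)) (hr.2.le.trans hsT) x ω)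
    s ⟨hts, le_rfl⟩

theorem measurable_solProd (hm : ∀ k t, Measurable (Y k t))
    (hrc : ∀ k ω t, ContinuousWithinAt (fun s => Y k s ω) (Set.Ici t) t)
    (x : Fin p → Lattice d) (t : ℝ) : Measurable (solProd κ Y x t) :=
  Finset.measurable_prod _ fun j _ => measurable_sol κ hm hrc (x j) t

theorem measurable_solProd_past (hm : ∀ k t, Measurable (Y k t))
    (hrc : ∀ k ω t, ContinuousWithinAt (fun s => Y k s ω) (Set.Ici t) t)
    (x : Fin p → Lattice d) (s : ℝ≥0) :
    Measurable[MeasurableSpace.comap (past Y s) inferInstance] (solProd κ Y x s) :=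
  Finset.measurable_prod _ fun j _ => measurable_sol_past κ hm hrc (x j) s

end Product

/-! ### The moment function -/

section Moment

variable {Ω : Type*} [MeasurableSpace Ω]

/-- The positions of all processes at time `t`. -/
def position (Y : Fin n → ℝ≥0 → Ω → Lattice d) (t : ℝ) (ω : Ω) : Fin n → Lattice d :=
  fun k => Y k t.toNNReal ω

open Classical in
/-- `𝔼[∏_j u(x_j,t); Y(t) = y]`. -/
def moment (κ : ℝ≥0) (P : Measure Ω) (Y : Fin n → ℝ≥0 → Ω → Lattice d) (t : ℝ)
    (z : Config d n p) : ℝ :=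
  ∫ ω, solProd κ Y z.1 t ω * (if position Y t ω = z.2 then 1 else 0) ∂P

variable {P : Measure Ω} [IsProbabilityMeasure P] {Y : Fin n → ℝ≥0 → Ω → Lattice d} (κ : ℝ≥0)

theorem abs_ite_le_one (q : Prop) [Decidable q] : |if q then (1 : ℝ) else 0| ≤ 1 := by
  split_ifs <;> simp

theorem measurable_position (hm : ∀ k t, Measurable (Y k t)) (t : ℝ) :
    Measurable (position Y t) :=
  measurable_pi_lambda _ fun k => hm k _

open Classical in
theorem measurable_ite_position (hm : ∀ k t, Measurable (Y k t)) (t : ℝ) (y : Fin n → Lattice d) :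
    Measurable fun ω => if position Y t ω = y then (1 : ℝ) else 0 :=
  Measurable.ite (measurable_position hm t (measurableSet_singleton y)) measurable_const
    measurable_const

open Classical in
theorem abs_solProd_mul_le (hm : ∀ k t, Measurable (Y k t))
    (hrc : ∀ k ω t, ContinuousWithinAt (fun s => Y k s ω) (Set.Ici t) t)
    {t T : ℝ} (hT : 0 ≤ T) (ht : t ≤ T) (x : Fin p → Lattice d) (s : ℝ)
    (y : Fin n → Lattice d) (ω : Ω) :
    |solProd κ Y x t ω * (if position Y s ω = y then 1 else 0)| ≤
      Real.exp (growth d n κ * T) ^ p := by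
  rw [abs_mul]
  calc _ ≤ Real.exp (growth d n κ * T) ^ p * 1 :=
        mul_le_mul (abs_solProd_le κ hm hrc hT ht x ω) (abs_ite_le_one _) (abs_nonneg _)
          (by positivity)
    _ = _ := mul_one _

open Classical in
theorem integrable_solProd_mul (hm : ∀ k t, Measurable (Y k t))
    (hrc : ∀ k ω t, ContinuousWithinAt (fun s => Y k s ω) (Set.Ici t) t)
    (t : ℝ) (x : Fin p → Lattice d) (s : ℝ) (y : Fin n → Lattice d) :
    Integrable (fun ω => solProd κ Y x t ω * (if position Y s ω = y then 1 else 0)) P :=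
  integrable_of_abs_le ((measurable_solProd κ hm hrc x t).mul (measurable_ite_position hm s y))
    (abs_solProd_mul_le κ hm hrc (le_max_right t 0) (le_max_left t 0) x s y)

theorem abs_moment_le (hm : ∀ k t, Measurable (Y k t))
    (hrc : ∀ k ω t, ContinuousWithinAt (fun s => Y k s ω) (Set.Ici t) t)
    {t T : ℝ} (hT : 0 ≤ T) (ht : t ≤ T) (z : Config d n p) :
    |moment κ P Y t z| ≤ Real.exp (growth d n κ * T) ^ p :=
  abs_integral_le_of_abs_le fun ω => abs_solProd_mul_le κ hm hrc hT ht z.1 t z.2 ω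

open Classical in
theorem integral_solProdDeriv (hm : ∀ k t, Measurable (Y k t))
    (hrc : ∀ k ω t, ContinuousWithinAt (fun s => Y k s ω) (Set.Ici t) t)
    (t : ℝ) (z : Config d n p) :
    ∫ ω, solProdDeriv κ Y z.1 t ω * (if position Y t ω = z.2 then 1 else 0) ∂P =
      κ * laplacianX (moment κ P Y t) z + interaction z * moment κ P Y t z := by
  have hpt : ∀ ω, solProdDeriv κ Y z.1 t ω * (if position Y t ω = z.2 then 1 else 0) =
      κ * (∑ j, ∑ i, (((solProd κ Y (z + xVec j i).1 t ω *
          (if position Y t ω = (z + xVec j i).2 then 1 else 0)) -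
        (solProd κ Y z.1 t ω * (if position Y t ω = z.2 then 1 else 0))) +
        ((solProd κ Y (z - xVec j i).1 t ω *
          (if position Y t ω = (z - xVec j i).2 then 1 else 0)) -
        (solProd κ Y z.1 t ω * (if position Y t ω = z.2 then 1 else 0))))) +
      interaction z * (solProd κ Y z.1 t ω * (if position Y t ω = z.2 then 1 else 0)) := by
    intro ω
    rw [solProdDeriv_eq]
    by_cases h : position Y t ω = z.2
    -- On the event Y(t) = y the random potential becomes the deterministic I_p(x,y), which closes
    -- the equation.
    · have hI : ∑ j, medium Y (z.1 j) t ω = interaction z := by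
        unfold medium catalysts interaction
        refine Finset.sum_congr rfl fun j _ => Finset.sum_congr rfl fun k _ => ?_
        have hk : Y k t.toNNReal ω = z.2 k := congrFun h k
        simp only [hk]
        simp only [sub_eq_zero, eq_comm]
      simp [h, hI, xVec]
    · simp [h, xVec]
  have hi : ∀ z' : Config d n p, Integrable (fun ω => solProd κ Y z'.1 t ω *
      (if position Y t ω = z'.2 then 1 else 0)) P := fun z' =>
    integrable_solProd_mul κ hm hrc t z'.1 t z'.2
  have hii : ∀ j i, Integrable (fun ω => ((solProd κ Y (z + xVec j i).1 t ω *
          (if position Y t ω = (z + xVec j i).2 then 1 else 0)) -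
        (solProd κ Y z.1 t ω * (if position Y t ω = z.2 then 1 else 0))) +
        ((solProd κ Y (z - xVec j i).1 t ω *
          (if position Y t ω = (z - xVec j i).2 then 1 else 0)) -
        (solProd κ Y z.1 t ω * (if position Y t ω = z.2 then 1 else 0)))) P := fun j i =>
    ((hi _).sub (hi _)).add ((hi _).sub (hi _))
  simp only [hpt]
  rw [integral_add ((integrable_finsetSum _ fun j _ => integrable_finsetSum _ fun i _ =>
    hii j i).const_mul _) ((hi z).const_mul _), integral_const_mul, integral_const_mul,
    integral_finsetSum _ fun j _ => integrable_finsetSum _ fun i _ => hii j i]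
  congr 2
  refine Finset.sum_congr rfl fun j _ => ?_
  rw [integral_finsetSum _ fun i _ => hii j i]
  refine Finset.sum_congr rfl fun i _ => ?_
  have hsub : ∀ z₁ z₂ : Config d n p, Integrable (fun ω => (solProd κ Y z₁.1 t ω *
      (if position Y t ω = z₁.2 then 1 else 0)) -
      (solProd κ Y z₂.1 t ω * (if position Y t ω = z₂.2 then 1 else 0))) P := fun z₁ z₂ =>
    (hi z₁).sub (hi z₂)
  rw [integral_add (hsub _ _) (hsub _ _), integral_sub (hi _) (hi _), integral_sub (hi _) (hi _)]
  rfl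

end Moment

/-! ### The evolution equation of the moment function -/

section MomentEvolution

variable [NeZero d] {Ω : Type*} [MeasurableSpace Ω] {P : Measure Ω} [IsProbabilityMeasure P]
  {Y : Fin n → ℝ≥0 → Ω → Lattice d} (κ : ℝ≥0) {ρ : ℝ≥0}

open Classical in
/-- The Markov property: the increments after time `t` are independent of the past. -/
theorem integral_solProd_position (hY : ∀ k, IsSimpleRandomWalk P ρ (Y k))
    (hindep : iIndepFun (fun k ω t => Y k t ω) P) {s t : ℝ} (ht : 0 ≤ t) (hts : t ≤ s)
    (x : Fin p → Lattice d) (y : Fin n → Lattice d) :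
    ∫ ω, solProd κ Y x t ω * (if position Y s ω = y then 1 else 0) ∂P =
      ∫ ω, moment κ P Y t (x, y - (position Y s ω - position Y t ω)) ∂P := by
  have hm : ∀ k t, Measurable (Y k t) := fun k => (hY k).measurable
  have hrc : ∀ k ω t, ContinuousWithinAt (fun s => Y k s ω) (Set.Ici t) t :=
    fun k => (hY k).rightContinuous
  let X : Ω → ℝ × (Fin n → Lattice d) := fun ω => (solProd κ Y x t ω, position Y t ω)
  let D : Ω → Fin n → Lattice d := fun ω => position Y s ω - position Y t ω
  have hXm : Measurable X := (measurable_solProd κ hm hrc x t).prodMk (measurable_position hm t)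
  have hDm : Measurable D := (measurable_position hm s).sub (measurable_position hm t)
  have hXpast : Measurable[MeasurableSpace.comap (past Y t.toNNReal) inferInstance] X := by
    refine Measurable.prodMk ?_ ?_
    · have h := measurable_solProd_past κ hm hrc x t.toNNReal
      rwa [Real.coe_toNNReal t ht] at h
    · have h1 : position Y t = (fun (w : Fin n × Set.Iic t.toNNReal → Lattice d) (k : Fin n) =>
          w (k, ⟨t.toNNReal, Set.mem_Iic.2 le_rfl⟩)) ∘ past Y t.toNNReal := rfl
      rw [h1]
      exact (measurable_pi_lambda _ fun k => measurable_pi_apply _).comp (comap_measurable _)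
  have hXD : IndepFun X D P := by
    have h := indepFun_past_increment hY hindep (Real.toNNReal_mono hts)
    rw [IndepFun_iff_Indep] at h ⊢
    exact indep_of_indep_of_le_left h hXpast.comap_le
  let g : (ℝ × (Fin n → Lattice d)) × (Fin n → Lattice d) → ℝ := fun q =>
    q.1.1 * if q.1.2 + q.2 = y then 1 else 0
  have hg : Measurable g := by
    refine (measurable_fst.comp measurable_fst).mul
      (Measurable.ite ?_ measurable_const measurable_const)
    exact ((measurable_snd.comp measurable_fst).add measurable_snd) (measurableSet_singleton y)
  -- The pair (u and position at t, later increment) has a product law, so Fubini lets the increment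
  -- be integrated last.
  have hmap := (indepFun_iff_map_prod_eq_prod_map_map hXm.aemeasurable hDm.aemeasurable).1 hXD
  have hXDm : Measurable fun ω => (X ω, D ω) := hXm.prodMk hDm
  have hgi : Integrable (fun ω => g (X ω, D ω)) P := by
    refine integrable_of_abs_le (hg.comp hXDm) (C := Real.exp (growth d n κ * t) ^ p) fun ω => ?_
    simp only [g, X]
    rw [abs_mul]
    calc _ ≤ Real.exp (growth d n κ * t) ^ p * 1 :=
          mul_le_mul (abs_solProd_le κ hm hrc ht le_rfl x ω) (abs_ite_le_one _) (abs_nonneg _)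
            (by positivity)
      _ = _ := mul_one _
  have hgm : Integrable g ((P.map X).prod (P.map D)) := by
    rw [← hmap, integrable_map_measure hg.aestronglyMeasurable hXDm.aemeasurable]
    exact hgi
  have hprobX : IsProbabilityMeasure (P.map X) := Measure.isProbabilityMeasure_map hXm.aemeasurable
  have hprobD : IsProbabilityMeasure (P.map D) := Measure.isProbabilityMeasure_map hDm.aemeasurable
  calc _ = ∫ ω, g (X ω, D ω) ∂P := by
        refine integral_congr_ae (Eventually.of_forall fun ω => ?_)
        simp only [g, X, D, add_sub_cancel]
    _ = ∫ q, g q ∂(P.map X).prod (P.map D) := by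
        rw [← hmap, integral_map hXDm.aemeasurable hg.aestronglyMeasurable]
    _ = ∫ a, ∫ w, g (w, a) ∂P.map X ∂P.map D := integral_prod_symm _ hgm
    _ = ∫ a, moment κ P Y t (x, y - a) ∂P.map D := by
        refine integral_congr_ae (Eventually.of_forall fun a => ?_)
        simp only [moment]
        have hga : Measurable fun w => g (w, a) := hg.comp (measurable_id.prodMk measurable_const)
        rw [integral_map hXm.aemeasurable hga.aestronglyMeasurable]
        refine integral_congr_ae (Eventually.of_forall fun ω => ?_)
        simp only [g, X, eq_sub_iff_add_eq]
    _ = _ := by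
        rw [integral_map hDm.aemeasurable (measurable_of_countable _).aestronglyMeasurable]

/-- The error bound in the small-time expansion of the motion of the catalysts. -/
def smallTimeError (d n : ℕ) (ρ : ℝ≥0) (C h : ℝ) : ℝ :=
  n * (4 * C * (2 * d * ρ * h) ^ 2) + (2 + 2 * n) * C *
    (n * (n * (2 * d * ρ * h + 4 * (2 * d * ρ * h) ^ 2) ^ 2))

theorem tendsto_smallTimeError_div (d n : ℕ) (ρ : ℝ≥0) (C : ℝ) (t : ℝ) :
    Tendsto (fun s => (s - t)⁻¹ * smallTimeError d n ρ C (s - t)) (𝓝[>] t) (𝓝 0) := by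
  let q : ℝ → ℝ := fun s => n * (4 * C * (2 * d * ρ) ^ 2) * (s - t) + (2 + 2 * n) * C *
    (n * (n * (2 * d * ρ + 4 * (2 * d * ρ) ^ 2 * (s - t)) ^ 2)) * (s - t)
  have hq : Continuous q := by fun_prop
  have h0 : q t = 0 := by simp [q]
  have h1 : Tendsto q (𝓝[>] t) (𝓝 0) := by
    have := hq.tendsto t
    rw [h0] at this
    exact this.mono_left nhdsWithin_le_nhds
  refine h1.congr' ?_
  filter_upwards [self_mem_nhdsWithin] with s hs
  have hs' : s - t ≠ 0 := sub_ne_zero.2 (ne_of_gt hs)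
  simp only [q, smallTimeError]
  field_simp

open Classical in
-- With the solution frozen at time t, the Markov property turns the change of position into an
-- average of the moment function over increments. The first-order expansion of that average is
-- ρΔ_y, since a walk has rate 2dρ and its single step is uniform over the 2d neighbours.
theorem abs_integral_solProd_position_sub_le (hY : ∀ k, IsSimpleRandomWalk P ρ (Y k))
    (hindep : iIndepFun (fun k ω t => Y k t ω) P) {s t T : ℝ} (ht : 0 ≤ t) (hts : t ≤ s)
    (htT : t ≤ T) (z : Config d n p) :
    |∫ ω, solProd κ Y z.1 t ω * (if position Y s ω = z.2 then 1 else 0) ∂P - moment κ P Y t z -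
      (s - t) * (ρ * laplacianY (moment κ P Y t) z)| ≤
      smallTimeError d n ρ (Real.exp (growth d n κ * T) ^ p) (s - t) := by
  have hm : ∀ k t, Measurable (Y k t) := fun k => (hY k).measurable
  have hrc : ∀ k ω t, ContinuousWithinAt (fun s => Y k s ω) (Set.Ici t) t :=
    fun k => (hY k).rightContinuous
  have hr : ((2 * d * ρ * (s.toNNReal - t.toNNReal) : ℝ≥0) : ℝ) = 2 * d * ρ * (s - t) := by
    rw [NNReal.coe_mul, NNReal.coe_sub (Real.toNNReal_mono hts), Real.coe_toNNReal t ht,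
      Real.coe_toNNReal s (ht.trans hts)]
    push_cast
    ring
  have h := abs_integral_increments_sub_le (P := P)
    (D := fun k ω => Y k s.toNNReal ω - Y k t.toNNReal ω) (fun k => (hm k _).sub (hm k _))
    (fun k => (hY k).law t.toNNReal s.toNNReal (Real.toNNReal_mono hts))
    (fun k l hkl => (hindep.indepFun hkl).comp
      (φ := fun w : ℝ≥0 → Lattice d => w s.toNNReal - w t.toNNReal)
      (ψ := fun w : ℝ≥0 → Lattice d => w s.toNNReal - w t.toNNReal)
      ((measurable_pi_apply _).sub (measurable_pi_apply _))
      ((measurable_pi_apply _).sub (measurable_pi_apply _)))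
    (φ := fun a => moment κ P Y t (z.1, z.2 - a)) (C := Real.exp (growth d n κ * T) ^ p)
    (fun a => abs_moment_le κ hm hrc (ht.trans htT) htT _)
  rw [hr] at h
  rw [integral_solProd_position κ hY hindep ht hts, smallTimeError]
  convert h using 3
  · simp only [sub_zero]
    rfl
  · rw [laplacianY, Finset.mul_sum, Finset.mul_sum]
    refine Finset.sum_congr rfl fun k _ => ?_
    have hw := integral_walkPMF_one (d := d) fun a => moment κ P Y t (z.1, z.2 - Pi.single k a)
    have hd : ∑ i : Fin d, ((moment κ P Y t (z + yVec k i) - moment κ P Y t z) +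
        (moment κ P Y t (z - yVec k i) - moment κ P Y t z)) =
        ∑ i : Fin d, (moment κ P Y t (z.1, z.2 - Pi.single k (basisVec i)) +
          moment κ P Y t (z.1, z.2 - Pi.single k (-basisVec i))) -
          2 * d * moment κ P Y t z := by
      have h2 : (2 : ℝ) * d * moment κ P Y t z = ∑ _i : Fin d, 2 * moment κ P Y t z := by
        simp; ring
      rw [h2, ← Finset.sum_sub_distrib]
      refine Finset.sum_congr rfl fun i _ => ?_
      have e1 : z + yVec k i = (z.1, z.2 - Pi.single k (-basisVec i)) := by
        ext1
        · simp [yVec]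
        · simp [yVec, Pi.single_neg]
      have e2 : z - yVec k i = (z.1, z.2 - Pi.single k (basisVec i)) := by
        ext1 <;> simp [yVec]
      rw [e1, e2]
      ring
    rw [hd, ← hw, sub_zero]
    ring

theorem continuousOn_moment (hY : ∀ k, IsSimpleRandomWalk P ρ (Y k))
    (hindep : iIndepFun (fun k ω t => Y k t ω) P) (T : ℝ) (z : Config d n p) :
    ContinuousOn (fun t => moment κ P Y t z) (Set.Icc 0 T) := by
  classical
  have hm : ∀ k t, Measurable (Y k t) := fun k => (hY k).measurable
  have hrc : ∀ k ω t, ContinuousWithinAt (fun s => Y k s ω) (Set.Ici t) t :=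
    fun k => (hY k).rightContinuous
  rcases lt_or_ge T 0 with hT | hT
  · rw [Set.Icc_eq_empty (not_le.2 hT)]; exact continuousOn_empty _
  set C := Real.exp (growth d n κ * T) ^ p with hC
  set K := p * (C * (growth d n κ * Real.exp (growth d n κ * T))) with hK
  -- A modulus of continuity uniform on [0,T]: the Lipschitz change of u, plus the drift and the
  -- error of the catalysts' motion. Uniformity gives continuity from the left as well.
  let q : ℝ → ℝ := fun h => K * h + (h * (ρ * (n * (d * (4 * C)))) + smallTimeError d n ρ C h)
  have hq : Continuous q := by unfold q smallTimeError; fun_prop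
  have hq0 : q 0 = 0 := by simp [q, smallTimeError]
  have key : ∀ t s, 0 ≤ t → t ≤ s → s ≤ T → |moment κ P Y s z - moment κ P Y t z| ≤ q (s - t) := by
    intro t s ht hts hsT
    have hB := abs_integral_solProd_position_sub_le κ hY hindep ht hts (hts.trans hsT) z
    have hA : |moment κ P Y s z -
        ∫ ω, solProd κ Y z.1 t ω * (if position Y s ω = z.2 then 1 else 0) ∂P| ≤ K * (s - t) := by
      unfold moment
      rw [← integral_sub (integrable_solProd_mul κ hm hrc s z.1 s z.2)
        (integrable_solProd_mul κ hm hrc t z.1 s z.2)]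
      refine abs_integral_le_of_abs_le fun ω => ?_
      rw [← sub_mul, abs_mul]
      calc _ ≤ K * (s - t) * 1 := mul_le_mul (abs_solProd_sub_le κ hm hrc ht hts hsT z.1 ω)
            (abs_ite_le_one _) (abs_nonneg _) ((abs_nonneg _).trans
              (abs_solProd_sub_le κ hm hrc ht hts hsT z.1 ω))
        _ = _ := mul_one _
    have hL : |(s - t) * (ρ * laplacianY (moment κ P Y t) z)| ≤
        (s - t) * (ρ * (n * (d * (4 * C)))) := by
      rw [abs_mul, abs_mul, abs_of_nonneg (sub_nonneg.2 hts), NNReal.abs_eq]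
      refine mul_le_mul_of_nonneg_left (mul_le_mul_of_nonneg_left ?_ ρ.2) (sub_nonneg.2 hts)
      unfold laplacianY
      have hb : ∀ z' : Config d n p, |moment κ P Y t z'| ≤ C := fun z' =>
        abs_moment_le κ hm hrc hT (hts.trans hsT) z'
      calc _ ≤ ∑ _k : Fin n, ∑ _i : Fin d, 4 * C := by
            refine (Finset.abs_sum_le_sum_abs _ _).trans (Finset.sum_le_sum fun k _ =>
              (Finset.abs_sum_le_sum_abs _ _).trans (Finset.sum_le_sum fun i _ => ?_))
            have h1 := abs_le.1 (hb (z + yVec k i))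
            have h2 := abs_le.1 (hb (z - yVec k i))
            have h3 := abs_le.1 (hb z)
            rw [abs_le]
            constructor <;> linarith
        _ = _ := by simp
    simp only [q]
    rw [abs_le] at *
    constructor <;> linarith [hA.1, hA.2, hB.1, hB.2, hL.1, hL.2]
  intro t ht
  rw [ContinuousWithinAt, tendsto_iff_norm_sub_tendsto_zero]
  have hlim : Tendsto (fun s => q |s - t|) (𝓝[Set.Icc 0 T] t) (𝓝 0) := by
    have hc : Continuous fun s : ℝ => q |s - t| := hq.comp (by fun_prop)
    have := hc.tendsto t
    simp only [sub_self, abs_zero, hq0] at this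
    exact this.mono_left nhdsWithin_le_nhds
  refine squeeze_zero' (Eventually.of_forall fun s => norm_nonneg _) ?_ hlim
  filter_upwards [self_mem_nhdsWithin] with s hs
  rw [Real.norm_eq_abs]
  rcases le_total t s with h | h
  · rw [abs_of_nonneg (sub_nonneg.2 h)]; exact key t s ht.1 h hs.2
  · rw [abs_sub_comm, abs_sub_comm s t, abs_of_nonneg (sub_nonneg.2 h)]
    exact key s t hs.1 h ht.2

/-- With `J s` the expectation that mixes u at time t with the position at time s, the difference
quotient splits in two. Between `moment` at s and `J s` only u moves, which gives κΔ_x + I_p;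
between `J s` and `moment` at t only the catalysts move, which gives ρΔ_y. -/
theorem hasDerivWithinAt_moment (hY : ∀ k, IsSimpleRandomWalk P ρ (Y k))
    (hindep : iIndepFun (fun k ω t => Y k t ω) P) {t : ℝ} (ht : 0 ≤ t) (z : Config d n p) :
    HasDerivWithinAt (fun s => moment κ P Y s z)
      (κ * laplacianX (moment κ P Y t) z + ρ * laplacianY (moment κ P Y t) z +
        interaction z * moment κ P Y t z) (Set.Ici t) t := by
  classical
  have hm : ∀ k t, Measurable (Y k t) := fun k => (hY k).measurable
  have hrc : ∀ k ω t, ContinuousWithinAt (fun s => Y k s ω) (Set.Ici t) t :=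
    fun k => (hY k).rightContinuous
  rw [← hasDerivWithinAt_Ioi_iff_Ici, hasDerivWithinAt_iff_tendsto_slope' Set.self_notMem_Ioi]
  let J : ℝ → ℝ := fun s =>
    ∫ ω, solProd κ Y z.1 t ω * (if position Y s ω = z.2 then 1 else 0) ∂P
  let T := t + 1
  have hT : 0 ≤ T := by simp only [T]; linarith
  set K := p * (Real.exp (growth d n κ * T) ^ p *
    (growth d n κ * Real.exp (growth d n κ * T))) with hK
  have hIoo : ∀ᶠ s in 𝓝[>] t, s ∈ Set.Ioo t T := Ioo_mem_nhdsGT (by simp [T])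
  -- Dominated convergence: the quotients of u are uniformly bounded, and each position is constant
  -- just after t by right-continuity on a discrete space.
  have hA : Tendsto (fun s => ∫ ω, ((s - t)⁻¹ * (solProd κ Y z.1 s ω - solProd κ Y z.1 t ω)) *
      (if position Y s ω = z.2 then 1 else 0) ∂P) (𝓝[>] t)
      (𝓝 (∫ ω, solProdDeriv κ Y z.1 t ω * (if position Y t ω = z.2 then 1 else 0) ∂P)) := by
    refine tendsto_integral_filter_of_dominated_convergence (fun _ => K) ?_ ?_
      (integrable_const _) (Eventually.of_forall fun ω => ?_)
    · refine Eventually.of_forall fun s => Measurable.aestronglyMeasurable ?_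
      exact (((measurable_solProd κ hm hrc z.1 s).sub
        (measurable_solProd κ hm hrc z.1 t)).const_mul _).mul (measurable_ite_position hm s z.2)
    · filter_upwards [hIoo] with s hs
      refine Eventually.of_forall fun ω => ?_
      have hst : 0 < s - t := sub_pos.2 hs.1
      have h1 := abs_solProd_sub_le κ hm hrc ht hs.1.le hs.2.le z.1 ω
      rw [norm_mul, norm_mul, Real.norm_eq_abs, Real.norm_eq_abs, Real.norm_eq_abs,
        abs_of_pos (inv_pos.2 hst)]
      calc _ ≤ (s - t)⁻¹ * (K * (s - t)) * 1 := by
            refine mul_le_mul (mul_le_mul_of_nonneg_left h1 (inv_pos.2 hst).le)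
              (abs_ite_le_one _) (abs_nonneg _) ?_
            exact mul_nonneg (inv_pos.2 hst).le ((abs_nonneg _).trans h1)
        _ = K := by field_simp
    · refine Tendsto.mul ?_ ?_
      · have h := hasDerivWithinAt_solProd κ hm hrc ht z.1 ω
        rw [← hasDerivWithinAt_Ioi_iff_Ici,
          hasDerivWithinAt_iff_tendsto_slope' Set.self_notMem_Ioi] at h
        exact h.congr fun s => by rw [slope_def_field]; ring
      · have h : ∀ᶠ s in 𝓝[>] t, position Y s ω = position Y t ω := by
          have h1 : ∀ᶠ s in 𝓝[≥] t, ∀ k, Y k s.toNNReal ω = Y k t.toNNReal ω :=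
            eventually_all.2 fun k => (tendsto_toNNReal_nhdsGE t).eventually
              (eventually_eq_of_rightContinuous (hrc k ω _))
          exact (h1.filter_mono (nhdsWithin_mono t Set.Ioi_subset_Ici_self)).mono
            fun s hs => funext hs
        refine tendsto_const_nhds.congr' ?_
        filter_upwards [h] with s hs
        rw [hs]
  have hB : Tendsto (fun s => (s - t)⁻¹ * (J s - moment κ P Y t z)) (𝓝[>] t)
      (𝓝 (ρ * laplacianY (moment κ P Y t) z)) := by
    rw [tendsto_iff_norm_sub_tendsto_zero]
    refine squeeze_zero' (Eventually.of_forall fun s => norm_nonneg _) ?_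
      (tendsto_smallTimeError_div d n ρ (Real.exp (growth d n κ * T) ^ p) t)
    filter_upwards [hIoo] with s hs
    have hst : 0 < s - t := sub_pos.2 hs.1
    have h1 := abs_integral_solProd_position_sub_le κ hY hindep ht hs.1.le (hs.1.trans hs.2).le z
    have h2 : (s - t)⁻¹ * (J s - moment κ P Y t z) - ρ * laplacianY (moment κ P Y t) z =
        (s - t)⁻¹ * (J s - moment κ P Y t z - (s - t) * (ρ * laplacianY (moment κ P Y t) z)) := by
      field_simp
    rw [h2, norm_mul, Real.norm_of_nonneg (inv_pos.2 hst).le]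
    exact mul_le_mul_of_nonneg_left h1 (inv_pos.2 hst).le
  have hsum := hA.add hB
  rw [integral_solProdDeriv κ hm hrc] at hsum
  have hval : κ * laplacianX (moment κ P Y t) z + interaction z * moment κ P Y t z +
      ρ * laplacianY (moment κ P Y t) z = κ * laplacianX (moment κ P Y t) z +
      ρ * laplacianY (moment κ P Y t) z + interaction z * moment κ P Y t z := by ring
  rw [hval] at hsum
  refine hsum.congr fun s => ?_
  have h1 : ∫ ω, ((s - t)⁻¹ * (solProd κ Y z.1 s ω - solProd κ Y z.1 t ω)) *
      (if position Y s ω = z.2 then 1 else 0) ∂P = (s - t)⁻¹ * (moment κ P Y s z - J s) := by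
    simp only [moment, J]
    rw [← integral_sub (integrable_solProd_mul κ hm hrc s z.1 s z.2)
      (integrable_solProd_mul κ hm hrc t z.1 s z.2), ← integral_const_mul]
    exact integral_congr_ae (Eventually.of_forall fun ω => by simp only; ring)
  rw [h1, slope_def_field]
  ring

open Classical in
theorem moment_zero (hY : ∀ k, IsSimpleRandomWalk P ρ (Y k)) (z : Config d n p) :
    moment κ P Y 0 z = if z.2 = 0 then 1 else 0 := by
  have hm : ∀ k t, Measurable (Y k t) := fun k => (hY k).measurable
  have hrc : ∀ k ω t, ContinuousWithinAt (fun s => Y k s ω) (Set.Ici t) t :=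
    fun k => (hY k).rightContinuous
  have hstart : ∀ᵐ ω ∂P, position Y 0 ω = 0 := by
    have : ∀ᵐ ω ∂P, ∀ k, Y k 0 ω = 0 := ae_all_iff.2 fun k => (hY k).start
    filter_upwards [this] with ω hω
    funext k
    simpa [position] using hω k
  have h : ∀ᵐ ω ∂P, solProd κ Y z.1 0 ω * (if position Y 0 ω = z.2 then 1 else 0) =
      if z.2 = 0 then 1 else 0 := by
    filter_upwards [hstart] with ω hω
    have h1 : solProd κ Y z.1 0 ω = 1 :=
      Finset.prod_eq_one fun j _ => (isSolution_sol κ hm hrc ω).initial _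
    rw [h1, hω, one_mul]
    simp only [eq_comm]
  rw [moment, integral_congr_ae h]
  simp

end MomentEvolution

/-! ### The tilted semigroup representation of bounded solutions -/

theorem summable_prod_pi_fin {α : Type*} {g : α → ℝ} (hg : ∀ a, 0 ≤ g a) (hs : Summable g)
    (m : ℕ) : Summable fun x : Fin m → α => ∏ i, g (x i) := by
  induction m with
  | zero => exact .of_finite
  | succ m ih =>
    rw [← (Fin.consEquiv fun _ : Fin (m + 1) => α).summable_iff]
    refine (hs.mul_of_nonneg ih hg fun x => Finset.prod_nonneg fun i _ => hg _).congr fun q => ?_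
    simp [Fin.consEquiv, Fin.prod_univ_succ]

theorem summable_exp_neg_mul_abs_int {c : ℝ} (hc : 0 < c) :
    Summable fun a : ℤ => Real.exp (-c * |(a : ℝ)|) := by
  have h : Summable fun m : ℕ => Real.exp (-c * (m : ℝ)) := by
    have := Real.summable_exp_nat_mul_iff.2 (neg_lt_zero.2 hc)
    exact this.congr fun m => by rw [mul_comm]
  refine Summable.of_nat_of_neg ?_ ?_
  · exact h.congr fun m => by simp
  · exact h.congr fun m => by simp

theorem summable_exp_neg_mul_sum_abs {c : ℝ} (hc : 0 < c) (d m : ℕ) :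
    Summable fun x : Fin m → Lattice d => Real.exp (-c * ∑ j, ∑ i, |(x j i : ℝ)|) := by
  have h := summable_prod_pi_fin (fun v => Finset.prod_nonneg fun i _ => (Real.exp_pos _).le)
    (summable_prod_pi_fin (fun a => (Real.exp_pos _).le) (summable_exp_neg_mul_abs_int hc) d) m
  refine h.congr fun x => ?_
  simp_rw [← Real.exp_sum, Finset.mul_sum]

theorem tilt_mk_zero (x : Fin p → Lattice d) :
    tilt ((x, 0) : Config d n p) = -∑ j, ∑ i, |(x j i : ℝ)| := by
  simp [tilt]

theorem tilt_zero_mk (y : Fin n → Lattice d) :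
    tilt ((0, y) : Config d n p) = ∑ k, ∑ i, |(y k i : ℝ)| := by
  simp [tilt]

/-- The function `exp(-θ |x|₁) 1{y = 0}`, the tilted initial condition. -/
def tiltedInit (d n p : ℕ) {θ : ℝ} (hθ : 0 < θ) : L2 d n p :=
  ⟨fun z => Real.exp (θ * tilt z) * if z.2 = 0 then 1 else 0, by
    refine memℓp_gen ?_
    have hinj : Function.Injective fun x : Fin p → Lattice d => ((x, 0) : Config d n p) :=
      fun x y h => congrArg Prod.fst h
    rw [← hinj.summable_iff]
    · refine (summable_exp_neg_mul_sum_abs (c := 2 * θ) (by positivity) d p).congr fun x => ?_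
      simp only [Function.comp, if_true, mul_one, tilt_mk_zero, ENNReal.toReal_ofNat,
        Real.rpow_ofNat, Real.norm_eq_abs, sq_abs]
      rw [← Real.exp_nat_mul]
      congr 1
      push_cast
      ring
    · rintro ⟨x, y⟩ hz
      have hy : y ≠ 0 := fun h => hz ⟨x, by rw [h]⟩
      simp [hy]⟩

theorem tiltedInit_apply {θ : ℝ} (hθ : 0 < θ) (z : Config d n p) :
    tiltedInit d n p hθ z = Real.exp (θ * tilt z) * if z.2 = 0 then 1 else 0 := rfl

theorem hasDerivAt_exp_smul_apply (B : L2 d n p →L[ℝ] L2 d n p) (g : L2 d n p)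
    (z : Config d n p) (t : ℝ) :
    HasDerivAt (fun s : ℝ => NormedSpace.exp (s • B) g z) (B (NormedSpace.exp (t • B) g) z) t :=
  (evalCLM z).hasFDerivAt.comp_hasDerivAt t
    ((ContinuousLinearMap.apply ℝ (L2 d n p) g).hasFDerivAt.comp_hasDerivAt t
      (hasDerivAt_exp_smul_const' (𝕂 := ℝ) B t))

theorem exists_norm_exp_smul_apply_le (B : L2 d n p →L[ℝ] L2 d n p) (g : L2 d n p) (T : ℝ) :
    ∃ C, ∀ t ∈ Set.Icc 0 T, ‖NormedSpace.exp (t • B) g‖ ≤ C := by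
  have hc : Continuous fun s : ℝ => NormedSpace.exp (s • B) g :=
    continuous_iff_continuousAt.2 fun t =>
      ((ContinuousLinearMap.apply ℝ (L2 d n p) g).hasFDerivAt.comp_hasDerivAt t
        (hasDerivAt_exp_smul_const' (𝕂 := ℝ) B t)).continuousAt
  exact isCompact_Icc.exists_bound_of_continuousOn hc.continuousOn

/-- A solution of `∂m/∂t = κ Δ_x m + ρ Δ_y m + I_p m` whose growth in space is at most that of
`exp(θ ||y|₁ - |x|₁|)` is given by the semigroup of the tilted operator. -/
theorem eq_exp_tiltedOp_apply (κ ρ : ℝ≥0) (θ : ℝ) (F : L2 d n p) (m : ℝ → Config d n p → ℝ)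
    (h0 : ∀ z, m 0 z = Real.exp (-(θ * tilt z)) * F z)
    (hc : ∀ T z, ContinuousOn (fun t => m t z) (Set.Icc 0 T))
    (hd : ∀ t z, 0 ≤ t → HasDerivWithinAt (fun s => m s z)
      (κ * laplacianX (m t) z + ρ * laplacianY (m t) z + interaction z * m t z) (Set.Ici t) t)
    (hb : ∀ T, 0 ≤ T → ∃ C, ∀ z, ∀ t ∈ Set.Icc 0 T, |m t z| ≤ C) {t : ℝ} (ht : 0 ≤ t)
    (z : Config d n p) :
    m t z = Real.exp (-(θ * tilt z)) * NormedSpace.exp (t • tiltedOp d n p κ ρ θ) F z := by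
  set B := tiltedOp d n p κ ρ θ with hB
  let A : ℝ → (Config d n p → ℝ) → Config d n p → ℝ := fun _ f z =>
    ∑ a, rate κ ρ a * (f (z + shift a) - f z) + interaction z * f z
  -- This weight dominates both bounded functions and the unweighted semigroup, and it varies by a
  -- factor of at most exp|θ| between neighbours, so the generator is bounded in the W-weighted sup
  -- norm.
  let W : Config d n p → ℝ := fun z => Real.exp (|θ| * |tilt z|)
  let G : Config d n p → ℝ → ℝ := fun z s => Real.exp (-(θ * tilt z)) * NormedSpace.exp (s • B) F z
  have hW1 : ∀ z, 1 ≤ W z := fun z => Real.one_le_exp (by positivity)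
  have hWs : ∀ (z : Config d n p) (a : Dir d n p), W (z + shift a) ≤ Real.exp |θ| * W z := by
    intro z a
    rw [← Real.exp_add]
    refine Real.exp_le_exp.2 ?_
    have h := abs_tilt_add_shift_sub_le a z
    have h' : |tilt (z + shift a)| ≤ 1 + |tilt z| := by
      have := abs_sub_abs_le_abs_sub (tilt (z + shift a)) (tilt z)
      linarith
    nlinarith [abs_nonneg θ]
  have hA : ∀ (t : ℝ) f c, 0 ≤ c → (∀ z, |f z| ≤ c * W z) → ∀ z,
      |A t f z| ≤ (totalRate d n p κ ρ * (Real.exp |θ| + 1) + p * n) * (c * W z) := by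
    intro t f c hc0 hf z
    refine (abs_add_le _ _).trans ?_
    rw [add_mul]
    refine add_le_add ?_ ?_
    · rw [totalRate, Finset.sum_mul, Finset.sum_mul]
      refine (Finset.abs_sum_le_sum_abs _ _).trans (Finset.sum_le_sum fun a _ => ?_)
      rw [abs_mul, abs_of_nonneg (rate_nonneg κ ρ a), mul_assoc]
      refine mul_le_mul_of_nonneg_left ?_ (rate_nonneg κ ρ a)
      have h1 : c * W (z + shift a) ≤ c * (Real.exp |θ| * W z) :=
        mul_le_mul_of_nonneg_left (hWs z a) hc0
      calc _ ≤ |f (z + shift a)| + |f z| := abs_sub _ _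
        _ ≤ c * W (z + shift a) + c * W z := add_le_add (hf _) (hf _)
        _ ≤ _ := by linarith
    · rw [abs_mul]
      exact mul_le_mul (abs_interaction_le z) (hf z) (abs_nonneg _) (by positivity)
  have hG : ∀ z s, HasDerivAt (G z) (A s (fun z' => G z' s) z) s := by
    intro z s
    have h := (hasDerivAt_exp_smul_apply B F z s).const_mul (Real.exp (-(θ * tilt z)))
    refine HasDerivAt.congr_deriv (f := G z) h ?_
    rw [hB, tiltedOp_apply, mul_add, Finset.mul_sum]
    refine congrArg₂ (· + ·) (Finset.sum_congr rfl fun a _ => ?_) (by simp only [G]; ring)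
    have h2 : Real.exp (-(θ * tilt (z + shift a))) =
        Real.exp (-(θ * tilt z)) * tiltRatio θ a z := by
      rw [tiltRatio, ← Real.exp_add]
      congr 1
      ring
    simp only [G, h2]
    ring
  obtain ⟨C₁, hC₁⟩ := hb t ht
  obtain ⟨C₂, hC₂⟩ := exists_norm_exp_smul_apply_le B F t
  have hC₁0 : 0 ≤ C₁ := (abs_nonneg _).trans (hC₁ 0 0 ⟨le_rfl, ht⟩)
  have key := eq_zero_of_linear_evolution A W (fun z => (Real.exp_pos _).le) hA
    (add_nonneg (mul_nonneg (totalRate_nonneg κ ρ) (by positivity)) (by positivity))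
    (fun z s => m s z - G z s) (fun z => by simp [G, h0 z])
    (fun z => (hc t z).sub fun s _ => (hG z s).continuousAt.continuousWithinAt)
    (fun z s hs => by
      have h1 := hd s z hs.1
      rw [laplacian_add_interaction_eq] at h1
      refine (h1.sub (hG z s).hasDerivWithinAt).congr_deriv ?_
      simp only [A]
      rw [add_sub_add_comm, ← Finset.sum_sub_distrib]
      exact congrArg₂ (· + ·) (Finset.sum_congr rfl fun a _ => by ring) (by ring))
    (C := C₁ + C₂) (fun z s hs => by
      have h1 : |G z s| ≤ W z * C₂ := by
        simp only [G]
        rw [abs_mul, Real.abs_exp]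
        refine mul_le_mul (Real.exp_le_exp.2 ?_)
          ((lp.norm_apply_le_norm (by norm_num) _ z).trans (hC₂ s hs)) (abs_nonneg _)
          (Real.exp_pos _).le
        rw [← abs_mul]
        exact neg_le_abs _
      have h2 : |m s z| ≤ C₁ * W z := (hC₁ z s hs).trans (le_mul_of_one_le_right hC₁0 (hW1 z))
      calc _ ≤ |m s z| + |G z s| := abs_sub _ _
        _ ≤ _ := by linarith)
  exact sub_eq_zero.1 (key z t ⟨ht, le_rfl⟩)

section MomentRepresentation

variable [NeZero d] {Ω : Type*} [MeasurableSpace Ω] {P : Measure Ω} [IsProbabilityMeasure P]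
  {Y : Fin n → ℝ≥0 → Ω → Lattice d} (κ : ℝ≥0) {ρ : ℝ≥0}

/-- The Feynman–Kac representation of the moment function. -/
theorem moment_eq (hY : ∀ k, IsSimpleRandomWalk P ρ (Y k))
    (hindep : iIndepFun (fun k ω t => Y k t ω) P) {θ : ℝ} (hθ : 0 < θ) {t : ℝ} (ht : 0 ≤ t)
    (z : Config d n p) :
    moment κ P Y t z = Real.exp (-(θ * tilt z)) *
      NormedSpace.exp (t • tiltedOp d n p κ ρ θ) (tiltedInit d n p hθ) z := by
  refine eq_exp_tiltedOp_apply κ ρ θ (tiltedInit d n p hθ) (moment κ P Y) (fun z => ?_)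
    (continuousOn_moment κ hY hindep) (fun t z ht => hasDerivWithinAt_moment κ hY hindep ht z)
    (fun T hT => ⟨_, fun z t ht => abs_moment_le κ (fun k => (hY k).measurable)
      (fun k => (hY k).rightContinuous) hT ht.2 z⟩) ht z
  rw [moment_zero κ hY, tiltedInit_apply, ← mul_assoc, ← Real.exp_add]
  simp

theorem moment_nonneg (hY : ∀ k, IsSimpleRandomWalk P ρ (Y k))
    (hindep : iIndepFun (fun k ω t => Y k t ω) P) {t : ℝ} (ht : 0 ≤ t) (z : Config d n p) :
    0 ≤ moment κ P Y t z := by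
  rw [moment_eq κ hY hindep one_pos ht]
  refine mul_nonneg (Real.exp_pos _).le (exp_tiltedOp_apply_nonneg κ ρ 1 (fun z => ?_) ht z)
  rw [tiltedInit_apply]
  split_ifs <;> simp [Real.exp_nonneg]

/-- Comparison with the semigroup generated by `L_p`. -/
theorem exp_andersonOp_apply_le_moment (hY : ∀ k, IsSimpleRandomWalk P ρ (Y k))
    (hindep : iIndepFun (fun k ω t => Y k t ω) P) {h : L2 d n p} (h0 : ∀ z, 0 ≤ h z)
    (h1 : ∀ z, h z ≤ if z.2 = 0 then 1 else 0) {t : ℝ} (ht : 0 ≤ t) (z : Config d n p) :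
    NormedSpace.exp (t • andersonOp d n p κ ρ) h z ≤ moment κ P Y t z := by
  have hF : ∀ z, ‖Real.exp (1 * tilt z) * h z‖ ≤ ‖tiltedInit d n p one_pos z‖ := by
    intro z
    rw [tiltedInit_apply, norm_mul, norm_mul, Real.norm_of_nonneg (h0 z),
      Real.norm_of_nonneg ((h0 z).trans (h1 z))]
    exact mul_le_mul_of_nonneg_left (h1 z) (norm_nonneg _)
  -- Both evolutions are written with the same conjugated semigroup, where the comparison reduces to
  -- ordered initial conditions and positivity; any θ > 0 would do.
  let F : L2 d n p := ⟨fun z => Real.exp (1 * tilt z) * h z,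
    (lp.memℓp (tiltedInit d n p one_pos)).mono' hF⟩
  have hFz : ∀ z, F z = Real.exp (1 * tilt z) * h z := fun z => rfl
  have hrep := eq_exp_tiltedOp_apply κ ρ 1 F
    (fun t z => NormedSpace.exp (t • andersonOp d n p κ ρ) h z)
    (fun z => by
      rw [hFz, ← mul_assoc, ← Real.exp_add]
      simp)
    (fun T z t _ => (hasDerivAt_exp_smul_apply _ h z t).continuousAt.continuousWithinAt)
    (fun t z _ => by
      have := (hasDerivAt_exp_smul_apply (andersonOp d n p κ ρ) h z t).hasDerivWithinAt
        (s := Set.Ici t)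
      rwa [andersonOp_apply] at this)
    (fun T _ => by
      obtain ⟨C, hC⟩ := exists_norm_exp_smul_apply_le (andersonOp d n p κ ρ) h T
      exact ⟨C, fun z t ht => (lp.norm_apply_le_norm (by norm_num) _ z).trans (hC t ht)⟩) ht z
  rw [hrep, moment_eq κ hY hindep one_pos ht]
  refine mul_le_mul_of_nonneg_left ?_ (Real.exp_pos _).le
  have hpos := exp_tiltedOp_apply_nonneg κ ρ 1 (g := tiltedInit d n p one_pos - F) (fun z => by
    rw [lp.coeFn_sub, Pi.sub_apply, hFz, tiltedInit_apply, ← mul_sub]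
    exact mul_nonneg (Real.exp_pos _).le (sub_nonneg.2 (h1 z))) ht z
  rw [map_sub, lp.coeFn_sub, Pi.sub_apply] at hpos
  exact sub_nonneg.1 hpos

/-- The moment of the solution at the origin, decomposed over the final positions. -/
theorem hasSum_moment (hY : ∀ k, IsSimpleRandomWalk P ρ (Y k)) (t : ℝ) :
    HasSum (fun y => moment κ P Y t ((0, y) : Config d n p)) (∫ ω, sol κ Y 0 t ω ^ p ∂P) := by
  classical
  have hm : ∀ k t, Measurable (Y k t) := fun k => (hY k).measurable
  have hrc : ∀ k ω t, ContinuousWithinAt (fun s => Y k s ω) (Set.Ici t) t :=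
    fun k => (hY k).rightContinuous
  have hsol : ∀ ω, solProd κ Y (0 : Fin p → Lattice d) t ω = sol κ Y 0 t ω ^ p := fun ω => by
    simp [solProd]
  have hinteg : Integrable (fun ω => solProd κ Y (0 : Fin p → Lattice d) t ω) P :=
    integrable_of_abs_le (measurable_solProd κ hm hrc 0 t)
      (abs_solProd_le κ hm hrc (le_max_right t 0) (le_max_left t 0) 0)
  have hU : ⋃ y, position Y t ⁻¹' {y} = Set.univ := by
    ext ω; simp
  have h := hasSum_integral_iUnion (μ := P) (f := fun ω => solProd κ Y (0 : Fin p → Lattice d) t ω)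
    (s := fun y => position Y t ⁻¹' {y})
    (fun y => measurable_position hm t (measurableSet_singleton y))
    (fun y y' hy => Disjoint.preimage _ (Set.disjoint_singleton.2 hy)) hinteg.integrableOn
  rw [hU, Measure.restrict_univ] at h
  simp_rw [hsol] at h
  have hmom : (fun y => moment κ P Y t ((0, y) : Config d n p)) =
      fun y => ∫ ω in position Y t ⁻¹' {y}, sol κ Y 0 t ω ^ p ∂P := by
    funext y
    rw [← integral_indicator (measurable_position hm t (measurableSet_singleton y))]
    refine integral_congr_ae (Eventually.of_forall fun ω => ?_)
    simp only [Set.indicator, Set.mem_preimage, Set.mem_singleton_iff, hsol]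
    split_ifs <;> simp
  rw [hmom]
  exact h

end MomentRepresentation

/-! ### Growth of the moments -/

theorem inner_nonneg_of_nonneg {f g : L2 d n p} (hf : ∀ z, 0 ≤ f z) (hg : ∀ z, 0 ≤ g z) :
    0 ≤ inner ℝ f g := by
  rw [inner_eq_tsum]
  exact tsum_nonneg fun z => mul_nonneg (hf z) (hg z)

open Classical in
/-- The indicator function of a finite set of configurations. -/
def finIndicator (A : Finset (Config d n p)) : L2 d n p :=
  ⟨fun z => if z ∈ A then 1 else 0, memℓp_gen (summable_of_ne_finset_zero (s := A) fun z hz => by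
    simp [hz])⟩

open Classical in
theorem finIndicator_apply (A : Finset (Config d n p)) (z : Config d n p) :
    finIndicator A z = if z ∈ A then 1 else 0 := rfl

theorem finIndicator_nonneg (A : Finset (Config d n p)) (z : Config d n p) :
    0 ≤ finIndicator A z := by
  rw [finIndicator_apply]
  split_ifs <;> simp

theorem inner_finIndicator (A : Finset (Config d n p)) (f : L2 d n p) :
    inner ℝ (finIndicator A) f = ∑ z ∈ A, f z := by
  rw [inner_eq_tsum, tsum_eq_sum (s := A) fun z hz => by simp [finIndicator_apply, hz]]
  exact Finset.sum_congr rfl fun z hz => by simp [finIndicator_apply, hz]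

/-- On the finite support of f the minimum of F/f serves as c. -/
theorem exists_pos_mul_le {Z : Type*} (A : Finset Z) {f F : Z → ℝ} (hf : ∀ z, 0 ≤ f z)
    (hA : ∀ z, z ∉ A → f z = 0) (hF : ∀ z, 0 ≤ F z) (hpos : ∀ z, f z ≠ 0 → 0 < F z) :
    ∃ c, 0 < c ∧ ∀ z, c * f z ≤ F z := by
  classical
  rcases (A.filter fun z => f z ≠ 0).eq_empty_or_nonempty with h | h
  · refine ⟨1, one_pos, fun z => ?_⟩
    have hz : f z = 0 := by
      by_contra hz
      have hzA : z ∈ A := by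
        by_contra hzA
        exact hz (hA z hzA)
      have hmem : z ∈ A.filter fun z => f z ≠ 0 := Finset.mem_filter.2 ⟨hzA, hz⟩
      rw [h] at hmem
      exact absurd hmem (Finset.notMem_empty z)
    rw [hz, mul_zero]
    exact hF z
  · obtain ⟨w, hw, hmin⟩ := Finset.exists_min_image _ (fun z => F z / f z) h
    have hw0 := (Finset.mem_filter.1 hw).2
    refine ⟨F w / f w, div_pos (hpos w hw0) (lt_of_le_of_ne (hf w) hw0.symm), fun z => ?_⟩
    rcases eq_or_ne (f z) 0 with hz | hz
    · rw [hz, mul_zero]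
      exact hF z
    · have hzA : z ∈ A := by
        by_contra hzA
        exact hz (hA z hzA)
      have h1 := hmin z (Finset.mem_filter.2 ⟨hzA, hz⟩)
      exact (le_div_iff₀ (lt_of_le_of_ne (hf z) hz.symm)).1 h1

section MomentGrowth

variable [NeZero d] {Ω : Type*} [MeasurableSpace Ω] {P : Measure Ω} [IsProbabilityMeasure P]
  {Y : Fin n → ℝ≥0 → Ω → Lattice d} (κ : ℝ≥0) {ρ : ℝ≥0}

theorem integral_sol_pow_pos (hY : ∀ k, IsSimpleRandomWalk P ρ (Y k))
    (hindep : iIndepFun (fun k ω t => Y k t ω) P) (p : ℕ) {t : ℝ} (ht : 0 ≤ t) :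
    0 < ∫ ω, sol κ Y 0 t ω ^ p ∂P := by
  have hpos : 0 < NormedSpace.exp (t • andersonOp d n p κ ρ) (finIndicator {0}) 0 :=
    exp_andersonOp_apply_pos_self κ ρ (finIndicator_nonneg _) (by simp [finIndicator_apply]) ht
  have hle := exp_andersonOp_apply_le_moment κ hY hindep (finIndicator_nonneg {0}) (fun z => by
    rw [finIndicator_apply]
    by_cases hz : z = 0
    · simp [hz]
    · rw [if_neg (by simpa using hz)]
      split_ifs <;> simp) ht (0 : Config d n p)
  exact (hpos.trans_le hle).trans_le
    (le_hasSum (hasSum_moment κ hY t) 0 fun y _ => moment_nonneg κ hY hindep ht _)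

/-- The form of the conjugated operator exceeds that of L_p by at most ε‖f‖² once θ is small, so its
semigroup grows no faster than exp((S + ε)t). A single value is bounded by the l² norm, and the
factor exp(-θ|y|₁) makes the sum over final positions finite. -/
theorem exists_integral_sol_pow_le (hY : ∀ k, IsSimpleRandomWalk P ρ (Y k))
    (hindep : iIndepFun (fun k ω t => Y k t ω) P) {S : ℝ}
    (hS : ∀ f : L2 d n p, inner ℝ f (andersonOp d n p κ ρ f) ≤ S * ‖f‖ ^ 2) {ε : ℝ} (hε : 0 < ε) :
    ∃ C, ∀ t : ℝ, 0 ≤ t → ∫ ω, sol κ Y 0 t ω ^ p ∂P ≤ C * Real.exp ((S + ε) * t) := by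
  obtain ⟨θ, hθ, hθε⟩ : ∃ θ : ℝ, 0 < θ ∧ totalRate d n p κ ρ * (Real.exp |θ| - 1) < ε := by
    have hc : Continuous fun θ : ℝ => totalRate d n p κ ρ * (Real.exp |θ| - 1) := by fun_prop
    have h0 : Tendsto (fun θ : ℝ => totalRate d n p κ ρ * (Real.exp |θ| - 1)) (𝓝[>] 0) (𝓝 0) := by
      have := hc.tendsto 0
      simp only [abs_zero, Real.exp_zero, sub_self, mul_zero] at this
      exact this.mono_left nhdsWithin_le_nhds
    obtain ⟨θ, h1, h2⟩ := ((h0.eventually_lt_const hε).and self_mem_nhdsWithin).exists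
    exact ⟨θ, h2, h1⟩
  have hform : ∀ f : L2 d n p, inner ℝ f (tiltedOp d n p κ ρ θ f) ≤ (S + ε) * ‖f‖ ^ 2 := by
    intro f
    have h1 : inner ℝ f ((tiltedOp d n p κ ρ θ - andersonOp d n p κ ρ) f) ≤ ε * ‖f‖ ^ 2 :=
      calc _ ≤ ‖f‖ * ‖(tiltedOp d n p κ ρ θ - andersonOp d n p κ ρ) f‖ := real_inner_le_norm _ _
        _ ≤ ‖f‖ * (ε * ‖f‖) := by
            refine mul_le_mul_of_nonneg_left ((ContinuousLinearMap.le_opNorm _ _).trans ?_)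
              (norm_nonneg _)
            exact mul_le_mul_of_nonneg_right ((norm_tiltedOp_sub_le κ ρ θ).trans hθε.le)
              (norm_nonneg _)
        _ = _ := by ring
    have h2 := hS f
    rw [_root_.sub_apply, inner_sub_right] at h1
    linarith
  have hsum := summable_exp_neg_mul_sum_abs hθ d n
  refine ⟨(∑' y : Fin n → Lattice d, Real.exp (-θ * ∑ k, ∑ i, |(y k i : ℝ)|)) *
    ‖tiltedInit d n p hθ‖, fun t ht => ?_⟩
  rw [mul_assoc]
  refine hasSum_le (fun y => ?_) (hasSum_moment κ hY t) (hsum.hasSum.mul_right _)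
  rw [moment_eq κ hY hindep hθ ht, tilt_zero_mk, neg_mul]
  refine mul_le_mul_of_nonneg_left ?_ (Real.exp_pos _).le
  calc _ ≤ ‖NormedSpace.exp (t • tiltedOp d n p κ ρ θ) (tiltedInit d n p hθ)‖ :=
        (Real.le_norm_self _).trans (lp.norm_apply_le_norm two_ne_zero _ _)
    _ ≤ _ := norm_exp_smul_apply_le hform _ ht
    _ = _ := mul_comm _ _

theorem inner_exp_le_integral_sol_pow (hY : ∀ k, IsSimpleRandomWalk P ρ (Y k))
    (hindep : iIndepFun (fun k ω t => Y k t ω) P) (B₁ : Finset (Fin p → Lattice d))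
    (B₂ : Finset (Fin n → Lattice d)) {t : ℝ} (ht : 0 ≤ t) :
    inner ℝ (finIndicator ({0} ×ˢ B₂)) (NormedSpace.exp (t • andersonOp d n p κ ρ)
      (finIndicator (B₁ ×ˢ {0}))) ≤ ∫ ω, sol κ Y 0 t ω ^ p ∂P := by
  rw [inner_finIndicator, Finset.sum_product, Finset.sum_singleton]
  refine le_trans (Finset.sum_le_sum fun y _ => exp_andersonOp_apply_le_moment κ hY hindep
    (finIndicator_nonneg _) (fun z => ?_) ht (0, y))
    (sum_le_hasSum B₂ (fun y _ => moment_nonneg κ hY hindep ht _) (hasSum_moment κ hY t))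
  rw [finIndicator_apply]
  by_cases hz : z.2 = 0
  · rw [if_pos hz]
    split_ifs <;> simp
  · rw [if_neg hz, if_neg]
    exact fun h => hz (Finset.mem_singleton.1 (Finset.mem_product.1 h).2)

/-- From {0} × B₂ one spreads only in x, from B₁ × {0} only in y; together the two ends cover the
support of g, whichever particles are mobile. This takes one unit of time at each end, whence t ≥ 2.
-/
theorem exists_le_integral_sol_pow (hn : 1 ≤ n) (hp : 1 ≤ p)
    (hY : ∀ k, IsSimpleRandomWalk P ρ (Y k))
    (hindep : iIndepFun (fun k ω t => Y k t ω) P) (f : L2 d n p) {b : ℝ}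
    (hf : b * ‖f‖ ^ 2 < inner ℝ f (andersonOp d n p κ ρ f)) :
    ∃ c, 0 < c ∧ ∀ t : ℝ, 2 ≤ t → c * Real.exp (b * t) ≤ ∫ ω, sol κ Y 0 t ω ^ p ∂P := by
  classical
  obtain ⟨A, g, hg, hgA, hgκ, hgρ, hgb⟩ := exists_test hn hp κ ρ f hf
  have hg0 : 0 < ‖g‖ := by
    refine norm_pos_iff.2 fun h => ?_
    simp [h] at hgb
  set L := andersonOp d n p κ ρ with hL
  have hmem : ∀ z, g z ≠ 0 → z ∈ A := fun z hz => by
    by_contra hzA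
    exact hz (hgA z hzA)
  set χ₁ : L2 d n p := finIndicator ({0} ×ˢ A.image Prod.snd) with hχ₁
  set χ₂ : L2 d n p := finIndicator (A.image Prod.fst ×ˢ {0}) with hχ₂
  have hχ₁0 : ∀ z, 0 ≤ χ₁ z := finIndicator_nonneg _
  have hχ₂0 : ∀ z, 0 ≤ χ₂ z := finIndicator_nonneg _
  set F₁ := NormedSpace.exp ((1 : ℝ) • L) χ₁ with hF₁
  set F₂ := NormedSpace.exp ((1 : ℝ) • L) χ₂ with hF₂
  obtain ⟨c₁, hc₁, h₁⟩ : ∃ c, 0 < c ∧ ∀ z, c * g z ≤ F₁ z := by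
    refine exists_pos_mul_le A hg hgA (exp_andersonOp_apply_nonneg κ ρ hχ₁0 zero_le_one)
      fun z hz => ?_
    refine exp_andersonOp_apply_pos_of_fst κ ρ hχ₁0 z.1 z.2 (fun hκ => ?_) ?_ one_pos
    · by_contra h
      exact hz (hgκ hκ z h)
    · rw [hχ₁, finIndicator_apply, if_pos]
      · exact one_pos
      · exact Finset.mem_product.2 ⟨Finset.mem_singleton_self _,
          Finset.mem_image.2 ⟨z, hmem z hz, rfl⟩⟩
  obtain ⟨c₂, hc₂, h₂⟩ : ∃ c, 0 < c ∧ ∀ z, c * g z ≤ F₂ z := by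
    refine exists_pos_mul_le A hg hgA (exp_andersonOp_apply_nonneg κ ρ hχ₂0 zero_le_one)
      fun z hz => ?_
    refine exp_andersonOp_apply_pos_of_snd κ ρ hχ₂0 z.1 z.2 (fun hρ => ?_) ?_ one_pos
    · by_contra h
      exact hz (hgρ hρ z h)
    · rw [hχ₂, finIndicator_apply, if_pos]
      · exact one_pos
      · exact Finset.mem_product.2 ⟨Finset.mem_image.2 ⟨z, hmem z hz, rfl⟩,
          Finset.mem_singleton_self _⟩
  -- The factor exp(-2b) accounts for the two units of time spent spreading.
  refine ⟨c₁ * c₂ * ‖g‖ ^ 2 * Real.exp (-(2 * b)), by positivity, fun t ht => ?_⟩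
  have ht2 : 0 ≤ t - 2 := by linarith
  set E := NormedSpace.exp ((t - 2) • L) with hE
  have hsplit : NormedSpace.exp (t • L) = NormedSpace.exp ((1 : ℝ) • L) *
      (E * NormedSpace.exp ((1 : ℝ) • L)) := by
    rw [hE, exp_smul_mul_exp_smul, exp_smul_mul_exp_smul]
    congr 2
    ring
  have hinner : inner ℝ χ₁ (NormedSpace.exp (t • L) χ₂) = inner ℝ F₁ (E F₂) := by
    rw [hsplit, mul_apply_eq_comp, mul_apply_eq_comp, hF₁,
      inner_exp_smul_comm (isSelfAdjoint_andersonOp κ ρ)]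
  have hEF : ∀ z, 0 ≤ E F₂ z :=
    exp_andersonOp_apply_nonneg κ ρ (exp_andersonOp_apply_nonneg κ ρ hχ₂0 zero_le_one) ht2
  have hEd : ∀ z, 0 ≤ E (F₂ - c₂ • g) z := exp_andersonOp_apply_nonneg κ ρ (fun z =>
    sub_nonneg.2 (h₂ z)) ht2
  -- F₁ and F₂ are replaced by c₁ g and c₂ g one at a time; each replacement lowers the inner
  -- product because the other entry stays nonnegative.
  have hi₁ : 0 ≤ inner ℝ (F₁ - c₁ • g) (E F₂) := inner_nonneg_of_nonneg (fun z =>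
    sub_nonneg.2 (h₁ z)) hEF
  have hi₂ : 0 ≤ inner ℝ g (E (F₂ - c₂ • g)) := inner_nonneg_of_nonneg hg hEd
  rw [inner_sub_left, real_inner_smul_left] at hi₁
  rw [map_sub, map_smul, inner_sub_right, real_inner_smul_right] at hi₂
  have hexp := exp_mul_norm_sq_le_inner_exp (isSelfAdjoint_andersonOp κ ρ) hgb.le ht2
  calc c₁ * c₂ * ‖g‖ ^ 2 * Real.exp (-(2 * b)) * Real.exp (b * t)
      = c₁ * (c₂ * (Real.exp (b * (t - 2)) * ‖g‖ ^ 2)) := by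
        rw [mul_assoc, ← Real.exp_add, show -(2 * b) + b * t = b * (t - 2) by ring]
        ring
    _ ≤ c₁ * (c₂ * inner ℝ g (E g)) := by gcongr
    _ ≤ c₁ * inner ℝ g (E F₂) := by gcongr; linarith
    _ ≤ inner ℝ F₁ (E F₂) := by linarith
    _ ≤ _ := by
        rw [← hinner]
        exact inner_exp_le_integral_sol_pow κ hY hindep _ _ (by linarith)

end MomentGrowth

theorem tendsto_log_div_of_exp_bounds {m : ℝ → ℝ} {S : ℝ}
    (hu : ∀ ε, 0 < ε → ∃ C, ∀ᶠ t in atTop, m t ≤ C * Real.exp ((S + ε) * t))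
    (hl : ∀ ε, 0 < ε → ∃ c, 0 < c ∧ ∀ᶠ t in atTop, c * Real.exp ((S - ε) * t) ≤ m t) :
    Tendsto (fun t => Real.log (m t) / t) atTop (𝓝 S) := by
  have hdiv : ∀ c : ℝ, Tendsto (fun t : ℝ => c / t) atTop (𝓝 0) := fun c =>
    tendsto_const_nhds.div_atTop tendsto_id
  rw [tendsto_order]
  constructor
  · intro a ha
    obtain ⟨c, hc, h⟩ := hl ((S - a) / 2) (by linarith)
    filter_upwards [h, eventually_gt_atTop 0,
      (hdiv (Real.log c)).eventually_const_lt (show -((S - a) / 2) < 0 by linarith)]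
      with t h1 ht h2
    have h3 := Real.log_le_log (by positivity) h1
    rw [Real.log_mul hc.ne' (Real.exp_pos _).ne', Real.log_exp] at h3
    rw [lt_div_iff₀ ht] at h2 ⊢
    nlinarith
  · intro a ha
    -- The lower bound enters only to make m eventually positive, so that logarithms may be taken.
    obtain ⟨c, hc, h⟩ := hl 1 one_pos
    obtain ⟨C, h'⟩ := hu ((a - S) / 2) (by linarith)
    filter_upwards [h, h', eventually_gt_atTop 0,
      (hdiv (Real.log C)).eventually_lt_const (show 0 < (a - S) / 2 by linarith)]
      with t h0 h1 ht h2
    have hm : 0 < m t := lt_of_lt_of_le (by positivity) h0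
    have hC : 0 < C := pos_of_mul_pos_left (hm.trans_le h1) (Real.exp_pos _).le
    have h3 := Real.log_le_log hm h1
    rw [Real.log_mul hC.ne' (Real.exp_pos _).ne', Real.log_exp] at h3
    rw [div_lt_iff₀ ht] at h2 ⊢
    nlinarith

end PAM

end

/-! ### The main theorem -/

theorem mainTheorem1 (d n p : ℕ) [NeZero d] (hn : 1 ≤ n) (hp : 1 ≤ p) (κ ρ : ℝ≥0)
    {Ω : Type*} [MeasurableSpace Ω] (P : Measure Ω) [IsProbabilityMeasure P]
    (Y : Fin n → ℝ≥0 → Ω → PAM.Lattice d)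
    (hY : ∀ k, PAM.IsSimpleRandomWalk P ρ (Y k))
    (hindep : iIndepFun (fun k ω t => Y k t ω) P) :
    -- for every realization of the catalysts the equation has exactly one solution
    (∀ ω, ∃ u, PAM.IsSolution κ (PAM.catalysts fun k t => Y k t ω) u ∧
      ∀ v, PAM.IsSolution κ (PAM.catalysts fun k t => Y k t ω) v →
        ∀ x t, 0 ≤ t → v x t = u x t) ∧
    ∃ S : ℝ,
      IsLUB {r : ℝ | ∃ f : PAM.L2 d n p, ‖f‖ = 1 ∧ r = PAM.energy κ ρ f} S ∧
      IsSelfAdjoint (PAM.andersonOp d n p κ ρ) ∧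
      IsGreatest (spectrum ℝ (PAM.andersonOp d n p κ ρ)) S ∧
      ∀ u : PAM.Lattice d → ℝ → Ω → ℝ,
        (∀ᵐ ω ∂P, PAM.IsSolution κ (PAM.catalysts fun k t => Y k t ω) (fun x t => u x t ω)) →
        (∀ t, 0 ≤ t → Integrable (fun ω => u 0 t ω ^ p) P ∧ 0 < ∫ ω, u 0 t ω ^ p ∂P) ∧
        Tendsto (fun t : ℝ => 1 / (p * t) * Real.log (∫ ω, u 0 t ω ^ p ∂P)) atTop
          (𝓝 (1 / p * S)) := by
  have hm : ∀ k t, Measurable (Y k t) := fun k => (hY k).measurable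
  have hrc : ∀ k ω t, ContinuousWithinAt (fun s => Y k s ω) (Set.Ici t) t :=
    fun k => (hY k).rightContinuous
  have huniq : ∀ ω v, PAM.IsSolution κ (PAM.catalysts fun k t => Y k t ω) v →
      ∀ x t, 0 ≤ t → v x t = PAM.sol κ Y x t ω := fun ω v hv x t ht =>
    hv.eq_of_agree (PAM.isSolution_sol κ hm hrc ω) (T := t) (PAM.abs_catalysts_le _)
      (fun _ _ _ => rfl) x t ⟨ht, le_rfl⟩
  refine ⟨fun ω => ⟨_, PAM.isSolution_sol κ hm hrc ω, huniq ω⟩, ?_⟩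
  have hset : {r : ℝ | ∃ f : PAM.L2 d n p, ‖f‖ = 1 ∧ r = PAM.energy κ ρ f} =
      {r | ∃ f : PAM.L2 d n p, ‖f‖ = 1 ∧ r = inner ℝ f (PAM.andersonOp d n p κ ρ f)} := by
    simp only [PAM.energy_eq_inner]
  obtain ⟨S, hS⟩ : ∃ S, IsLUB {r : ℝ | ∃ f : PAM.L2 d n p, ‖f‖ = 1 ∧
      r = inner ℝ f (PAM.andersonOp d n p κ ρ f)} S := by
    refine ⟨_, isLUB_csSup ⟨_, lp.single 2 (0 : PAM.Config d n p) (1 : ℝ), ?_, rfl⟩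
      ⟨‖PAM.andersonOp d n p κ ρ‖, ?_⟩⟩
    · rw [lp.norm_single (by norm_num), norm_one]
    · rintro r ⟨f, hf, rfl⟩
      refine (real_inner_le_norm _ _).trans ?_
      rw [hf, one_mul]
      simpa [hf] using (PAM.andersonOp d n p κ ρ).le_opNorm f
  have hform := PAM.inner_apply_le_mul_norm_sq fun f hf => hS.1 ⟨f, hf, rfl⟩
  refine ⟨S, hset ▸ hS, PAM.isSelfAdjoint_andersonOp κ ρ,
    PAM.isGreatest_spectrum_of_isLUB (PAM.isSelfAdjoint_andersonOp κ ρ) hS, fun u hu => ?_⟩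
  -- No measurability of u is assumed: by uniqueness it agrees almost surely with the measurable
  -- Picard solution.
  have hu_sol : ∀ t, 0 ≤ t →
      (fun ω => u 0 t ω ^ p) =ᵐ[P] fun ω => PAM.sol κ Y 0 t ω ^ p := fun t ht => by
    filter_upwards [hu] with ω hω
    rw [huniq ω _ hω 0 t ht]
  refine ⟨fun t ht => ⟨?_, ?_⟩, ?_⟩
  · refine Integrable.congr ?_ (hu_sol t ht).symm
    refine PAM.integrable_of_abs_le ((PAM.measurable_sol κ hm hrc 0 t).pow_const p)
      (C := Real.exp (PAM.growth d n κ * t) ^ p) fun ω => ?_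
    have := PAM.abs_solProd_le κ hm hrc ht le_rfl (0 : Fin p → PAM.Lattice d) ω
    simpa [PAM.solProd] using this
  · rw [integral_congr_ae (hu_sol t ht)]
    exact PAM.integral_sol_pow_pos κ hY hindep p ht
  · have hlim : Tendsto (fun t => Real.log (∫ ω, PAM.sol κ Y 0 t ω ^ p ∂P) / t) atTop (𝓝 S) := by
      refine PAM.tendsto_log_div_of_exp_bounds (fun ε hε => ?_) fun ε hε => ?_
      · obtain ⟨C, hC⟩ := PAM.exists_integral_sol_pow_le κ hY hindep hform hε
        exact ⟨C, (eventually_ge_atTop 0).mono hC⟩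
      -- A unit vector whose form exceeds S - ε exists because S is the least upper bound.
      · obtain ⟨r, ⟨f, hf, rfl⟩, hr⟩ := (lt_isLUB_iff hS).1 (sub_lt_self S hε)
        obtain ⟨c, hc, h⟩ := PAM.exists_le_integral_sol_pow κ hn hp hY hindep f (b := S - ε)
          (by rwa [hf, one_pow, mul_one])
        exact ⟨c, hc, (eventually_ge_atTop 2).mono h⟩
    refine (hlim.const_mul (1 / (p : ℝ))).congr' ?_
    filter_upwards [eventually_ge_atTop 0] with t ht
    rw [integral_congr_ae (hu_sol t ht)]
    ring
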